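/- Let $\Gamma>0$ and $s>1$. For $2\pi$-periodic (in $\phi$) real-valued functions $U(\zeta,\phi)=\sum_{p\ \mathrm{odd}}U_p(\zeta)e^{ip\phi}$ with only odd harmonics, let $X^s$ be the space of such $U\in H^s(\mathbb R\times\mathbb T)$ (taken as continuous functions, since $s>1$), with norm $$\|U\|_{X^s}=\Big(\sum_{p\ \mathrm{odd}}\int_{\mathbb R}(p^2+\xi^2)^s|\widehat U_p(\xi)|^2\,d\xi\Big)^{1/2}.$$ For $\epsilon\in\mathbb R$ consider the interpolating system xNLS$^\epsilon$: for all odd $p\in\mathbb Z$, $$U_p''-p^2U_p+6p^2\Gamma U_p^3+\frac{2p^2}{3}\,\epsilon\,\Gamma\Big(3U_p\sum_{q}|U_q|^2+\sum_{q,r}U_qU_rU_{p-q-r}\Big)=0,$$ where the sums run over odd $q$ and odd $q,r$ and exclude the self-interaction terms, i.e. the terms with $|q|=|p|$ in the first sum and those with $|q|=|r|=|p-q-r|=|p|$ in the second. Only solutions with real envelopes are considered: $U_p=\overline{U_p}=U_{-p}$ for all odd $p$. Let $U_\star(\zeta)=(3\Gamma)^{-1/2}\operatorname{sech}\zeta$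 and $\mathcal U_\star(\zeta,\phi)=2U_\star(\zeta)\cos\phi$, which solves the system for $\epsilon=0$. Then there are $\epsilon_0>0$, $C>0$ and $\delta>0$ (depending only on $s$ and $\Gamma$) such that for every $\epsilon\in(-\epsilon_0,\epsilon_0)$ the system xNLS$^\epsilon$ has exactly one solution $U\in X^s$ with real envelopes that is even in space, $U_p(\zeta)=U_p(-\zeta)$, and satisfies $\|U-\mathcal U_\star\|_{X^s}<\delta$. This solution is localized, i.e. $U(\zeta,\phi)\to0$ as $|\zeta|\to\infty$ for every $\phi$, and $$\|U-\mathcal U_\star\|_{X^s}\le C|\epsilon|.$$ -/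

import Mathlib

open MeasureTheory Filter Topology
open scoped ENNReal FourierTransform ComplexConjugate

noncomputable section

namespace XNLS

/-- The `p`-th Fourier mode `U_p(ζ) = (1/2π) ∫_{-π}^{π} U(ζ,φ) e^{-ipφ} dφ` of a function
`U(ζ,φ)` that is `2π`-periodic in `φ`. -/
def mode (U : ℝ → ℝ → ℝ) (p : ℤ) (ζ : ℝ) : ℂ :=
  (1 / (2 * Real.pi) : ℂ) *
    ∫ φ in (-Real.pi)..Real.pi, (U ζ φ : ℂ) * Complex.exp (-(Complex.I * p * φ))

open Classical in
/-- The contribution `∫ (p² + ξ²)^s |f̂(ξ)|² dξ` of the `p`-th mode `f` to the squared norm of `X^s`;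
it is `∞` if `f` is not square integrable. Here `f̂` is the Fourier-Plancherel transform on `L²`,
and the frequency is written as `ξ = 2πη`, since Mathlib's transform has the kernel `e^{-2πiηζ}`
(then `|f̂(ξ)|² dξ` for the unitary transform in `ξ` is `|𝓕 f(η)|² dη`). -/
def modeEnergy (s : ℝ) (p : ℤ) (f : ℝ → ℂ) : ℝ≥0∞ :=
  if h : MemLp f 2 (volume : Measure ℝ) then
    ∫⁻ η : ℝ, ENNReal.ofReal (((p : ℝ) ^ 2 + (2 * Real.pi * η) ^ 2) ^ s) *
      ‖(𝓕 (h.toLp f) : Lp ℂ 2 (volume : Measure ℝ)) η‖ₑ ^ 2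
  else ⊤

/-- The norm of `X^s`, with values in `[0,∞]`:
`‖U‖ = (∑_{p odd} ∫ (p² + ξ²)^s |Û_p(ξ)|² dξ)^{1/2}`. -/
def xNorm (s : ℝ) (U : ℝ → ℝ → ℝ) : ℝ≥0∞ :=
  (∑' p : {p : ℤ // Odd p}, modeEnergy s p (mode U p)) ^ (1 / 2 : ℝ)

/-- The space `X^s` for `s > 1`: the real-valued functions in `H^s(ℝ × 𝕋)` whose even harmonics
vanish. As `H^s(ℝ × 𝕋)` embeds into the continuous functions for `s > 1`, each class is given by
its continuous representative. -/
structure MemX (s : ℝ) (U : ℝ → ℝ → ℝ) : Prop where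
  continuous : Continuous (Function.uncurry U)
  periodic : ∀ ζ, Function.Periodic (U ζ) (2 * Real.pi)
  even_harmonics : ∀ p : ℤ, Even p → ∀ ζ, mode U p ζ = 0
  norm_lt_top : xNorm s U < ⊤

/-- The envelope of each harmonic is real, and `U_{-p} = U_p`. -/
def RealEnvelopes (U : ℝ → ℝ → ℝ) : Prop :=
  ∀ (p : ℤ) (ζ : ℝ), conj (mode U p ζ) = mode U p ζ ∧ mode U (-p) ζ = mode U p ζ

/-- Even symmetry in the space variable: `U_p(ζ) = U_p(-ζ)`. -/
def EvenModes (U : ℝ → ℝ → ℝ) : Prop :=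
  ∀ (p : ℤ) (ζ : ℝ), mode U p ζ = mode U p (-ζ)

/-- Indices `q` of the sum `∑ |U_q|²` without self-interaction in the equation of mode `p`. -/
def crossIndex (p : ℤ) : Set ℤ :=
  {q | Odd q ∧ |q| ≠ |p|}

/-- Indices `(q, r)` of the sum `∑ U_q U_r U_{p-q-r}` without self-interaction in the equation of
mode `p`: the terms with all three of `q`, `r`, `p-q-r` equal to `p` or `-p` are left out (when
`U_{-p} = U_p` is real, they are exactly the terms equal to `U_p³` for that reason). -/
def mixIndex (p : ℤ) : Set (ℤ × ℤ) :=
  {m | Odd m.1 ∧ Odd m.2 ∧ ¬(|m.1| = |p| ∧ |m.2| = |p| ∧ |p - m.1 - m.2| = |p|)}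

/-- `3 U_p ∑_q |U_q|² + ∑_{q,r} U_q U_r U_{p-q-r}`, without the self-interaction terms. -/
def coupling (U : ℝ → ℝ → ℝ) (p : ℤ) (ζ : ℝ) : ℂ :=
  3 * mode U p ζ * ∑' q : crossIndex p, ((‖mode U q ζ‖ ^ 2 : ℝ) : ℂ) +
    ∑' m : mixIndex p, mode U m.1.1 ζ * mode U m.1.2 ζ * mode U (p - m.1.1 - m.1.2) ζ

/-- `U` solves the interpolating system with parameter `ε`: the modes are twice continuously
differentiable, the series converge absolutely, and for every odd `p`
`U_p'' - p² U_p + 6 p² Γ U_p³ + (2p²/3) ε Γ (3 U_p ∑_q |U_q|² + ∑_{q,r} U_q U_r U_{p-q-r}) = 0`,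
where the sums exclude the self-interaction terms. -/
structure Solves (Γ ε : ℝ) (U : ℝ → ℝ → ℝ) : Prop where
  contDiff : ∀ p : ℤ, Odd p → ContDiff ℝ 2 (mode U p)
  summable_cross : ∀ p : ℤ, Odd p → ∀ ζ,
    Summable fun q : crossIndex p => ‖mode U q ζ‖ ^ 2
  summable_mix : ∀ p : ℤ, Odd p → ∀ ζ,
    Summable fun m : mixIndex p =>
      ‖mode U m.1.1 ζ * mode U m.1.2 ζ * mode U (p - m.1.1 - m.1.2) ζ‖
  equation : ∀ p : ℤ, Odd p → ∀ ζ : ℝ,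
    deriv (deriv (mode U p)) ζ - (p : ℂ) ^ 2 * mode U p ζ
      + 6 * (p : ℂ) ^ 2 * (Γ : ℂ) * mode U p ζ ^ 3
      + 2 * (p : ℂ) ^ 2 / 3 * (ε : ℂ) * (Γ : ℂ) * coupling U p ζ = 0

/-- The NLS soliton `U_*(ζ) = (3Γ)^{-1/2} sech ζ`. -/
def soliton (Γ : ℝ) (ζ : ℝ) : ℝ :=
  1 / Real.sqrt (3 * Γ) * (1 / Real.cosh ζ)

/-- The monochromatic soliton `2 U_*(ζ) cos φ`. -/
def monoSoliton (Γ : ℝ) (ζ φ : ℝ) : ℝ :=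
  2 * soliton Γ ζ * Real.cos φ

/-- An even solution of the interpolating system in `X^s` with real envelopes. -/
structure IsEvenSolution (s Γ ε : ℝ) (U : ℝ → ℝ → ℝ) : Prop where
  memX : MemX s U
  realEnvelopes : RealEnvelopes U
  evenModes : EvenModes U
  solves : Solves Γ ε U

end XNLS

end

/-!
On the Fourier side the system reads `u = T(u, u, u)`: the resolvents `p² (p² - ∂²)⁻¹` are applied
to trilinear convolutions of the Fourier transform `u` of the field, a function on `ℤ × ℝ`. A
bounded solution of the differential equations is determined by its right-hand side, so solutions
of the system are exactly the solutions of this equation. For `s > 1` the weighted `L²` space is an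
algebra under convolution, hence `T` is a bounded trilinear map there, affine in `ε`, and the
implicit function theorem applies at `ε = 0` once the derivative at the soliton is invertible. That
derivative is the identity minus a compact operator, because the soliton decays; and it is injective
on even functions: the kernel consists of bounded solutions of the linearized soliton equation in
the harmonics `±1`, and the Wronskian with `U_⋆'` leaves only the odd solution `U_⋆'` itself.
-/

noncomputable section

namespace XNLS

/-! ### The Fourier transform on `L¹ ∩ L²` -/

section FourierL2

variable {V E : Type*} [NormedAddCommGroup V] [InnerProductSpace ℝ V] [FiniteDimensional ℝ V]
  [MeasurableSpace V] [BorelSpace V] [NormedAddCommGroup E]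

theorem continuous_fourierInv [NormedSpace ℂ E] {g : V → E} (hg : Integrable g) :
    Continuous (𝓕⁻ g) := by
  rw [Real.fourierInv_eq_fourier_comp_neg]
  exact VectorFourier.fourierIntegral_continuous Real.continuous_fourierChar
    continuous_inner hg.comp_neg

theorem norm_fourierInv_le [NormedSpace ℂ E] (g : V → E) (x : V) : ‖𝓕⁻ g x‖ ≤ ∫ ξ, ‖g ξ‖ :=
  VectorFourier.norm_fourierIntegral_le_integral_norm _ _ _ _ _

theorem integral_fourierInv_smul_eq [NormedSpace ℂ E] [CompleteSpace E] {f : V → ℂ} {g : V → E}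
    (hf : Integrable f) (hg : Integrable g) : ∫ x, 𝓕⁻ f x • g x = ∫ x, f x • 𝓕⁻ g x := by
  have hflip : (-innerₗ V).flip = -innerₗ V := by
    ext; simp [real_inner_comm]
  simpa only [hflip] using! VectorFourier.integral_fourierIntegral_smul_eq_flip
    (L := -innerₗ V) Real.continuous_fourierChar continuous_inner.neg hf hg

variable [InnerProductSpace ℂ E] [CompleteSpace E]

theorem fourierInv_ae_eq_coe_fourierInv_toLp {g : V → E} (hg : Integrable g) (hg2 : MemLp g 2) :
    𝓕⁻ g =ᵐ[volume] (𝓕⁻ (hg2.toLp g) : Lp E 2 (volume : Measure V)) := by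
  refine ae_eq_of_integral_contDiff_smul_eq (continuous_fourierInv hg).locallyIntegrable
    ((Lp.memLp _).locallyIntegrable one_le_two) fun φ hφ hφc => ?_
  have hc : HasCompactSupport (Complex.ofRealCLM ∘ φ) := hφc.comp_left rfl
  let ψ : SchwartzMap V ℂ := hc.toSchwartzMap (by fun_prop)
  calc ∫ x, φ x • 𝓕⁻ g x = ∫ x, ψ x • 𝓕⁻ g x := rfl
    _ = ∫ x, 𝓕⁻ (ψ : V → ℂ) x • g x := (integral_fourierInv_smul_eq ψ.integrable hg).symm
    _ = ∫ x, (𝓕⁻ ψ : SchwartzMap V ℂ) x • hg2.toLp g x := by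
      refine integral_congr_ae ?_
      filter_upwards [hg2.coeFn_toLp] with x hx
      rw [hx, SchwartzMap.fourierInv_coe]
    _ = ∫ x, ψ x • (𝓕⁻ (hg2.toLp g) : Lp E 2 (volume : Measure V)) x := by
      simpa only [TemperedDistribution.fourierInv_apply, Lp.toTemperedDistribution_apply] using
        DFunLike.congr_fun (Lp.fourierInv_toTemperedDistribution_eq (hg2.toLp g)) ψ

theorem memLp_fourierInv {g : V → E} (hg : Integrable g) (hg2 : MemLp g 2) :
    MemLp (𝓕⁻ g) 2 :=
  (memLp_congr_ae (fourierInv_ae_eq_coe_fourierInv_toLp hg hg2)).2 (Lp.memLp _)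

theorem fourier_toLp_fourierInv {g : V → E} (hg : Integrable g) (hg2 : MemLp g 2)
    (h : MemLp (𝓕⁻ g) 2) : 𝓕 (h.toLp (𝓕⁻ g)) = hg2.toLp g := by
  have : h.toLp (𝓕⁻ g) = 𝓕⁻ (hg2.toLp g) := by
    ext1
    exact h.coeFn_toLp.trans (fourierInv_ae_eq_coe_fourierInv_toLp hg hg2)
  rw [this, FourierTransform.fourier_fourierInv_eq]

theorem ae_eq_of_fourierInv_eq {f g : V → E} (hf : Integrable f) (hf2 : MemLp f 2)
    (hg : Integrable g) (hg2 : MemLp g 2) (h : 𝓕⁻ f = 𝓕⁻ g) : f =ᵐ[volume] g := by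
  have hL2 : (memLp_fourierInv hf hf2).toLp _ = (memLp_fourierInv hg hg2).toLp _ :=
    (MemLp.toLp_eq_toLp_iff _ _).2 (by rw [h])
  rw [← MemLp.toLp_eq_toLp_iff hf2 hg2, ← fourier_toLp_fourierInv hf hf2 (memLp_fourierInv hf hf2),
    hL2, fourier_toLp_fourierInv hg hg2]

theorem eq_fourierInv_of_integrable {f : V → E} (hf : Continuous f) (hf2 : MemLp f 2)
    (hi : Integrable (𝓕 (hf2.toLp f) : Lp E 2 (volume : Measure V))) :
    f = 𝓕⁻ ((𝓕 (hf2.toLp f) : Lp E 2 (volume : Measure V)) : V → E) := by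
  refine (Continuous.ae_eq_iff_eq volume hf (continuous_fourierInv hi)).1 ?_
  refine EventuallyEq.trans ?_ (fourierInv_ae_eq_coe_fourierInv_toLp hi (Lp.memLp _)).symm
  rw [Lp.toLp_coeFn, FourierTransform.fourierInv_fourier_eq]
  exact hf2.coeFn_toLp.symm

end FourierL2

/-! ### The resolvent of the second derivative -/

/-- The Fourier symbol of `a² (a² - ∂²)⁻¹`, with the frequency `ξ` written as `2πη`. -/
def resolvent (a η : ℝ) : ℝ := a ^ 2 / (a ^ 2 + (2 * Real.pi * η) ^ 2)

theorem resolvent_nonneg (a η : ℝ) : 0 ≤ resolvent a η := by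
  unfold resolvent; positivity

theorem resolvent_le_one (a η : ℝ) : resolvent a η ≤ 1 :=
  div_le_one_of_le₀ (le_add_of_nonneg_right (sq_nonneg _)) (by positivity)

theorem measurable_resolvent (a : ℝ) : Measurable (resolvent a) := by
  unfold resolvent; fun_prop

theorem resolvent_neg_right (a η : ℝ) : resolvent a (-η) = resolvent a η := by
  simp only [resolvent, mul_neg, even_two, Even.neg_pow]

theorem resolvent_neg_left (a η : ℝ) : resolvent (-a) η = resolvent a η := by
  simp only [resolvent, even_two, Even.neg_pow]

theorem resolvent_mul_symbol (a η : ℝ) :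
    resolvent a η * (a ^ 2 + (2 * Real.pi * η) ^ 2) = a ^ 2 :=
  div_mul_cancel_of_imp fun h => by nlinarith [sq_nonneg a, sq_nonneg (2 * Real.pi * η)]

theorem abs_pow_mul_resolvent_le (a η : ℝ) {k : ℕ} (hk : k ≤ 2) :
    |η| ^ k * resolvent a η ≤ 1 + a ^ 2 := by
  have hpow : |η| ^ k ≤ 1 + η ^ 2 := by
    interval_cases k <;> nlinarith [sq_abs η, sq_nonneg (|η| - 1)]
  have hpi : η ^ 2 ≤ (2 * Real.pi * η) ^ 2 := by
    rw [mul_pow]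
    exact le_mul_of_one_le_left (sq_nonneg η) (one_le_pow₀ (by linarith [Real.pi_gt_three]))
  calc |η| ^ k * resolvent a η ≤ (1 + η ^ 2) * resolvent a η := by
        gcongr; exact resolvent_nonneg a η
    _ ≤ 1 + a ^ 2 := by
        nlinarith [resolvent_le_one a η, resolvent_nonneg a η, resolvent_mul_symbol a η]

section Resolvent

variable {E : Type*} [NormedAddCommGroup E] [NormedSpace ℂ E] {f g : ℝ → E}

theorem fourier_sub (hf : Integrable f) (hg : Integrable g) (ζ : ℝ) :
    𝓕 (fun η => f η - g η) ζ = 𝓕 f ζ - 𝓕 g ζ := by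
  simp_rw [Real.fourier_eq, smul_sub]
  exact integral_sub ((Real.fourierIntegral_convergent_iff ζ).2 hf)
    ((Real.fourierIntegral_convergent_iff ζ).2 hg)

theorem integrable_pow_smul_resolvent (a : ℝ) (hg : Integrable g) {k : ℕ} (hk : k ≤ 2) :
    Integrable fun η : ℝ => η ^ k • (resolvent a η : ℂ) • g η := by
  have hmeas := measurable_resolvent a
  have h := hg.bdd_smul (φ := fun η : ℝ => ((η ^ k * resolvent a η : ℝ) : ℂ)) (1 + a ^ 2)
    (Measurable.aestronglyMeasurable (by fun_prop)) (ae_of_all _ fun η => ?_)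
  · refine h.congr (ae_of_all _ fun η => ?_)
    simp only [Pi.smul_apply', Complex.coe_smul, mul_smul]
  · rw [Complex.norm_real, norm_mul, norm_pow, Real.norm_eq_abs,
      Real.norm_of_nonneg (resolvent_nonneg a η)]
    exact abs_pow_mul_resolvent_le a η hk

theorem fourierInv_resolvent_smul (a : ℝ) (g : ℝ → E) :
    𝓕⁻ (fun η => (resolvent a η : ℂ) • g η) = 𝓕 fun η => (resolvent a η : ℂ) • g (-η) := by
  simp only [Real.fourierInv_eq_fourier_comp_neg, resolvent_neg_right]

theorem contDiff_fourierInv_resolvent_smul (a : ℝ) (hg : Integrable g) :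
    ContDiff ℝ 2 (𝓕⁻ fun η => (resolvent a η : ℂ) • g η) := by
  rw [fourierInv_resolvent_smul]
  refine Real.contDiff_fourier (N := 2) fun k hk => ?_
  simpa only [norm_smul, norm_pow] using
    (integrable_pow_smul_resolvent a hg.comp_neg (by exact_mod_cast hk)).norm

theorem exists_norm_deriv_fourierInv_resolvent_smul_le (a : ℝ) (hg : Integrable g) :
    ∃ M, ∀ ζ, ‖deriv (𝓕⁻ fun η => (resolvent a η : ℂ) • g η) ζ‖ ≤ M := by
  rw [fourierInv_resolvent_smul,
    Real.deriv_fourier (by simpa using integrable_pow_smul_resolvent a hg.comp_neg zero_le_two)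
      (by simpa using integrable_pow_smul_resolvent a hg.comp_neg one_le_two)]
  exact ⟨_, VectorFourier.norm_fourierIntegral_le_integral_norm _ _ _ _⟩

theorem deriv_deriv_fourierInv_resolvent_smul (a : ℝ) (hg : Integrable g) (ζ : ℝ) :
    deriv (deriv (𝓕⁻ fun η => (resolvent a η : ℂ) • g η)) ζ =
      (a : ℂ) ^ 2 • (𝓕⁻ (fun η => (resolvent a η : ℂ) • g η) ζ - 𝓕⁻ g ζ) := by
  rw [fourierInv_resolvent_smul, Real.fourierInv_eq_fourier_comp_neg g]
  have hg' := hg.comp_neg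
  have hf : Integrable fun η => (resolvent a η : ℂ) • g (-η) := by
    simpa using integrable_pow_smul_resolvent a hg' zero_le_two
  have hsymbol (x : ℝ) : (-2 * Real.pi * Complex.I * x) ^ 2 * (resolvent a x : ℂ) =
      (a : ℂ) ^ 2 * (resolvent a x - 1) := by
    have h : (resolvent a x : ℂ) * ((a : ℂ) ^ 2 + (2 * Real.pi * x) ^ 2) = (a : ℂ) ^ 2 := by
      exact_mod_cast resolvent_mul_symbol a x
    linear_combination 4 * (Real.pi : ℂ) ^ 2 * x ^ 2 * resolvent a x * Complex.I_sq - h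
  have hiter := Real.iteratedDeriv_fourier (N := 2) (n := 2)
    (fun k hk => integrable_pow_smul_resolvent a hg' (by exact_mod_cast hk)) le_rfl
  rw [← iteratedDeriv_one (f := deriv _), ← iteratedDeriv_succ', hiter]
  simp_rw [smul_smul, hsymbol, mul_smul, sub_smul, one_smul]
  exact (congrFun (VectorFourier.fourierIntegral_const_smul Real.fourierChar volume (innerₗ ℝ) _ _)
    ζ).trans (congrArg _ (fourier_sub hf hg' ζ))

end Resolvent

/-! ### Bounded solutions of linear equations -/

section BoundedSolutions

variable {E : Type*} [NormedAddCommGroup E] [NormedSpace ℝ E] {a : ℝ}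

theorem eq_exp_smul_of_hasDerivAt {f : ℝ → E} (h : ∀ x, HasDerivAt f (a • f x) x) (x : ℝ) :
    f x = Real.exp (a * x) • f 0 := by
  have hconst (y : ℝ) : HasDerivAt (fun y : ℝ => Real.exp (-(a * y)) • f y) 0 y := by
    have hexp : HasDerivAt (fun y : ℝ => Real.exp (-(a * y)))
        (Real.exp (-(a * y)) * -(a * 1)) y := ((hasDerivAt_id y).const_mul a).neg.exp
    refine (hexp.smul (h y)).congr_deriv ?_
    module
  have heq := is_const_of_deriv_eq_zero (fun y => (hconst y).differentiableAt)
    (fun y => (hconst y).deriv) x 0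
  simp only [mul_zero, neg_zero, Real.exp_zero, one_smul] at heq
  rw [← heq, smul_smul, ← Real.exp_add, add_neg_cancel, Real.exp_zero, one_smul]

theorem eq_zero_of_bounded_exp_smul_sub (ha : 0 < a) {b c : E} {M : ℝ}
    (hM : ∀ x : ℝ, ‖Real.exp (a * x) • b - Real.exp (-(a * x)) • c‖ ≤ M) : b = 0 := by
  have hlim : Tendsto (fun x : ℝ => Real.exp (-(a * x))) atTop (𝓝 0) :=
    Real.tendsto_exp_neg_atTop_nhds_zero.comp (tendsto_id.const_mul_atTop ha)
  have hdiff : Tendsto (fun x : ℝ => Real.exp (-(a * x)) •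
      (Real.exp (a * x) • b - Real.exp (-(a * x)) • c)) atTop (𝓝 0) :=
    hlim.zero_smul_isBoundedUnder_le (isBoundedUnder_of ⟨M, hM⟩)
  have hsum := hdiff.add (hlim.smul (hlim.smul_const c))
  simp only [zero_smul, smul_zero, add_zero, smul_sub, sub_add_cancel, smul_smul, ← Real.exp_add,
    neg_add_cancel, Real.exp_zero, one_smul] at hsum
  exact tendsto_nhds_unique tendsto_const_nhds hsum

theorem eq_zero_of_bounded_of_deriv_deriv_eq (ha : a ≠ 0) {f : ℝ → E} (hf : ContDiff ℝ 2 f)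
    (h : ∀ x, deriv (deriv f) x = a ^ 2 • f x) {M : ℝ} (hM : ∀ x, ‖f x‖ ≤ M) : f = 0 := by
  wlog hpos : 0 < a generalizing a
  · exact this (neg_ne_zero.2 ha) (by simpa only [neg_sq] using h)
      (neg_pos.2 (lt_of_le_of_ne (not_lt.1 hpos) ha))
  have hf0 (x : ℝ) : HasDerivAt f (deriv f x) x := (hf.differentiable two_ne_zero x).hasDerivAt
  have hf1 (x : ℝ) : HasDerivAt (deriv f) (a ^ 2 • f x) x := by
    rw [← h x]
    exact ((hf.deriv' (n := 1)).differentiable one_ne_zero x).hasDerivAt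
  have hgrow := eq_exp_smul_of_hasDerivAt (f := fun x => deriv f x + a • f x) (a := a)
    fun x => ((hf1 x).add ((hf0 x).const_smul a)).congr_deriv (by module)
  have hdecay := eq_exp_smul_of_hasDerivAt (f := fun x => deriv f x - a • f x) (a := -a)
    fun x => ((hf1 x).sub ((hf0 x).const_smul a)).congr_deriv (by module)
  set b := deriv f 0 + a • f 0
  set c := deriv f 0 - a • f 0
  have hsum (x : ℝ) : Real.exp (a * x) • b - Real.exp (-(a * x)) • c = (2 * a) • f x := by
    rw [← neg_mul, ← hgrow, ← hdecay]
    module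
  have hbound (x : ℝ) : ‖Real.exp (a * x) • b - Real.exp (-(a * x)) • c‖ ≤ 2 * a * M := by
    rw [hsum, norm_smul, Real.norm_of_nonneg (by positivity)]
    exact mul_le_mul_of_nonneg_left (hM x) (by positivity)
  have hb : b = 0 := eq_zero_of_bounded_exp_smul_sub hpos hbound
  have hc : c = 0 := eq_zero_of_bounded_exp_smul_sub hpos fun x => by
    simpa only [mul_neg, neg_neg, norm_sub_rev] using hbound (-x)
  funext x
  have hx := hsum x
  rw [hb, hc, smul_zero, smul_zero, sub_zero, eq_comm, smul_eq_zero] at hx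
  exact hx.resolve_left (by positivity)

theorem eq_of_bounded_of_deriv_deriv_eq (ha : a ≠ 0) {f g h : ℝ → E} (hf : ContDiff ℝ 2 f)
    (hg : ContDiff ℝ 2 g) (hf' : ∀ x, deriv (deriv f) x = a ^ 2 • (f x - h x))
    (hg' : ∀ x, deriv (deriv g) x = a ^ 2 • (g x - h x)) {M N : ℝ} (hM : ∀ x, ‖f x‖ ≤ M)
    (hN : ∀ x, ‖g x‖ ≤ N) : f = g := by
  have hderiv : deriv (f - g) = deriv f - deriv g := funext fun x =>
    deriv_sub (hf.differentiable two_ne_zero x) (hg.differentiable two_ne_zero x)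
  refine sub_eq_zero.1 (eq_zero_of_bounded_of_deriv_deriv_eq ha (hf.sub hg) (fun x => ?_)
    fun x => (norm_sub_le _ _).trans (add_le_add (hM x) (hN x)))
  rw [hderiv, deriv_sub ((hf.deriv' (n := 1)).differentiable one_ne_zero x)
    ((hg.deriv' (n := 1)).differentiable one_ne_zero x), hf', hg', Pi.sub_apply]
  module

end BoundedSolutions

/-! ### Cauchy-Schwarz bounds for trilinear convolutions -/

section CauchySchwarz

variable {α : Type*} [MeasurableSpace α] {μ : Measure α}

theorem lintegral_mul_le_sqrt {f g : α → ℝ≥0∞} (hf : AEMeasurable f μ) (hg : AEMeasurable g μ) :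
    ∫⁻ a, f a * g a ∂μ ≤ (∫⁻ a, f a ^ 2 ∂μ) ^ (1 / 2 : ℝ) * (∫⁻ a, g a ^ 2 ∂μ) ^ (1 / 2 : ℝ) := by
  simpa using ENNReal.lintegral_mul_le_Lp_mul_Lq μ Real.HolderConjugate.two_two hf hg

theorem rpow_half_sq (a : ℝ≥0∞) : (a ^ (1 / 2 : ℝ)) ^ 2 = a := by
  rw [← ENNReal.rpow_natCast, ← ENNReal.rpow_mul]
  simp

theorem sq_lintegral_le_weighted {f W : α → ℝ≥0∞} (hf : AEMeasurable f μ) (hW : AEMeasurable W μ)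
    (h0 : ∀ a, W a ≠ 0) (ht : ∀ a, W a ≠ ⊤) :
    (∫⁻ a, f a ∂μ) ^ 2 ≤ (∫⁻ a, (W a)⁻¹ ∂μ) * ∫⁻ a, W a * f a ^ 2 ∂μ := by
  have hsplit (a : α) : ((W a)⁻¹ ^ (1 / 2 : ℝ)) * (W a ^ (1 / 2 : ℝ) * f a) = f a := by
    rw [← mul_assoc, ← ENNReal.mul_rpow_of_nonneg _ _ (by norm_num),
      ENNReal.inv_mul_cancel (h0 a) (ht a), ENNReal.one_rpow, one_mul]
  have hcs := lintegral_mul_le_sqrt (hW.inv.pow_const (1 / 2 : ℝ))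
    ((hW.pow_const (1 / 2 : ℝ)).mul hf)
  simp only [Pi.inv_apply, Pi.mul_apply, hsplit, mul_pow, rpow_half_sq] at hcs
  simpa only [mul_pow, rpow_half_sq] using pow_le_pow_left₀ zero_le hcs 2

end CauchySchwarz

section TripleConvolution

variable {G : Type*} [AddCommGroup G] [MeasurableSpace G]

/-- The trilinear convolution of nonnegative functions on an additive group, in which the three
arguments add up to `x - e`. For frequencies labelled by `n`, standing for the odd harmonic
`2 n + 1`, the shift by `e = (1, 0)` turns a sum of harmonics into the sum of their labels. -/
def tripleLConv (μ : Measure G) (e : G) (a b c : G → ℝ≥0∞) (x : G) : ℝ≥0∞ :=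
  ∫⁻ z : G × G, a z.1 * b z.2 * c (x - z.1 - z.2 - e) ∂(μ.prod μ)

variable [MeasurableAdd₂ G] [MeasurableNeg G] {μ : Measure G} [μ.IsAddLeftInvariant] {e : G}
  {a b c W : G → ℝ≥0∞} {K : ℝ≥0∞}

theorem lintegral_tripleLConv [SFinite μ] (ha : Measurable a) (hb : Measurable b)
    (hc : Measurable c) :
    ∫⁻ x, tripleLConv μ e a b c x ∂μ = (∫⁻ x, a x ∂μ) * (∫⁻ x, b x ∂μ) * ∫⁻ x, c x ∂μ := by
  unfold tripleLConv
  rw [lintegral_lintegral_swap (by fun_prop)]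
  have hinner (z : G × G) : ∫⁻ x, a z.1 * b z.2 * c (x - z.1 - z.2 - e) ∂μ =
      a z.1 * b z.2 * ∫⁻ x, c x ∂μ := by
    rw [lintegral_const_mul _ (by fun_prop)]
    simp_rw [sub_sub]
    rw [lintegral_sub_right_eq_self c]
  simp_rw [hinner]
  rw [lintegral_mul_const _ (by fun_prop), lintegral_prod_mul ha.aemeasurable hb.aemeasurable]

variable [μ.IsNegInvariant]

theorem lintegral_sub_left_sub_eq_self (c : G → ℝ≥0∞) (x y : G) :
    ∫⁻ z, c (x - y - z - e) ∂μ = ∫⁻ z, c z ∂μ := by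
  simp_rw [sub_right_comm (x - y) _ e]
  exact lintegral_sub_left_eq_self c _

variable [SFinite μ]

theorem lintegral_prod_mul_fst_third (ha : Measurable a) (hc : Measurable c) (x : G) :
    ∫⁻ z : G × G, a z.1 * c (x - z.1 - z.2 - e) ∂(μ.prod μ) =
      (∫⁻ y, a y ∂μ) * ∫⁻ y, c y ∂μ := by
  rw [lintegral_prod _ (by fun_prop), ← lintegral_mul_const _ ha]
  refine lintegral_congr fun y => ?_
  dsimp only
  rw [lintegral_const_mul _ (by fun_prop), lintegral_sub_left_sub_eq_self]

theorem lintegral_prod_mul_snd_third (hb : Measurable b) (hc : Measurable c) (x : G) :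
    ∫⁻ z : G × G, b z.2 * c (x - z.1 - z.2 - e) ∂(μ.prod μ) =
      (∫⁻ y, b y ∂μ) * ∫⁻ y, c y ∂μ := by
  rw [← lintegral_prod_mul_fst_third (e := e) hb hc x, ← lintegral_prod_swap]
  simp only [Prod.fst_swap, Prod.snd_swap, sub_right_comm x]

theorem tripleLConv_le (ha : Measurable a) (hb : Measurable b) (hc : Measurable c) (x : G) :
    tripleLConv μ e a b c x ≤ (∫⁻ y, a y ∂μ) * ((∫⁻ y, b y ^ 2 ∂μ) ^ (1 / 2 : ℝ) *
      (∫⁻ y, c y ^ 2 ∂μ) ^ (1 / 2 : ℝ)) := by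
  rw [tripleLConv, lintegral_prod _ (by fun_prop), ← lintegral_mul_const _ ha]
  refine lintegral_mono fun y => ?_
  simp_rw [mul_assoc]
  rw [lintegral_const_mul _ (by fun_prop)]
  gcongr
  refine (lintegral_mul_le_sqrt hb.aemeasurable (by fun_prop)).trans_eq ?_
  rw [lintegral_sub_left_sub_eq_self (fun t => c t ^ 2)]

theorem add_mul_inv_mul_eq {A B D : ℝ≥0∞} (hA : A ≠ 0) (hA' : A ≠ ⊤) (hB : B ≠ 0) (hB' : B ≠ ⊤)
    (hD : D ≠ 0) (hD' : D ≠ ⊤) :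
    (A + B + D) * (A * B * D)⁻¹ = B⁻¹ * D⁻¹ + A⁻¹ * D⁻¹ + A⁻¹ * B⁻¹ := by
  rw [ENNReal.mul_inv (Or.inr hD') (Or.inr hD), ENNReal.mul_inv (Or.inl hA) (Or.inl hA')]
  calc (A + B + D) * (A⁻¹ * B⁻¹ * D⁻¹) = (A * A⁻¹) * (B⁻¹ * D⁻¹) + (B * B⁻¹) * (A⁻¹ * D⁻¹) +
        (D * D⁻¹) * (A⁻¹ * B⁻¹) := by ring
    _ = _ := by
      simp only [ENNReal.mul_inv_cancel, ne_eq, hA, hA', hB, hB', hD, hD', not_false_eq_true,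
        one_mul]

theorem mul_lintegral_inv_triple_le (hW : Measurable W) (h0 : ∀ y, W y ≠ 0) (ht : ∀ y, W y ≠ ⊤)
    (hK : ∀ x y z, W x ≤ K * (W y + W z + W (x - y - z - e))) (x : G) :
    W x * ∫⁻ z : G × G, (W z.1 * W z.2 * W (x - z.1 - z.2 - e))⁻¹ ∂(μ.prod μ) ≤
      K * (3 * (∫⁻ y, (W y)⁻¹ ∂μ) ^ 2) := by
  calc W x * ∫⁻ z : G × G, (W z.1 * W z.2 * W (x - z.1 - z.2 - e))⁻¹ ∂(μ.prod μ)
    _ = ∫⁻ z : G × G, W x * (W z.1 * W z.2 * W (x - z.1 - z.2 - e))⁻¹ ∂(μ.prod μ) :=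
      (lintegral_const_mul _ (by fun_prop)).symm
    _ ≤ ∫⁻ z : G × G, K * ((W z.2)⁻¹ * (W (x - z.1 - z.2 - e))⁻¹ +
          (W z.1)⁻¹ * (W (x - z.1 - z.2 - e))⁻¹ + (W z.1)⁻¹ * (W z.2)⁻¹) ∂(μ.prod μ) := by
      refine lintegral_mono fun z => (mul_le_mul_left (hK x z.1 z.2) _).trans_eq ?_
      rw [mul_assoc, add_mul_inv_mul_eq (h0 _) (ht _) (h0 _) (ht _) (h0 _) (ht _)]
    _ = _ := by
      have hWi : Measurable fun y => (W y)⁻¹ := hW.inv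
      rw [lintegral_const_mul _ (by fun_prop), lintegral_add_right _ (by fun_prop),
        lintegral_add_right _ (by fun_prop), lintegral_prod_mul_snd_third (c := fun y => (W y)⁻¹)
          hWi hWi, lintegral_prod_mul_fst_third (c := fun y => (W y)⁻¹) hWi hWi,
        lintegral_prod_mul hWi.aemeasurable hWi.aemeasurable]
      ring

theorem mul_tripleLConv_sq_le (hW : Measurable W) (h0 : ∀ y, W y ≠ 0) (ht : ∀ y, W y ≠ ⊤)
    (hK : ∀ x y z, W x ≤ K * (W y + W z + W (x - y - z - e)))
    (ha : Measurable a) (hb : Measurable b) (hc : Measurable c) (x : G) :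
    W x * tripleLConv μ e a b c x ^ 2 ≤ K * (3 * (∫⁻ y, (W y)⁻¹ ∂μ) ^ 2) *
      tripleLConv μ e (fun y => W y * a y ^ 2) (fun y => W y * b y ^ 2)
        (fun y => W y * c y ^ 2) x := by
  have hcs := sq_lintegral_le_weighted (μ := μ.prod μ)
    (f := fun z : G × G => a z.1 * b z.2 * c (x - z.1 - z.2 - e))
    (W := fun z => W z.1 * W z.2 * W (x - z.1 - z.2 - e)) (by fun_prop) (by fun_prop)
    (fun z => mul_ne_zero (mul_ne_zero (h0 _) (h0 _)) (h0 _))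
    (fun z => ENNReal.mul_ne_top (ENNReal.mul_ne_top (ht _) (ht _)) (ht _))
  refine (mul_le_mul_right hcs _).trans ?_
  rw [← mul_assoc]
  refine mul_le_mul' (mul_lintegral_inv_triple_le hW h0 ht hK x) (lintegral_mono fun z => ?_)
  exact le_of_eq (by ring)

theorem lintegral_mul_tripleLConv_sq_le (hW : Measurable W) (h0 : ∀ y, W y ≠ 0)
    (ht : ∀ y, W y ≠ ⊤) (hK : ∀ x y z, W x ≤ K * (W y + W z + W (x - y - z - e)))
    (ha : Measurable a) (hb : Measurable b) (hc : Measurable c) :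
    ∫⁻ x, W x * tripleLConv μ e a b c x ^ 2 ∂μ ≤ K * (3 * (∫⁻ y, (W y)⁻¹ ∂μ) ^ 2) *
      ((∫⁻ x, W x * a x ^ 2 ∂μ) * (∫⁻ x, W x * b x ^ 2 ∂μ) * ∫⁻ x, W x * c x ^ 2 ∂μ) := by
  refine (lintegral_mono (mul_tripleLConv_sq_le hW h0 ht hK ha hb hc)).trans_eq ?_
  have hmeas : Measurable (tripleLConv μ e (fun y => W y * a y ^ 2) (fun y => W y * b y ^ 2)
      (fun y => W y * c y ^ 2)) :=
    Measurable.lintegral_prod_right' (f := fun q : G × (G × G) => W q.2.1 * a q.2.1 ^ 2 *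
      (W q.2.2 * b q.2.2 ^ 2) *
      (W (q.1 - q.2.1 - q.2.2 - e) * c (q.1 - q.2.1 - q.2.2 - e) ^ 2)) (by fun_prop)
  rw [lintegral_const_mul _ hmeas,
    lintegral_tripleLConv (by fun_prop) (by fun_prop) (by fun_prop)]

theorem add_le_three_mul_of_one_le {A B D : ℝ≥0∞} (hA : 1 ≤ A) (hB : 1 ≤ B) (hD : 1 ≤ D) :
    A + B + D ≤ 3 * (A * B * D) := by
  have hA' : A ≤ A * B * D := by simpa using mul_le_mul' (mul_le_mul' (le_refl A) hB) hD
  have hB' : B ≤ A * B * D := by simpa using mul_le_mul' (mul_le_mul' hA (le_refl B)) hD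
  have hD' : D ≤ A * B * D := by simpa using mul_le_mul' (mul_le_mul' hA hB) (le_refl D)
  calc A + B + D ≤ A * B * D + A * B * D + A * B * D := by gcongr
    _ = 3 * (A * B * D) := by ring

theorem mul_tripleLConv_sq_le_of_one_le (hW : Measurable W) (h1 : ∀ y, 1 ≤ W y)
    (hK : ∀ x y z, W x ≤ K * (W y + W z + W (x - y - z - e)))
    (ha : Measurable a) (hb : Measurable b) (hc : Measurable c) (x : G) :
    W x * tripleLConv μ e a b c x ^ 2 ≤ K * 3 * ((∫⁻ y, W y ^ (1 / 2 : ℝ) * a y ∂μ) ^ 2 *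
      ((∫⁻ y, W y * b y ^ 2 ∂μ) * ∫⁻ y, W y * c y ^ 2 ∂μ)) := by
  have hmul (y z : G) : W x ≤ K * 3 * (W y * W z * W (x - y - z - e)) := by
    rw [mul_assoc]
    exact (hK x y z).trans (mul_le_mul_right (add_le_three_mul_of_one_le (h1 _) (h1 _) (h1 _)) _)
  have hdist : W x ^ (1 / 2 : ℝ) * tripleLConv μ e a b c x ≤ (K * 3) ^ (1 / 2 : ℝ) *
      tripleLConv μ e (fun y => W y ^ (1 / 2 : ℝ) * a y) (fun y => W y ^ (1 / 2 : ℝ) * b y)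
        (fun y => W y ^ (1 / 2 : ℝ) * c y) x := by
    unfold tripleLConv
    rw [← lintegral_const_mul _ (by fun_prop), ← lintegral_const_mul _ (by fun_prop)]
    refine lintegral_mono fun z => ?_
    have hroot := ENNReal.rpow_le_rpow (hmul z.1 z.2) (z := 1 / 2) (by norm_num)
    simp only [ENNReal.mul_rpow_of_nonneg _ _ (one_div_nonneg.2 (zero_le_two (α := ℝ)))] at hroot ⊢
    exact (mul_le_mul_left hroot _).trans_eq (by ring)
  have hbound := tripleLConv_le (μ := μ) (e := e) (a := fun y => W y ^ (1 / 2 : ℝ) * a y)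
    (b := fun y => W y ^ (1 / 2 : ℝ) * b y) (c := fun y => W y ^ (1 / 2 : ℝ) * c y)
    (by fun_prop) (by fun_prop) (by fun_prop) x
  simpa only [mul_pow, rpow_half_sq] using
    pow_le_pow_left₀ zero_le (hdist.trans (mul_le_mul_right hbound _)) 2

end TripleConvolution

/-! ### The frequency space and its weights -/

/-- The measure on the frequency space `ℤ × ℝ`, in which `(n, η)` stands for the harmonic
`p = 2 n + 1` and the spatial frequency `ξ = 2 π η`. -/
abbrev freqMeasure : Measure (ℤ × ℝ) := Measure.count.prod volume

/-- The symbol `p² + ξ²` of the Laplacian at the frequency `x`. -/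
def freqSymbol (x : ℤ × ℝ) : ℝ := ((2 * x.1 + 1 : ℤ) : ℝ) ^ 2 + (2 * Real.pi * x.2) ^ 2

/-- The weight `(p² + ξ²)^s`. -/
def weight (s : ℝ) (x : ℤ × ℝ) : ℝ := freqSymbol x ^ s

/-- The weight `(p² + ξ²)^s` with values in `[0, ∞]`. -/
def eweight (s : ℝ) (x : ℤ × ℝ) : ℝ≥0∞ := ENNReal.ofReal (weight s x)

theorem one_le_odd_sq (n : ℤ) : (1 : ℝ) ≤ ((2 * n + 1 : ℤ) : ℝ) ^ 2 := by
  have h : (1 : ℤ) ≤ (2 * n + 1) ^ 2 :=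
    Int.add_one_le_iff.2 (lt_of_le_of_ne (sq_nonneg _) (pow_ne_zero 2 (by omega)).symm)
  exact_mod_cast h

theorem sq_odd_le_freqSymbol (x : ℤ × ℝ) : ((2 * x.1 + 1 : ℤ) : ℝ) ^ 2 ≤ freqSymbol x :=
  le_add_of_nonneg_right (sq_nonneg _)

theorem one_add_sq_le_freqSymbol (x : ℤ × ℝ) : 1 + x.2 ^ 2 ≤ freqSymbol x := by
  refine add_le_add (one_le_odd_sq x.1) ?_
  rw [mul_pow]
  exact le_mul_of_one_le_left (sq_nonneg _) (one_le_pow₀ (by linarith [Real.pi_gt_three]))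

theorem one_le_freqSymbol (x : ℤ × ℝ) : 1 ≤ freqSymbol x :=
  (one_le_odd_sq x.1).trans (sq_odd_le_freqSymbol x)

theorem one_le_weight {s : ℝ} (hs : 0 ≤ s) (x : ℤ × ℝ) : 1 ≤ weight s x :=
  Real.one_le_rpow (one_le_freqSymbol x) hs

theorem weight_pos (s : ℝ) (x : ℤ × ℝ) : 0 < weight s x :=
  Real.rpow_pos_of_pos (zero_lt_one.trans_le (one_le_freqSymbol x)) s

theorem measurable_weight (s : ℝ) : Measurable (weight s) := by
  refine measurable_from_prod_countable_right fun n => ?_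
  unfold weight freqSymbol
  fun_prop

theorem measurable_eweight (s : ℝ) : Measurable (eweight s) :=
  (measurable_weight s).ennreal_ofReal

theorem eweight_ne_zero (s : ℝ) (x : ℤ × ℝ) : eweight s x ≠ 0 :=
  (ENNReal.ofReal_pos.2 (weight_pos s x)).ne'

theorem eweight_ne_top (s : ℝ) (x : ℤ × ℝ) : eweight s x ≠ ⊤ := ENNReal.ofReal_ne_top

theorem one_le_eweight {s : ℝ} (hs : 0 ≤ s) (x : ℤ × ℝ) : 1 ≤ eweight s x :=
  ENNReal.one_le_ofReal.2 (one_le_weight hs x)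

theorem rpow_add_three_le {s a b c : ℝ} (hs : 0 ≤ s) (ha : 0 ≤ a) (hb : 0 ≤ b) (hc : 0 ≤ c) :
    (a + b + c) ^ s ≤ 3 ^ s * (a ^ s + b ^ s + c ^ s) := by
  set m := max a (max b c)
  have ham : a ≤ m := le_max_left _ _
  have hbm : b ≤ m := (le_max_left _ _).trans (le_max_right _ _)
  have hcm : c ≤ m := (le_max_right _ _).trans (le_max_right _ _)
  have hm : m ^ s ≤ a ^ s + b ^ s + c ^ s := by
    have has := Real.rpow_nonneg ha s
    have hbs := Real.rpow_nonneg hb s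
    have hcs := Real.rpow_nonneg hc s
    rcases max_choice a (max b c) with h | h
    · simp only [m, h]; linarith
    · rcases max_choice b c with h' | h' <;> simp only [m, h, h'] <;> linarith
  calc (a + b + c) ^ s ≤ (3 * m) ^ s := by gcongr; linarith
    _ = 3 ^ s * m ^ s := Real.mul_rpow (by norm_num) (ha.trans ham)
    _ ≤ _ := by gcongr

theorem sq_add_three_le (a b c : ℝ) : (a + b + c) ^ 2 ≤ 3 * (a ^ 2 + b ^ 2 + c ^ 2) := by
  nlinarith [sq_nonneg (a - b), sq_nonneg (b - c), sq_nonneg (a - c)]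

theorem freqSymbol_le (x y z : ℤ × ℝ) : freqSymbol x ≤
    3 * (freqSymbol y + freqSymbol z + freqSymbol (x - y - z - (1, 0))) := by
  have hp := sq_add_three_le (2 * y.1 + 1) (2 * z.1 + 1) (2 * (x.1 - y.1 - z.1 - 1) + 1)
  have hξ := sq_add_three_le (2 * Real.pi * y.2) (2 * Real.pi * z.2)
    (2 * Real.pi * (x.2 - y.2 - z.2))
  simp only [freqSymbol, Prod.fst_sub, Prod.snd_sub, sub_zero]
  push_cast
  ring_nf at hp hξ ⊢
  linarith

theorem weight_le {s : ℝ} (hs : 0 ≤ s) (x y z : ℤ × ℝ) :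
    weight s x ≤ 9 ^ s * (weight s y + weight s z + weight s (x - y - z - (1, 0))) := by
  have h0 (t : ℤ × ℝ) : 0 ≤ freqSymbol t := zero_le_one.trans (one_le_freqSymbol t)
  calc weight s x
    _ ≤ (3 * (freqSymbol y + freqSymbol z + freqSymbol (x - y - z - (1, 0)))) ^ s :=
      Real.rpow_le_rpow (h0 x) (freqSymbol_le x y z) hs
    _ = 3 ^ s * (freqSymbol y + freqSymbol z + freqSymbol (x - y - z - (1, 0))) ^ s :=
      Real.mul_rpow (by norm_num) (add_nonneg (add_nonneg (h0 _) (h0 _)) (h0 _))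
    _ ≤ 3 ^ s * (3 ^ s * (weight s y + weight s z + weight s (x - y - z - (1, 0)))) := by
      gcongr; exact rpow_add_three_le hs (h0 _) (h0 _) (h0 _)
    _ = _ := by rw [← mul_assoc, ← Real.mul_rpow (by norm_num) (by norm_num)]; norm_num

theorem eweight_le {s : ℝ} (hs : 0 ≤ s) (x y z : ℤ × ℝ) :
    eweight s x ≤ ENNReal.ofReal (9 ^ s) *
      (eweight s y + eweight s z + eweight s (x - y - z - (1, 0))) := by
  have h0 (t : ℤ × ℝ) : 0 ≤ weight s t := (weight_pos s t).le
  unfold eweight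
  rw [← ENNReal.ofReal_add (h0 _) (h0 _), ← ENNReal.ofReal_add (add_nonneg (h0 _) (h0 _)) (h0 _),
    ← ENNReal.ofReal_mul (by positivity)]
  exact ENNReal.ofReal_le_ofReal (weight_le hs x y z)

theorem inv_weight_le {s : ℝ} (hs : 0 ≤ s) (x : ℤ × ℝ) :
    (weight s x)⁻¹ ≤ |((2 * x.1 + 1 : ℤ) : ℝ)| ^ (-s) * (1 + ‖x.2‖ ^ 2) ^ (-s / 2) := by
  have hpos : 0 < freqSymbol x := zero_lt_one.trans_le (one_le_freqSymbol x)
  have hp : |((2 * x.1 + 1 : ℤ) : ℝ)| ^ (-s) = (((2 * x.1 + 1 : ℤ) : ℝ) ^ 2) ^ (-s / 2) := by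
    rw [← sq_abs, ← Real.rpow_natCast, ← Real.rpow_mul (abs_nonneg _), Nat.cast_two,
      mul_div_cancel₀ _ two_ne_zero]
  have hη : 1 + ‖x.2‖ ^ 2 ≤ freqSymbol x := by
    rw [Real.norm_eq_abs, sq_abs]
    exact one_add_sq_le_freqSymbol x
  calc (weight s x)⁻¹ = freqSymbol x ^ (-s / 2) * freqSymbol x ^ (-s / 2) := by
        rw [weight, ← Real.rpow_neg hpos.le, ← Real.rpow_add hpos, add_halves]
    _ ≤ _ := by
        rw [hp]
        exact mul_le_mul
          (Real.rpow_le_rpow_of_nonpos (zero_lt_one.trans_le (one_le_odd_sq _))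
            (sq_odd_le_freqSymbol x) (by linarith))
          (Real.rpow_le_rpow_of_nonpos (by positivity) hη (by linarith))
          (by positivity) (by positivity)

theorem lintegral_inv_eweight_lt_top {s : ℝ} (hs : 1 < s) :
    ∫⁻ x, (eweight s x)⁻¹ ∂freqMeasure < ⊤ := by
  have hbound (x : ℤ × ℝ) : (eweight s x)⁻¹ ≤ ENNReal.ofReal (|((2 * x.1 + 1 : ℤ) : ℝ)| ^ (-s)) *
      ENNReal.ofReal ((1 + ‖x.2‖ ^ 2) ^ (-s / 2)) := by
    rw [eweight, ← ENNReal.ofReal_inv_of_pos (weight_pos s x), ← ENNReal.ofReal_mul (by positivity)]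
    exact ENNReal.ofReal_le_ofReal (inv_weight_le (by linarith) x)
  have hsum : Summable fun n : ℤ => |((2 * n + 1 : ℤ) : ℝ)| ^ (-s) :=
    (Real.summable_abs_int_rpow hs).comp_injective (i := fun n : ℤ => 2 * n + 1)
      fun a b h => by simpa using h
  have hint : Integrable fun η : ℝ => (1 + ‖η‖ ^ 2) ^ (-s / 2) :=
    integrable_rpow_neg_one_add_norm_sq (by simpa using hs)
  refine (lintegral_mono hbound).trans_lt ?_
  rw [lintegral_prod_mul (f := fun n : ℤ => ENNReal.ofReal (|((2 * n + 1 : ℤ) : ℝ)| ^ (-s)))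
    (g := fun η : ℝ => ENNReal.ofReal ((1 + ‖η‖ ^ 2) ^ (-s / 2)))
    (measurable_of_countable _).aemeasurable (by fun_prop), lintegral_count]
  exact ENNReal.mul_lt_top hsum.tsum_ofReal_lt_top hint.lintegral_lt_top

instance : freqMeasure.IsNegInvariant := by
  refine ⟨?_⟩
  have hcount : MeasurePreserving (fun n : ℤ => -n) Measure.count Measure.count := by
    refine ⟨measurable_neg, Measure.ext fun A hA => ?_⟩
    rw [Measure.map_apply measurable_neg hA, Measure.count_apply (measurable_neg hA),
      Measure.count_apply hA, Set.neg_preimage, Set.encard_neg]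
  exact (hcount.prod (Measure.measurePreserving_neg (volume : Measure ℝ))).map_eq

/-- The constant of the algebra property of the weighted `L²` space. -/
def tripleConst (s : ℝ) : ℝ≥0∞ :=
  ENNReal.ofReal (9 ^ s) * (3 * (∫⁻ y, (eweight s y)⁻¹ ∂freqMeasure) ^ 2)

theorem tripleConst_lt_top {s : ℝ} (hs : 1 < s) : tripleConst s < ⊤ :=
  ENNReal.mul_lt_top ENNReal.ofReal_lt_top (ENNReal.mul_lt_top (by simp)
    (ENNReal.pow_lt_top (lintegral_inv_eweight_lt_top hs)))

/-! ### Weighted square integrable functions and their trilinear convolutions -/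

/-- The squared norm of the weighted `L²` space of frequencies: `∑ₙ ∫ (p² + ξ²)^s |u(n, η)|² dη`. -/
def wsq (s : ℝ) (u : ℤ × ℝ → ℝ) : ℝ≥0∞ := ∫⁻ x, eweight s x * ‖u x‖ₑ ^ 2 ∂freqMeasure

/-- Membership in the weighted `L²` space, for functions rather than classes, so that the trilinear
convolution can be evaluated at every frequency. -/
structure WL2 (s : ℝ) (u : ℤ × ℝ → ℝ) : Prop where
  measurable : Measurable u
  finite : wsq s u < ⊤

theorem lintegral_enorm_sq_le_wsq {s : ℝ} (hs : 0 ≤ s) (u : ℤ × ℝ → ℝ) :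
    ∫⁻ x, ‖u x‖ₑ ^ 2 ∂freqMeasure ≤ wsq s u :=
  lintegral_mono fun x => le_mul_of_one_le_left zero_le (one_le_eweight hs x)

theorem sq_lintegral_enorm_le_wsq {s : ℝ} {u : ℤ × ℝ → ℝ} (hu : Measurable u) :
    (∫⁻ x, ‖u x‖ₑ ∂freqMeasure) ^ 2 ≤ (∫⁻ x, (eweight s x)⁻¹ ∂freqMeasure) * wsq s u :=
  sq_lintegral_le_weighted hu.enorm.aemeasurable (measurable_eweight s).aemeasurable
    (eweight_ne_zero s) (eweight_ne_top s)

theorem WL2.integrable {s : ℝ} (hs : 1 < s) {u : ℤ × ℝ → ℝ} (hu : WL2 s u) :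
    Integrable u freqMeasure := by
  refine ⟨hu.measurable.aestronglyMeasurable, ?_⟩
  have hsq := (sq_lintegral_enorm_le_wsq (s := s) hu.measurable).trans_lt
    (ENNReal.mul_lt_top (lintegral_inv_eweight_lt_top hs) hu.finite)
  exact hasFiniteIntegral_iff_enorm.2 ((ENNReal.pow_lt_top_iff.1 hsq).resolve_right two_ne_zero)

theorem WL2.lintegral_sq_lt_top {s : ℝ} (hs : 0 ≤ s) {u : ℤ × ℝ → ℝ} (hu : WL2 s u) :
    ∫⁻ x, ‖u x‖ₑ ^ 2 ∂freqMeasure < ⊤ :=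
  (lintegral_enorm_sq_le_wsq hs u).trans_lt hu.finite

/-- The trilinear convolution whose terms are multiplied by a coefficient, the mask `m`, that
depends on the harmonic of the result and on those of the first two factors. -/
def triple (m : ℤ → ℤ → ℤ → ℝ) (u v w : ℤ × ℝ → ℝ) (x : ℤ × ℝ) : ℝ :=
  ∫ z : (ℤ × ℝ) × (ℤ × ℝ), m x.1 z.1.1 z.2.1 * (u z.1 * v z.2 * w (x - z.1 - z.2 - (1, 0)))
    ∂(freqMeasure.prod freqMeasure)

/-- Masks that are bounded by `M` and invariant under the change of sign of all harmonics, which is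
`n ↦ -1 - n` on the labels `n` of the harmonics `2 n + 1`. -/
structure IsMask (m : ℤ → ℤ → ℤ → ℝ) (M : ℝ) : Prop where
  bound : ∀ n q r, |m n q r| ≤ M
  symm : ∀ n q r, m (-1 - n) (-1 - q) (-1 - r) = m n q r

theorem IsMask.nonneg {m : ℤ → ℤ → ℤ → ℝ} {M : ℝ} (hm : IsMask m M) : 0 ≤ M :=
  (abs_nonneg _).trans (hm.bound 0 0 0)

theorem measurable_triple_integrand (m : ℤ → ℤ → ℤ → ℝ) {u v w : ℤ × ℝ → ℝ} (hu : Measurable u)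
    (hv : Measurable v) (hw : Measurable w) :
    Measurable fun q : (ℤ × ℝ) × ((ℤ × ℝ) × (ℤ × ℝ)) =>
      m q.1.1 q.2.1.1 q.2.2.1 * (u q.2.1 * v q.2.2 * w (q.1 - q.2.1 - q.2.2 - (1, 0))) := by
  have hm : Measurable fun q : (ℤ × ℝ) × ((ℤ × ℝ) × (ℤ × ℝ)) => m q.1.1 q.2.1.1 q.2.2.1 :=
    (measurable_of_countable (fun k : ℤ × ℤ × ℤ => m k.1 k.2.1 k.2.2)).comp
      (by fun_prop : Measurable fun q : (ℤ × ℝ) × ((ℤ × ℝ) × (ℤ × ℝ)) =>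
        (q.1.1, q.2.1.1, q.2.2.1))
  exact hm.mul (by fun_prop)

theorem measurable_triple (m : ℤ → ℤ → ℤ → ℝ) {u v w : ℤ × ℝ → ℝ} (hu : Measurable u)
    (hv : Measurable v) (hw : Measurable w) : Measurable (triple m u v w) :=
  (measurable_triple_integrand m hu hv hw).stronglyMeasurable.integral_prod_right'.measurable

theorem enorm_triple_integrand_le {m : ℤ → ℤ → ℤ → ℝ} {M : ℝ} (hm : IsMask m M)
    (u v w : ℤ × ℝ → ℝ) (x : ℤ × ℝ) (z : (ℤ × ℝ) × (ℤ × ℝ)) :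
    ‖m x.1 z.1.1 z.2.1 * (u z.1 * v z.2 * w (x - z.1 - z.2 - (1, 0)))‖ₑ ≤
      ENNReal.ofReal M * (‖u z.1‖ₑ * ‖v z.2‖ₑ * ‖w (x - z.1 - z.2 - (1, 0))‖ₑ) := by
  rw [enorm_mul, enorm_mul, enorm_mul]
  gcongr
  rw [Real.enorm_eq_ofReal_abs]
  exact ENNReal.ofReal_le_ofReal (hm.bound _ _ _)

theorem lintegral_enorm_triple_integrand_le {m : ℤ → ℤ → ℤ → ℝ} {M : ℝ} (hm : IsMask m M)
    {u v w : ℤ × ℝ → ℝ} (hu : Measurable u) (hv : Measurable v) (hw : Measurable w)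
    (x : ℤ × ℝ) :
    ∫⁻ z : (ℤ × ℝ) × (ℤ × ℝ), ‖m x.1 z.1.1 z.2.1 *
      (u z.1 * v z.2 * w (x - z.1 - z.2 - (1, 0)))‖ₑ ∂(freqMeasure.prod freqMeasure) ≤
      ENNReal.ofReal M * tripleLConv freqMeasure (1, 0) (fun y => ‖u y‖ₑ) (fun y => ‖v y‖ₑ)
        (fun y => ‖w y‖ₑ) x := by
  unfold tripleLConv
  rw [← lintegral_const_mul _ (by fun_prop)]
  exact lintegral_mono fun z => enorm_triple_integrand_le hm u v w x z

theorem tripleLConv_lt_top {s : ℝ} (hs : 1 < s) {u v w : ℤ × ℝ → ℝ} (hu : WL2 s u) (hv : WL2 s v)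
    (hw : WL2 s w) (x : ℤ × ℝ) :
    tripleLConv freqMeasure (1, 0) (fun y => ‖u y‖ₑ) (fun y => ‖v y‖ₑ) (fun y => ‖w y‖ₑ) x < ⊤ := by
  have hroot {f : ℤ × ℝ → ℝ} (hf : WL2 s f) :
      (∫⁻ y, ‖f y‖ₑ ^ 2 ∂freqMeasure) ^ (1 / 2 : ℝ) < ⊤ :=
    ENNReal.rpow_lt_top_of_nonneg (by norm_num) (hf.lintegral_sq_lt_top (by linarith)).ne
  exact (tripleLConv_le hu.measurable.enorm hv.measurable.enorm hw.measurable.enorm x).trans_lt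
    (ENNReal.mul_lt_top (hu.integrable hs).2 (ENNReal.mul_lt_top (hroot hv) (hroot hw)))

theorem integrable_triple {s : ℝ} (hs : 1 < s) {m : ℤ → ℤ → ℤ → ℝ} {M : ℝ} (hm : IsMask m M)
    {u v w : ℤ × ℝ → ℝ} (hu : WL2 s u) (hv : WL2 s v) (hw : WL2 s w) (x : ℤ × ℝ) :
    Integrable (fun z : (ℤ × ℝ) × (ℤ × ℝ) => m x.1 z.1.1 z.2.1 *
      (u z.1 * v z.2 * w (x - z.1 - z.2 - (1, 0)))) (freqMeasure.prod freqMeasure) := by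
  refine ⟨?_, ?_⟩
  · exact ((measurable_triple_integrand m hu.measurable hv.measurable hw.measurable).comp
      (measurable_prodMk_left (x := x))).aestronglyMeasurable
  · exact (lintegral_enorm_triple_integrand_le hm hu.measurable hv.measurable hw.measurable
      x).trans_lt (ENNReal.mul_lt_top ENNReal.ofReal_lt_top (tripleLConv_lt_top hs hu hv hw x))

theorem enorm_triple_le {m : ℤ → ℤ → ℤ → ℝ} {M : ℝ} (hm : IsMask m M) {u v w : ℤ × ℝ → ℝ}
    (hu : Measurable u) (hv : Measurable v) (hw : Measurable w) (x : ℤ × ℝ) :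
    ‖triple m u v w x‖ₑ ≤ ENNReal.ofReal M *
      tripleLConv freqMeasure (1, 0) (fun y => ‖u y‖ₑ) (fun y => ‖v y‖ₑ) (fun y => ‖w y‖ₑ) x :=
  (enorm_integral_le_lintegral_enorm _).trans (lintegral_enorm_triple_integrand_le hm hu hv hw x)

theorem wsq_triple_le {s : ℝ} (hs : 0 ≤ s) {m : ℤ → ℤ → ℤ → ℝ} {M : ℝ} (hm : IsMask m M)
    {u v w : ℤ × ℝ → ℝ} (hu : Measurable u) (hv : Measurable v) (hw : Measurable w) :
    wsq s (triple m u v w) ≤ ENNReal.ofReal M ^ 2 * (tripleConst s *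
      (wsq s u * wsq s v * wsq s w)) := by
  refine le_trans ?_ (mul_le_mul_right (lintegral_mul_tripleLConv_sq_le (measurable_eweight s)
    (eweight_ne_zero s) (eweight_ne_top s) (eweight_le hs) hu.enorm hv.enorm hw.enorm) _)
  rw [← lintegral_const_mul' _ _ (ENNReal.pow_ne_top ENNReal.ofReal_ne_top)]
  refine lintegral_mono fun x => ?_
  refine (mul_le_mul_right (pow_le_pow_left₀ zero_le (enorm_triple_le hm hu hv hw x) 2)
    _).trans_eq ?_
  ring

theorem WL2.add {s : ℝ} {u v : ℤ × ℝ → ℝ} (hu : WL2 s u) (hv : WL2 s v) :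
    WL2 s (fun x => u x + v x) := by
  have hW := measurable_eweight s
  have hmu := hu.measurable
  have hmv := hv.measurable
  refine ⟨hmu.add hmv, ?_⟩
  have hle : wsq s (fun x => u x + v x) ≤ 2 * (wsq s u + wsq s v) := by
    unfold wsq
    rw [← lintegral_add_left (by fun_prop), ← lintegral_const_mul _ (by fun_prop)]
    refine lintegral_mono fun x => ?_
    have hsq := (pow_le_pow_left₀ zero_le (enorm_add_le (u x) (v x)) 2).trans
      (by simpa [show (2 : ℝ) - 1 = 1 by norm_num] using
        ENNReal.rpow_add_le_mul_rpow_add_rpow ‖u x‖ₑ ‖v x‖ₑ one_le_two)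
    rw [← mul_add, mul_left_comm]
    exact mul_le_mul_right hsq _
  exact hle.trans_lt (ENNReal.mul_lt_top (by simp) (ENNReal.add_lt_top.2 ⟨hu.finite, hv.finite⟩))

theorem wsq_const_mul (s c : ℝ) (u : ℤ × ℝ → ℝ) :
    wsq s (fun x => c * u x) = ‖c‖ₑ ^ 2 * wsq s u := by
  unfold wsq
  rw [← lintegral_const_mul' _ _ (by simp)]
  congr with x
  rw [enorm_mul]
  ring

theorem WL2.const_mul {s : ℝ} {u : ℤ × ℝ → ℝ} (hu : WL2 s u) (c : ℝ) :
    WL2 s (fun x => c * u x) := by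
  refine ⟨hu.measurable.const_mul c, ?_⟩
  rw [wsq_const_mul]
  exact ENNReal.mul_lt_top (by simp) hu.finite

theorem WL2.triple {s : ℝ} (hs : 1 < s) {m : ℤ → ℤ → ℤ → ℝ} {M : ℝ} (hm : IsMask m M)
    {u v w : ℤ × ℝ → ℝ} (hu : WL2 s u) (hv : WL2 s v) (hw : WL2 s w) :
    WL2 s (triple m u v w) := by
  refine ⟨measurable_triple m hu.measurable hv.measurable hw.measurable, ?_⟩
  refine (wsq_triple_le (by linarith) hm hu.measurable hv.measurable hw.measurable).trans_lt ?_
  exact ENNReal.mul_lt_top (ENNReal.pow_lt_top ENNReal.ofReal_lt_top)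
    (ENNReal.mul_lt_top (tripleConst_lt_top hs)
      (ENNReal.mul_lt_top (ENNReal.mul_lt_top hu.finite hv.finite) hw.finite))

section Multilinear

variable {s : ℝ} {m : ℤ → ℤ → ℤ → ℝ} {M : ℝ} {u u' v v' w w' : ℤ × ℝ → ℝ}

theorem triple_add_left (hs : 1 < s) (hm : IsMask m M) (hu : WL2 s u) (hu' : WL2 s u')
    (hv : WL2 s v) (hw : WL2 s w) (x : ℤ × ℝ) :
    triple m (fun y => u y + u' y) v w x = triple m u v w x + triple m u' v w x := by
  unfold triple
  rw [← integral_add (integrable_triple hs hm hu hv hw x) (integrable_triple hs hm hu' hv hw x)]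
  congr with z
  ring

theorem triple_add_mid (hs : 1 < s) (hm : IsMask m M) (hu : WL2 s u) (hv : WL2 s v)
    (hv' : WL2 s v') (hw : WL2 s w) (x : ℤ × ℝ) :
    triple m u (fun y => v y + v' y) w x = triple m u v w x + triple m u v' w x := by
  unfold triple
  rw [← integral_add (integrable_triple hs hm hu hv hw x) (integrable_triple hs hm hu hv' hw x)]
  congr with z
  ring

theorem triple_add_right (hs : 1 < s) (hm : IsMask m M) (hu : WL2 s u) (hv : WL2 s v)
    (hw : WL2 s w) (hw' : WL2 s w') (x : ℤ × ℝ) :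
    triple m u v (fun y => w y + w' y) x = triple m u v w x + triple m u v w' x := by
  unfold triple
  rw [← integral_add (integrable_triple hs hm hu hv hw x) (integrable_triple hs hm hu hv hw' x)]
  congr with z
  ring

theorem triple_mul_left (c : ℝ) (x : ℤ × ℝ) :
    triple m (fun y => c * u y) v w x = c * triple m u v w x := by
  unfold triple
  rw [← integral_const_mul]
  congr with z
  ring

theorem triple_mul_mid (c : ℝ) (x : ℤ × ℝ) :
    triple m u (fun y => c * v y) w x = c * triple m u v w x := by
  unfold triple
  rw [← integral_const_mul]
  congr with z
  ring

theorem triple_mul_right (c : ℝ) (x : ℤ × ℝ) :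
    triple m u v (fun y => c * w y) x = c * triple m u v w x := by
  unfold triple
  rw [← integral_const_mul]
  congr with z
  ring

theorem quasiMeasurePreserving_third (x : ℤ × ℝ) :
    Measure.QuasiMeasurePreserving (fun z : (ℤ × ℝ) × (ℤ × ℝ) => x - z.1 - z.2 - (1, 0))
      (freqMeasure.prod freqMeasure) freqMeasure := by
  refine ⟨by fun_prop, Measure.AbsolutelyContinuous.mk fun A hA hA0 => ?_⟩
  have hpre : MeasurableSet ((fun z : (ℤ × ℝ) × (ℤ × ℝ) => x - z.1 - z.2 - (1, 0)) ⁻¹' A) :=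
    measurableSet_preimage (by fun_prop) hA
  have hsection (y z : ℤ × ℝ) :
      ((fun z : (ℤ × ℝ) × (ℤ × ℝ) => x - z.1 - z.2 - (1, 0)) ⁻¹' A).indicator
        (1 : (ℤ × ℝ) × (ℤ × ℝ) → ℝ≥0∞) (y, z) = A.indicator 1 (x - y - z - (1, 0)) := rfl
  rw [Measure.map_apply (by fun_prop) hA, ← lintegral_indicator_one hpre,
    lintegral_prod _ (measurable_one.indicator hpre).aemeasurable]
  simp_rw [hsection, lintegral_sub_left_sub_eq_self (fun t => A.indicator (1 : ℤ × ℝ → ℝ≥0∞) t),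
    lintegral_indicator_one hA, hA0, lintegral_zero]

theorem triple_congr (hu : u =ᵐ[freqMeasure] u') (hv : v =ᵐ[freqMeasure] v')
    (hw : w =ᵐ[freqMeasure] w') (x : ℤ × ℝ) : triple m u v w x = triple m u' v' w' x := by
  refine integral_congr_ae ?_
  filter_upwards [Measure.quasiMeasurePreserving_fst.ae hu,
    Measure.quasiMeasurePreserving_snd.ae hv, (quasiMeasurePreserving_third x).ae hw]
    with z hz₁ hz₂ hz₃
  rw [hz₁, hz₂, hz₃]

end Multilinear

/-! ### Reflections of the frequency space -/

/-- The reflection `p ↦ -p` of the harmonics. -/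
def reflectHarmonic : ℤ × ℝ ≃ᵐ ℤ × ℝ where
  toFun x := (-1 - x.1, x.2)
  invFun x := (-1 - x.1, x.2)
  left_inv x := by simp
  right_inv x := by simp
  measurable_toFun := (by fun_prop : Measurable fun x : ℤ × ℝ => (-1 - x.1, x.2))
  measurable_invFun := (by fun_prop : Measurable fun x : ℤ × ℝ => (-1 - x.1, x.2))

/-- The reflection `ξ ↦ -ξ` of the spatial frequency. -/
def reflectSpace : ℤ × ℝ ≃ᵐ ℤ × ℝ where
  toFun x := (x.1, -x.2)
  invFun x := (x.1, -x.2)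
  left_inv x := by simp
  right_inv x := by simp
  measurable_toFun := (by fun_prop : Measurable fun x : ℤ × ℝ => (x.1, -x.2))
  measurable_invFun := (by fun_prop : Measurable fun x : ℤ × ℝ => (x.1, -x.2))

@[simp] theorem reflectHarmonic_apply (x : ℤ × ℝ) : reflectHarmonic x = (-1 - x.1, x.2) := rfl

@[simp] theorem reflectSpace_apply (x : ℤ × ℝ) : reflectSpace x = (x.1, -x.2) := rfl

theorem measurePreserving_reflectHarmonic :
    MeasurePreserving reflectHarmonic freqMeasure freqMeasure := by
  have hcount : MeasurePreserving (fun n : ℤ => -1 - n) Measure.count Measure.count := by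
    refine ⟨by fun_prop, Measure.ext fun A hA => ?_⟩
    have hinv : Function.Involutive (fun n : ℤ => -1 - n) := fun n => by simp
    rw [Measure.map_apply (by fun_prop) hA,
      Measure.count_apply (measurableSet_preimage (by fun_prop) hA), Measure.count_apply hA,
      Set.encard_preimage_of_bijective hinv.bijective A]
  exact hcount.prod (MeasurePreserving.id volume)

theorem measurePreserving_reflectSpace :
    MeasurePreserving reflectSpace freqMeasure freqMeasure :=
  (MeasurePreserving.id Measure.count).prod (Measure.measurePreserving_neg (volume : Measure ℝ))

theorem weight_reflectHarmonic (s : ℝ) (x : ℤ × ℝ) :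
    weight s (reflectHarmonic x) = weight s x := by
  simp only [weight, freqSymbol, reflectHarmonic_apply]
  congr 2
  push_cast
  ring

theorem weight_reflectSpace (s : ℝ) (x : ℤ × ℝ) : weight s (reflectSpace x) = weight s x := by
  simp [weight, freqSymbol]

theorem triple_comp_equiv {m : ℤ → ℤ → ℤ → ℝ} {σ : ℤ × ℝ ≃ᵐ ℤ × ℝ}
    (hσ : MeasurePreserving σ freqMeasure freqMeasure)
    (hthird : ∀ x y z, σ x - σ y - σ z - (1, 0) = σ (x - y - z - (1, 0)))
    (hm : ∀ x y z, m (σ x).1 (σ y).1 (σ z).1 = m x.1 y.1 z.1) (u v w : ℤ × ℝ → ℝ) (x : ℤ × ℝ) :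
    triple m u v w (σ x) = triple m (u ∘ σ) (v ∘ σ) (w ∘ σ) x := by
  unfold triple
  rw [← (hσ.prod hσ).integral_comp (σ.prodCongr σ).measurableEmbedding]
  congr with z
  simp [hthird, hm]

/-! ### The space of symmetric weighted square integrable functions -/

/-- The measure `(p² + ξ²)^s dp dξ`. -/
def weightedMeasure (s : ℝ) : Measure (ℤ × ℝ) := freqMeasure.withDensity (eweight s)

theorem ae_weightedMeasure (s : ℝ) : ae (weightedMeasure s) = ae freqMeasure :=
  le_antisymm (withDensity_absolutelyContinuous _ _).ae_le
    (withDensity_absolutelyContinuous' (measurable_eweight s).aemeasurable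
      (ae_of_all _ (eweight_ne_zero s))).ae_le

theorem lintegral_weightedMeasure (s : ℝ) {f : ℤ × ℝ → ℝ≥0∞} (hf : Measurable f) :
    ∫⁻ x, f x ∂weightedMeasure s = ∫⁻ x, eweight s x * f x ∂freqMeasure := by
  rw [weightedMeasure, lintegral_withDensity_eq_lintegral_mul _ (measurable_eweight s) hf]
  rfl

theorem measurePreserving_weighted {s : ℝ} {σ : ℤ × ℝ ≃ᵐ ℤ × ℝ}
    (hσ : MeasurePreserving σ freqMeasure freqMeasure)
    (hw : ∀ x, weight s (σ x) = weight s x) :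
    MeasurePreserving σ (weightedMeasure s) (weightedMeasure s) := by
  refine ⟨σ.measurable, ?_⟩
  ext A hA
  rw [Measure.map_apply σ.measurable hA, weightedMeasure, withDensity_apply _ hA,
    withDensity_apply _ (σ.measurable hA), ← hσ.setLIntegral_comp_preimage hA
    (measurable_eweight s)]
  simp_rw [eweight, hw]

theorem eLpNorm_sq_eq_wsq (s : ℝ) {u : ℤ × ℝ → ℝ} (hu : Measurable u) :
    eLpNorm u 2 (weightedMeasure s) ^ 2 = wsq s u := by
  rw [eLpNorm_eq_lintegral_rpow_enorm_toReal (by simp) (by simp), ← ENNReal.rpow_natCast,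
    ← ENNReal.rpow_mul]
  simp only [ENNReal.toReal_ofNat, Nat.cast_ofNat, ENNReal.rpow_ofNat]
  norm_num
  exact lintegral_weightedMeasure s (hu.enorm.pow_const 2)

theorem WL2.memLp {s : ℝ} {u : ℤ × ℝ → ℝ} (hu : WL2 s u) : MemLp u 2 (weightedMeasure s) := by
  refine ⟨hu.measurable.aestronglyMeasurable, ?_⟩
  have h := hu.finite
  rw [← eLpNorm_sq_eq_wsq s hu.measurable] at h
  exact (ENNReal.pow_lt_top_iff.1 h).resolve_right two_ne_zero

theorem wL2_coeFn {s : ℝ} (f : Lp ℝ 2 (weightedMeasure s)) : WL2 s f := by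
  have hm : Measurable f := (Lp.stronglyMeasurable f).measurable
  refine ⟨hm, ?_⟩
  rw [← eLpNorm_sq_eq_wsq s hm]
  exact ENNReal.pow_lt_top (Lp.eLpNorm_lt_top f)

/-- Measurable functions in the weighted `L²` space that are even in the harmonic and in the
spatial frequency. -/
structure EvenL2 (s : ℝ) (u : ℤ × ℝ → ℝ) : Prop extends WL2 s u where
  harmonic : u ∘ reflectHarmonic =ᵐ[freqMeasure] u
  space : u ∘ reflectSpace =ᵐ[freqMeasure] u

/-- The closed subspace of the symmetric functions in the weighted `L²` space. -/
def evenSubmodule (s : ℝ) : Submodule ℝ (Lp ℝ 2 (weightedMeasure s)) :=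
  LinearMap.ker ((Lp.compMeasurePreservingₗᵢ ℝ reflectHarmonic (measurePreserving_weighted
      measurePreserving_reflectHarmonic (weight_reflectHarmonic s))).toContinuousLinearMap -
      ContinuousLinearMap.id ℝ (Lp ℝ 2 (weightedMeasure s))).toLinearMap ⊓
  LinearMap.ker ((Lp.compMeasurePreservingₗᵢ ℝ reflectSpace (measurePreserving_weighted
      measurePreserving_reflectSpace (weight_reflectSpace s))).toContinuousLinearMap -
      ContinuousLinearMap.id ℝ (Lp ℝ 2 (weightedMeasure s))).toLinearMap

theorem isClosed_evenSubmodule (s : ℝ) :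
    IsClosed (evenSubmodule s : Set (Lp ℝ 2 (weightedMeasure s))) :=
  (ContinuousLinearMap.isClosed_ker _).inter (ContinuousLinearMap.isClosed_ker _)

/-- The Hilbert space of the symmetric functions in the weighted `L²` space. -/
def EvenSpace (s : ℝ) : Type := evenSubmodule s

instance (s : ℝ) : NormedAddCommGroup (EvenSpace s) :=
  inferInstanceAs (NormedAddCommGroup (evenSubmodule s))

instance (s : ℝ) : InnerProductSpace ℝ (EvenSpace s) :=
  inferInstanceAs (InnerProductSpace ℝ (evenSubmodule s))

instance (s : ℝ) : CompleteSpace (EvenSpace s) :=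
  (isClosed_evenSubmodule s).completeSpace_coe

theorem mem_evenSubmodule {s : ℝ} {f : Lp ℝ 2 (weightedMeasure s)} :
    f ∈ evenSubmodule s ↔ (f ∘ reflectHarmonic =ᵐ[freqMeasure] f) ∧
      (f ∘ reflectSpace =ᵐ[freqMeasure] f) := by
  have hfix {σ : ℤ × ℝ ≃ᵐ ℤ × ℝ}
      (hσ : MeasurePreserving σ (weightedMeasure s) (weightedMeasure s)) :
      Lp.compMeasurePreserving (p := 2) (E := ℝ) σ hσ f = f ↔ f ∘ σ =ᵐ[freqMeasure] f := by
    have h : Lp.compMeasurePreserving σ hσ f =ᵐ[freqMeasure] f ∘ σ := by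
      rw [← ae_weightedMeasure s]
      exact Lp.coeFn_compMeasurePreserving f hσ
    rw [Lp.ext_iff, ae_weightedMeasure]
    exact ⟨fun h' => h.symm.trans h', fun h' => h.trans h'⟩
  rw [evenSubmodule, Submodule.mem_inf, LinearMap.mem_ker, LinearMap.mem_ker]
  refine and_congr ?_ ?_
  · rw [← hfix (measurePreserving_weighted measurePreserving_reflectHarmonic
      (weight_reflectHarmonic s))]
    exact sub_eq_zero
  · rw [← hfix (measurePreserving_weighted measurePreserving_reflectSpace
      (weight_reflectSpace s))]
    exact sub_eq_zero

/-- The measurable representative of a class that the library chooses. -/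
def EvenSpace.fn {s : ℝ} (f : EvenSpace s) : ℤ × ℝ → ℝ := (f.1 : Lp ℝ 2 (weightedMeasure s))

theorem EvenSpace.evenL2_fn {s : ℝ} (f : EvenSpace s) : EvenL2 s f.fn :=
  ⟨wL2_coeFn _, (mem_evenSubmodule.1 f.2).1, (mem_evenSubmodule.1 f.2).2⟩

theorem WL2.toLp_ae_eq {s : ℝ} {u : ℤ × ℝ → ℝ} (hu : WL2 s u) :
    hu.memLp.toLp u =ᵐ[freqMeasure] u := by
  have := hu.memLp.coeFn_toLp
  unfold EventuallyEq at this ⊢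
  rwa [ae_weightedMeasure] at this

/-- The class of a symmetric function. -/
def EvenL2.toEvenSpace {s : ℝ} {u : ℤ × ℝ → ℝ} (hu : EvenL2 s u) : EvenSpace s :=
  ⟨hu.memLp.toLp u, mem_evenSubmodule.2 (by
    have h := hu.toWL2.toLp_ae_eq
    exact ⟨(measurePreserving_reflectHarmonic.quasiMeasurePreserving.ae_eq_comp h).trans
        (hu.harmonic.trans h.symm),
      (measurePreserving_reflectSpace.quasiMeasurePreserving.ae_eq_comp h).trans
        (hu.space.trans h.symm)⟩)⟩

theorem EvenL2.fn_toEvenSpace {s : ℝ} {u : ℤ × ℝ → ℝ} (hu : EvenL2 s u) :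
    hu.toEvenSpace.fn =ᵐ[freqMeasure] u := hu.toWL2.toLp_ae_eq

theorem EvenSpace.ext {s : ℝ} {f g : EvenSpace s} (h : f.fn =ᵐ[freqMeasure] g.fn) :
    f = g := by
  apply Subtype.ext
  rw [Lp.ext_iff, ae_weightedMeasure]
  exact h

theorem EvenSpace.fn_add {s : ℝ} (f g : EvenSpace s) :
    (f + g).fn =ᵐ[freqMeasure] fun x => f.fn x + g.fn x := by
  have := Lp.coeFn_add f.1 g.1
  rw [ae_weightedMeasure] at this
  exact this

theorem EvenSpace.fn_sub {s : ℝ} (f g : EvenSpace s) :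
    (f - g).fn =ᵐ[freqMeasure] fun x => f.fn x - g.fn x := by
  have := Lp.coeFn_sub f.1 g.1
  rw [ae_weightedMeasure] at this
  exact this

theorem EvenSpace.fn_smul {s : ℝ} (c : ℝ) (f : EvenSpace s) :
    (c • f).fn =ᵐ[freqMeasure] fun x => c * f.fn x := by
  have := Lp.coeFn_smul c f.1
  rw [ae_weightedMeasure] at this
  exact this

theorem EvenSpace.enorm_sq {s : ℝ} (f : EvenSpace s) : ‖f‖ₑ ^ 2 = wsq s f.fn := by
  rw [← eLpNorm_sq_eq_wsq s f.evenL2_fn.measurable, EvenSpace.fn, ← Lp.enorm_def]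
  rfl

theorem wsq_congr {s : ℝ} {u v : ℤ × ℝ → ℝ} (h : u =ᵐ[freqMeasure] v) : wsq s u = wsq s v := by
  refine lintegral_congr_ae ?_
  filter_upwards [h] with x hx
  rw [hx]

theorem EvenL2.enorm_sq_toEvenSpace {s : ℝ} {u : ℤ × ℝ → ℝ} (hu : EvenL2 s u) :
    ‖hu.toEvenSpace‖ₑ ^ 2 = wsq s u := by
  rw [EvenSpace.enorm_sq, wsq_congr hu.fn_toEvenSpace]

/-! ### The interaction operator -/

/-- The Fourier multiplier `p² (p² - ∂²)⁻¹` on functions of the frequency, where `p = 2 n + 1`. -/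
def resolventMul (u : ℤ × ℝ → ℝ) (x : ℤ × ℝ) : ℝ := resolvent (2 * x.1 + 1) x.2 * u x

theorem measurable_resolventMul {u : ℤ × ℝ → ℝ} (hu : Measurable u) :
    Measurable (resolventMul u) :=
  (measurable_from_prod_countable_right fun n => measurable_resolvent (2 * (n : ℝ) + 1) :
    Measurable fun x : ℤ × ℝ => resolvent (2 * x.1 + 1) x.2).mul hu

theorem resolventMul_congr {u v : ℤ × ℝ → ℝ} (h : u =ᵐ[freqMeasure] v) :
    resolventMul u =ᵐ[freqMeasure] resolventMul v := by
  filter_upwards [h] with x hx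
  rw [resolventMul, resolventMul, hx]

theorem wsq_resolventMul_le (s : ℝ) (u : ℤ × ℝ → ℝ) : wsq s (resolventMul u) ≤ wsq s u := by
  refine lintegral_mono fun x => ?_
  gcongr
  rw [resolventMul, enorm_mul, Real.enorm_of_nonneg (resolvent_nonneg _ _)]
  exact mul_le_of_le_one_left zero_le (ENNReal.ofReal_le_one.2 (resolvent_le_one _ _))

theorem WL2.resolventMul {s : ℝ} {u : ℤ × ℝ → ℝ} (hu : WL2 s u) : WL2 s (resolventMul u) :=
  ⟨measurable_resolventMul hu.measurable, (wsq_resolventMul_le s u).trans_lt hu.finite⟩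

theorem resolventMul_reflectHarmonic (u : ℤ × ℝ → ℝ) (x : ℤ × ℝ) :
    resolventMul u (reflectHarmonic x) = resolventMul (u ∘ reflectHarmonic) x := by
  have hodd : 2 * ((-1 - x.1 : ℤ) : ℝ) + 1 = -(2 * x.1 + 1) := by push_cast; ring
  rw [resolventMul, resolventMul, Function.comp_apply, reflectHarmonic_apply, hodd,
    resolvent_neg_left]

theorem resolventMul_reflectSpace (u : ℤ × ℝ → ℝ) (x : ℤ × ℝ) :
    resolventMul u (reflectSpace x) = resolventMul (u ∘ reflectSpace) x := by
  rw [resolventMul, resolventMul, Function.comp_apply, reflectSpace_apply, resolvent_neg_right]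

theorem EvenL2.resolventMul {s : ℝ} {u : ℤ × ℝ → ℝ} (hu : EvenL2 s u) :
    EvenL2 s (resolventMul u) where
  toWL2 := hu.toWL2.resolventMul
  harmonic := EventuallyEq.trans (ae_of_all _ (resolventMul_reflectHarmonic u))
    (resolventMul_congr hu.harmonic)
  space := EventuallyEq.trans (ae_of_all _ (resolventMul_reflectSpace u))
    (resolventMul_congr hu.space)

theorem EvenL2.triple {s : ℝ} (hs : 1 < s) {m : ℤ → ℤ → ℤ → ℝ} {M : ℝ} (hm : IsMask m M)
    {u v w : ℤ × ℝ → ℝ} (hu : EvenL2 s u) (hv : EvenL2 s v) (hw : EvenL2 s w) :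
    EvenL2 s (triple m u v w) where
  toWL2 := WL2.triple hs hm hu.toWL2 hv.toWL2 hw.toWL2
  harmonic := ae_of_all _ fun x => by
    rw [Function.comp_apply, triple_comp_equiv measurePreserving_reflectHarmonic
      (fun x y z => by ext <;> simp; ring) (fun x y z => hm.symm _ _ _),
      triple_congr hu.harmonic hv.harmonic hw.harmonic]
  space := ae_of_all _ fun x => by
    rw [Function.comp_apply, triple_comp_equiv measurePreserving_reflectSpace
      (fun x y z => by ext <;> simp; ring) (fun x y z => rfl),
      triple_congr hu.space hv.space hw.space]

/-- The trilinear convolution followed by `p² (p² - ∂²)⁻¹`. -/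
def interaction (m : ℤ → ℤ → ℤ → ℝ) (u v w : ℤ × ℝ → ℝ) : ℤ × ℝ → ℝ :=
  resolventMul (triple m u v w)

theorem EvenL2.interaction {s : ℝ} (hs : 1 < s) {m : ℤ → ℤ → ℤ → ℝ} {M : ℝ} (hm : IsMask m M)
    {u v w : ℤ × ℝ → ℝ} (hu : EvenL2 s u) (hv : EvenL2 s v) (hw : EvenL2 s w) :
    EvenL2 s (interaction m u v w) :=
  (EvenL2.triple hs hm hu hv hw).resolventMul

theorem wsq_interaction_le {s : ℝ} (hs : 0 ≤ s) {m : ℤ → ℤ → ℤ → ℝ} {M : ℝ} (hm : IsMask m M)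
    {u v w : ℤ × ℝ → ℝ} (hu : Measurable u) (hv : Measurable v) (hw : Measurable w) :
    wsq s (interaction m u v w) ≤ ENNReal.ofReal M ^ 2 * (tripleConst s *
      (wsq s u * wsq s v * wsq s w)) :=
  (wsq_resolventMul_le s _).trans (wsq_triple_le hs hm hu hv hw)

/-- The interaction as a map on symmetric functions. -/
def interactionFun {s : ℝ} (hs : 1 < s) {m : ℤ → ℤ → ℤ → ℝ} {M : ℝ} (hm : IsMask m M)
    (u v w : EvenSpace s) : EvenSpace s :=
  (EvenL2.interaction hs hm u.evenL2_fn v.evenL2_fn w.evenL2_fn).toEvenSpace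

section InteractionCLM

variable {s : ℝ} (hs : 1 < s) {m : ℤ → ℤ → ℤ → ℝ} {M : ℝ} (hm : IsMask m M)

theorem interactionFun_ae (u v w : EvenSpace s) :
    (interactionFun hs hm u v w).fn =ᵐ[freqMeasure] interaction m u.fn v.fn w.fn :=
  EvenL2.fn_toEvenSpace _

theorem norm_interactionFun_le (u v w : EvenSpace s) :
    ‖interactionFun hs hm u v w‖ ≤ M * √(tripleConst s).toReal * ‖u‖ * ‖v‖ * ‖w‖ := by
  have hM := hm.nonneg
  have hle : ‖interactionFun hs hm u v w‖ₑ ^ 2 ≤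
      ENNReal.ofReal M ^ 2 * (tripleConst s * (‖u‖ₑ ^ 2 * ‖v‖ₑ ^ 2 * ‖w‖ₑ ^ 2)) := by
    rw [interactionFun, EvenL2.enorm_sq_toEvenSpace, EvenSpace.enorm_sq u, EvenSpace.enorm_sq v,
      EvenSpace.enorm_sq w]
    exact wsq_interaction_le (by linarith) hm u.evenL2_fn.measurable
      v.evenL2_fn.measurable w.evenL2_fn.measurable
  have htop : ENNReal.ofReal M ^ 2 * (tripleConst s * (‖u‖ₑ ^ 2 * ‖v‖ₑ ^ 2 * ‖w‖ₑ ^ 2)) ≠ ⊤ :=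
    ENNReal.mul_ne_top (by simp) (ENNReal.mul_ne_top (tripleConst_lt_top hs).ne
      (ENNReal.mul_ne_top (ENNReal.mul_ne_top (by simp) (by simp)) (by simp)))
  have hsq := ENNReal.toReal_mono htop hle
  simp only [ENNReal.toReal_mul, ENNReal.toReal_pow, toReal_enorm, ENNReal.toReal_ofReal hM]
    at hsq
  refine le_of_sq_le_sq (hsq.trans_eq ?_) (by positivity)
  rw [mul_pow, mul_pow, mul_pow, mul_pow, Real.sq_sqrt ENNReal.toReal_nonneg]
  ring

theorem interactionFun_eq_add {u v w u₁ v₁ w₁ u₂ v₂ w₂ : EvenSpace s}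
    (h : ∀ x, triple m u.fn v.fn w.fn x =
      triple m u₁.fn v₁.fn w₁.fn x + triple m u₂.fn v₂.fn w₂.fn x) :
    interactionFun hs hm u v w =
      interactionFun hs hm u₁ v₁ w₁ + interactionFun hs hm u₂ v₂ w₂ := by
  refine EvenSpace.ext ?_
  filter_upwards [interactionFun_ae hs hm u v w, interactionFun_ae hs hm u₁ v₁ w₁,
    interactionFun_ae hs hm u₂ v₂ w₂,
    EvenSpace.fn_add (interactionFun hs hm u₁ v₁ w₁) (interactionFun hs hm u₂ v₂ w₂)]
    with x hx hx₁ hx₂ hadd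
  rw [hx, hadd, hx₁, hx₂]
  simp only [interaction, resolventMul, h, mul_add]

theorem interactionFun_eq_smul {c : ℝ} {u v w u₁ v₁ w₁ : EvenSpace s}
    (h : ∀ x, triple m u.fn v.fn w.fn x = c * triple m u₁.fn v₁.fn w₁.fn x) :
    interactionFun hs hm u v w = c • interactionFun hs hm u₁ v₁ w₁ := by
  refine EvenSpace.ext ?_
  filter_upwards [interactionFun_ae hs hm u v w, interactionFun_ae hs hm u₁ v₁ w₁,
    EvenSpace.fn_smul c (interactionFun hs hm u₁ v₁ w₁)] with x hx hx₁ hsmul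
  rw [hx, hsmul, hx₁]
  simp only [interaction, resolventMul, h, mul_left_comm]

theorem interactionFun_add_left (u u' v w : EvenSpace s) :
    interactionFun hs hm (u + u') v w =
      interactionFun hs hm u v w + interactionFun hs hm u' v w :=
  interactionFun_eq_add hs hm fun x => by
    rw [triple_congr (EvenSpace.fn_add u u') EventuallyEq.rfl EventuallyEq.rfl,
      triple_add_left hs hm u.evenL2_fn.toWL2 u'.evenL2_fn.toWL2
        v.evenL2_fn.toWL2 w.evenL2_fn.toWL2]

theorem interactionFun_smul_left (c : ℝ) (u v w : EvenSpace s) :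
    interactionFun hs hm (c • u) v w = c • interactionFun hs hm u v w :=
  interactionFun_eq_smul hs hm fun x => by
    rw [triple_congr (EvenSpace.fn_smul c u) EventuallyEq.rfl EventuallyEq.rfl, triple_mul_left]

theorem interactionFun_add_mid (u v v' w : EvenSpace s) :
    interactionFun hs hm u (v + v') w =
      interactionFun hs hm u v w + interactionFun hs hm u v' w :=
  interactionFun_eq_add hs hm fun x => by
    rw [triple_congr EventuallyEq.rfl (EvenSpace.fn_add v v') EventuallyEq.rfl,
      triple_add_mid hs hm u.evenL2_fn.toWL2 v.evenL2_fn.toWL2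
        v'.evenL2_fn.toWL2 w.evenL2_fn.toWL2]

theorem interactionFun_smul_mid (c : ℝ) (u v w : EvenSpace s) :
    interactionFun hs hm u (c • v) w = c • interactionFun hs hm u v w :=
  interactionFun_eq_smul hs hm fun x => by
    rw [triple_congr EventuallyEq.rfl (EvenSpace.fn_smul c v) EventuallyEq.rfl, triple_mul_mid]

theorem interactionFun_add_right (u v w w' : EvenSpace s) :
    interactionFun hs hm u v (w + w') =
      interactionFun hs hm u v w + interactionFun hs hm u v w' :=
  interactionFun_eq_add hs hm fun x => by
    rw [triple_congr EventuallyEq.rfl EventuallyEq.rfl (EvenSpace.fn_add w w'),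
      triple_add_right hs hm u.evenL2_fn.toWL2 v.evenL2_fn.toWL2
        w.evenL2_fn.toWL2 w'.evenL2_fn.toWL2]

theorem interactionFun_smul_right (c : ℝ) (u v w : EvenSpace s) :
    interactionFun hs hm u v (c • w) = c • interactionFun hs hm u v w :=
  interactionFun_eq_smul hs hm fun x => by
    rw [triple_congr EventuallyEq.rfl EventuallyEq.rfl (EvenSpace.fn_smul c w), triple_mul_right]

/-- The interaction with a fixed first argument as a continuous bilinear map. -/
def interactionCLM₂ (u : EvenSpace s) :
    EvenSpace s →L[ℝ] EvenSpace s →L[ℝ] EvenSpace s :=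
  LinearMap.mkContinuous₂
    (LinearMap.mk₂ ℝ (fun v w => interactionFun hs hm u v w)
      (interactionFun_add_mid hs hm u) (fun c v w => interactionFun_smul_mid hs hm c u v w)
      (interactionFun_add_right hs hm u)
      (fun c v w => interactionFun_smul_right hs hm c u v w))
    (M * √(tripleConst s).toReal * ‖u‖)
    (fun v w => norm_interactionFun_le hs hm u v w)

theorem interactionCLM₂_apply (u v w : EvenSpace s) :
    interactionCLM₂ hs hm u v w = interactionFun hs hm u v w :=
  LinearMap.mkContinuous₂_apply _ _ v w

theorem norm_interactionCLM₂_le (u : EvenSpace s) :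
    ‖interactionCLM₂ hs hm u‖ ≤ M * √(tripleConst s).toReal * ‖u‖ :=
  have hM := hm.nonneg
  LinearMap.mkContinuous₂_norm_le _ (by positivity)
    (fun v w => norm_interactionFun_le hs hm u v w)

/-- The interaction as a linear map with values in the continuous bilinear maps. -/
def interactionLM :
    EvenSpace s →ₗ[ℝ] EvenSpace s →L[ℝ] EvenSpace s →L[ℝ] EvenSpace s where
  toFun := interactionCLM₂ hs hm
  map_add' u u' := by
    ext1 v
    ext1 w
    rw [add_apply, add_apply, interactionCLM₂_apply, interactionCLM₂_apply,
      interactionCLM₂_apply]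
    exact interactionFun_add_left hs hm u u' v w
  map_smul' c u := by
    ext1 v
    ext1 w
    rw [smul_apply, smul_apply, interactionCLM₂_apply, interactionCLM₂_apply]
    exact interactionFun_smul_left hs hm c u v w

/-- The interaction as a continuous trilinear map. -/
def interactionCLM :
    EvenSpace s →L[ℝ] EvenSpace s →L[ℝ] EvenSpace s →L[ℝ] EvenSpace s :=
  ⟨interactionLM hs hm, AddMonoidHomClass.continuous_of_bound (interactionLM hs hm)
    (M * √(tripleConst s).toReal) (norm_interactionCLM₂_le hs hm)⟩

theorem interactionCLM_apply (u v w : EvenSpace s) :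
    interactionCLM hs hm u v w = interactionFun hs hm u v w := by
  rw [← interactionCLM₂_apply hs hm]
  rfl

theorem interactionCLM_ae (u v w : EvenSpace s) :
    (interactionCLM hs hm u v w).fn =ᵐ[freqMeasure] interaction m u.fn v.fn w.fn := by
  rw [interactionCLM_apply]
  exact interactionFun_ae hs hm u v w

end InteractionCLM

/-! ### Slices and integrals over the frequency space -/

theorem ae_freqMeasure_slice {P : ℤ × ℝ → Prop} (h : ∀ᵐ x ∂freqMeasure, P x) (n : ℤ) :
    ∀ᵐ η : ℝ, P (n, η) :=
  Measure.ae_count_iff.1 (Measure.ae_ae_of_ae_prod h) n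

theorem ae_freqMeasure_of_slices {P : ℤ × ℝ → Prop} (hP : MeasurableSet {x | P x})
    (h : ∀ n, ∀ᵐ η : ℝ, P (n, η)) : ∀ᵐ x ∂freqMeasure, P x :=
  (Measure.ae_prod_iff_ae_ae hP).2 (Measure.ae_count_iff.2 h)

theorem lintegral_freqMeasure {f : ℤ × ℝ → ℝ≥0∞} (hf : Measurable f) :
    ∫⁻ x, f x ∂freqMeasure = ∑' n : ℤ, ∫⁻ η : ℝ, f (n, η) := by
  rw [lintegral_prod _ hf.aemeasurable, lintegral_count]

theorem lintegral_slice_le {f : ℤ × ℝ → ℝ≥0∞} (hf : Measurable f) (n : ℤ) :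
    ∫⁻ η : ℝ, f (n, η) ≤ ∫⁻ x, f x ∂freqMeasure := by
  rw [lintegral_freqMeasure hf]
  exact ENNReal.le_tsum n

section

variable {E : Type*} [NormedAddCommGroup E] {f : ℤ × ℝ → E}

theorem integrable_slice (hf : Integrable f freqMeasure) (n : ℤ) :
    Integrable fun η : ℝ => f (n, η) :=
  Measure.ae_count_iff.1 hf.prod_right_ae n

theorem summable_integral_norm_slice (hf : Integrable f freqMeasure) :
    Summable fun n : ℤ => ∫ η : ℝ, ‖f (n, η)‖ :=
  (integrable_count_iff.1 hf.integral_norm_prod_left).congr fun n =>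
    Real.norm_of_nonneg (by positivity)

theorem integral_freqMeasure [NormedSpace ℝ E] [CompleteSpace E]
    (hf : Integrable f freqMeasure) :
    ∫ x, f x ∂freqMeasure = ∑' n : ℤ, ∫ η : ℝ, f (n, η) := by
  rw [integral_prod _ hf, integral_countable hf.integral_prod_left]
  simp

end

section Pairs

variable {g : ℤ → ℤ → ℂ} {M : ℝ} {a b : ℤ × ℝ → ℂ}

theorem summable_norm_mul_integral_slices (hg : ∀ q r, ‖g q r‖ ≤ M)
    (ha : Integrable a freqMeasure) (hb : Integrable b freqMeasure) :
    Summable fun k : ℤ × ℤ =>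
      ‖g k.1 k.2 * (∫ η : ℝ, a (k.1, η)) * ∫ η : ℝ, b (k.2, η)‖ := by
  have hM : 0 ≤ M := (norm_nonneg _).trans (hg 0 0)
  refine Summable.of_nonneg_of_le (fun k => norm_nonneg _) (fun k => ?_)
    (((summable_integral_norm_slice ha).mul_of_nonneg (summable_integral_norm_slice hb)
      (fun _ => by positivity) (fun _ => by positivity)).mul_left M)
  rw [norm_mul, norm_mul, mul_assoc]
  gcongr
  · exact hg _ _
  · exact norm_integral_le_integral_norm _
  · exact norm_integral_le_integral_norm _

theorem integrable_mul_mul_prod (hg : ∀ q r, ‖g q r‖ ≤ M) (ha : Integrable a freqMeasure)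
    (hb : Integrable b freqMeasure) :
    Integrable (fun z : (ℤ × ℝ) × (ℤ × ℝ) => g z.1.1 z.2.1 * a z.1 * b z.2)
      (freqMeasure.prod freqMeasure) := by
  have hgm : Measurable fun z : (ℤ × ℝ) × (ℤ × ℝ) => g z.1.1 z.2.1 :=
    (measurable_of_countable (fun k : ℤ × ℤ => g k.1 k.2)).comp
      (by fun_prop : Measurable fun z : (ℤ × ℝ) × (ℤ × ℝ) => (z.1.1, z.2.1))
  simp_rw [mul_assoc]
  exact (ha.mul_prod hb).bdd_mul hgm.aestronglyMeasurable (ae_of_all _ fun z => hg _ _)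

theorem integral_mul_mul_right (hg : ∀ q r, ‖g q r‖ ≤ M) (hb : Integrable b freqMeasure)
    (y : ℤ × ℝ) :
    ∫ z, g y.1 z.1 * a y * b z ∂freqMeasure = a y * ∑' r, g y.1 r * ∫ η : ℝ, b (r, η) := by
  have hi : Integrable (fun z : ℤ × ℝ => g y.1 z.1 * b z) freqMeasure :=
    hb.bdd_mul ((measurable_of_countable (g y.1)).comp measurable_fst).aestronglyMeasurable
      (ae_of_all _ fun z => hg _ _)
  simp_rw [mul_right_comm _ (a y), mul_comm _ (a y)]
  rw [integral_const_mul, integral_freqMeasure hi]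
  simp_rw [integral_const_mul]

theorem integral_mul_mul_prod (hg : ∀ q r, ‖g q r‖ ≤ M) (ha : Integrable a freqMeasure)
    (hb : Integrable b freqMeasure) :
    ∫ z : (ℤ × ℝ) × (ℤ × ℝ), g z.1.1 z.2.1 * a z.1 * b z.2 ∂(freqMeasure.prod freqMeasure) =
      ∑' k : ℤ × ℤ, g k.1 k.2 * (∫ η : ℝ, a (k.1, η)) * ∫ η : ℝ, b (k.2, η) := by
  have hint := integrable_mul_mul_prod hg ha hb
  have hint' : Integrable (fun y : ℤ × ℝ => a y * ∑' r, g y.1 r * ∫ η : ℝ, b (r, η))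
      freqMeasure := by
    simpa only [integral_mul_mul_right hg hb] using hint.integral_prod_left
  rw [integral_prod _ hint]
  simp only [integral_mul_mul_right hg hb]
  rw [integral_freqMeasure hint', (summable_norm_mul_integral_slices hg ha hb).of_norm.tsum_prod]
  refine tsum_congr fun q => ?_
  dsimp only
  rw [integral_mul_const, ← tsum_mul_left]
  refine tsum_congr fun r => ?_
  ring

end Pairs

/-! ### Envelopes of the harmonics -/

/-- The plane wave `e^{i ξ ζ}` with `ξ = 2 π η`. -/
def wave (ζ η : ℝ) : ℂ := Complex.exp (2 * Real.pi * η * ζ * Complex.I)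

theorem norm_wave (ζ η : ℝ) : ‖wave ζ η‖ = 1 := by
  have hreal : (2 * Real.pi * η * ζ * Complex.I : ℂ) =
      ((2 * Real.pi * η * ζ : ℝ) : ℂ) * Complex.I := by
    push_cast; ring
  rw [wave, hreal, Complex.norm_exp_ofReal_mul_I]

theorem wave_add (ζ a b : ℝ) : wave ζ (a + b) = wave ζ a * wave ζ b := by
  rw [wave, wave, wave, ← Complex.exp_add]
  push_cast
  congr 1
  ring

theorem conj_wave (ζ η : ℝ) : conj (wave ζ η) = wave ζ (-η) := by
  rw [wave, wave, ← Complex.exp_conj]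
  congr 1
  apply Complex.ext <;> simp

theorem wave_neg_left (ζ η : ℝ) : wave (-ζ) η = wave ζ (-η) := by
  rw [wave, wave]
  push_cast
  congr 1
  ring

theorem continuous_wave (ζ : ℝ) : Continuous (wave ζ) := by
  unfold wave
  fun_prop

theorem fourierInv_eq_integral_wave (f : ℝ → ℂ) (ζ : ℝ) : 𝓕⁻ f ζ = ∫ η : ℝ, wave ζ η * f η := by
  rw [Real.fourierInv_eq']
  congr with η
  rw [smul_eq_mul, wave]
  congr 2
  simp only [RCLike.inner_apply, Real.ringHom_apply, Complex.ofReal_mul, Complex.ofReal_ofNat,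
    mul_eq_mul_right_iff, Complex.I_ne_zero, or_false]
  ring

theorem integrable_wave_mul {f : ℝ → ℂ} (hf : Integrable f) (ζ : ℝ) :
    Integrable fun η => wave ζ η * f η :=
  hf.bdd_mul (c := 1) (continuous_wave ζ).aestronglyMeasurable
    (ae_of_all _ fun η => (norm_wave ζ η).le)

/-- The envelope of the harmonic `p = 2 n + 1` of the field with Fourier transform `u`. -/
def envelope (u : ℤ × ℝ → ℝ) (n : ℤ) : ℝ → ℂ := 𝓕⁻ fun η : ℝ => (u (n, η) : ℂ)

theorem envelope_eq (u : ℤ × ℝ → ℝ) (n : ℤ) (ζ : ℝ) :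
    envelope u n ζ = ∫ η : ℝ, wave ζ η * (u (n, η) : ℂ) :=
  fourierInv_eq_integral_wave _ _

theorem envelope_congr {u v : ℤ × ℝ → ℝ} (h : u =ᵐ[freqMeasure] v) (n : ℤ) :
    envelope u n = envelope v n := by
  funext ζ
  refine Real.fourierInv_congr_ae ?_ ζ
  filter_upwards [ae_freqMeasure_slice h n] with η hη
  rw [hη]

section Envelope

variable {s : ℝ} {u v w : ℤ × ℝ → ℝ}

theorem WL2.integrable_complex (hs : 1 < s) (hu : WL2 s u) :
    Integrable (fun x => (u x : ℂ)) freqMeasure :=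
  (hu.integrable hs).ofReal

theorem WL2.integrable_slice (hs : 1 < s) (hu : WL2 s u) (n : ℤ) :
    Integrable fun η : ℝ => (u (n, η) : ℂ) :=
  XNLS.integrable_slice (hu.integrable_complex hs) n

theorem WL2.memLp_slice (hs : 1 < s) (hu : WL2 s u) (n : ℤ) :
    MemLp (fun η : ℝ => (u (n, η) : ℂ)) 2 := by
  refine ⟨(hu.integrable_slice hs n).aestronglyMeasurable, ?_⟩
  rw [eLpNorm_lt_top_iff_lintegral_rpow_enorm_lt_top (by simp) (by simp)]
  have h := (lintegral_slice_le (hu.measurable.enorm.pow_const 2) n).trans_lt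
    (hu.lintegral_sq_lt_top (by linarith))
  simpa [← ofReal_norm] using h

theorem norm_envelope_le (u : ℤ × ℝ → ℝ) (n : ℤ) (ζ : ℝ) :
    ‖envelope u n ζ‖ ≤ ∫ η : ℝ, ‖(u (n, η) : ℂ)‖ := norm_fourierInv_le _ _

theorem WL2.summable_norm (hs : 1 < s) (hu : WL2 s u) :
    Summable fun n : ℤ => ∫ η : ℝ, ‖(u (n, η) : ℂ)‖ :=
  summable_integral_norm_slice (f := fun x => (u x : ℂ)) (hu.integrable_complex hs)

theorem WL2.summable_envelope (hs : 1 < s) (hu : WL2 s u) (ζ : ℝ) :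
    Summable fun n : ℤ => ‖envelope u n ζ‖ :=
  Summable.of_nonneg_of_le (fun _ => norm_nonneg _) (fun n => norm_envelope_le u n ζ)
    (hu.summable_norm hs)

theorem WL2.exists_norm_envelope_le (hs : 1 < s) (hu : WL2 s u) :
    ∃ M, ∀ n ζ, ‖envelope u n ζ‖ ≤ M :=
  ⟨_, fun n ζ => (norm_envelope_le u n ζ).trans
    ((hu.summable_norm hs).le_tsum n fun _ _ => by positivity)⟩

theorem WL2.continuous_envelope (hs : 1 < s) (hu : WL2 s u) (n : ℤ) :
    Continuous (envelope u n) := continuous_fourierInv (hu.integrable_slice hs n)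

theorem EvenL2.slice_neg (hu : EvenL2 s u) (n : ℤ) : ∀ᵐ η : ℝ, u (n, -η) = u (n, η) :=
  ae_freqMeasure_slice (P := fun x => u (reflectSpace x) = u x) hu.space n

theorem EvenL2.slice_harmonic (hu : EvenL2 s u) (n : ℤ) :
    ∀ᵐ η : ℝ, u (-1 - n, η) = u (n, η) :=
  ae_freqMeasure_slice (P := fun x => u (reflectHarmonic x) = u x) hu.harmonic n

theorem EvenL2.envelope_neg (hu : EvenL2 s u) (n : ℤ) (ζ : ℝ) :
    envelope u n (-ζ) = envelope u n ζ := by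
  rw [envelope_eq, envelope_eq, ← integral_neg_eq_self]
  refine integral_congr_ae ?_
  filter_upwards [hu.slice_neg n] with η hη
  rw [hη, wave_neg_left, neg_neg]

theorem EvenL2.conj_envelope (hu : EvenL2 s u) (n : ℤ) (ζ : ℝ) :
    conj (envelope u n ζ) = envelope u n ζ := by
  refine Eq.trans ?_ (hu.envelope_neg n ζ)
  rw [envelope_eq, envelope_eq, ← integral_conj]
  congr with η
  rw [map_mul, conj_wave, wave_neg_left, Complex.conj_ofReal]

theorem EvenL2.envelope_reflect (hu : EvenL2 s u) (n : ℤ) :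
    envelope u (-1 - n) = envelope u n := by
  funext ζ
  rw [envelope_eq, envelope_eq]
  refine integral_congr_ae ?_
  filter_upwards [hu.slice_harmonic n] with η hη
  rw [hη]

theorem ae_eq_of_envelope_eq (hs : 1 < s) (hu : WL2 s u) (hv : WL2 s v)
    (h : ∀ n, envelope u n = envelope v n) : u =ᵐ[freqMeasure] v := by
  refine ae_freqMeasure_of_slices (measurableSet_eq_fun hu.measurable hv.measurable) fun n => ?_
  filter_upwards [ae_eq_of_fourierInv_eq (hu.integrable_slice hs n) (hu.memLp_slice hs n)
    (hv.integrable_slice hs n) (hv.memLp_slice hs n) (h n)] with η hη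
  exact_mod_cast hη

theorem integrable_wave_mul_freq {f : ℤ × ℝ → ℂ} (hf : Integrable f freqMeasure) (ζ : ℝ) :
    Integrable (fun x : ℤ × ℝ => wave ζ x.2 * f x) freqMeasure :=
  hf.bdd_mul (c := 1) ((continuous_wave ζ).comp continuous_snd).aestronglyMeasurable
    (ae_of_all _ fun x => (norm_wave ζ x.2).le)

theorem sub_sub_sub_shift_eq (n : ℤ) (η : ℝ) (z : (ℤ × ℝ) × (ℤ × ℝ)) :
    ((n, η) : ℤ × ℝ) - z.1 - z.2 - (1, 0) =
      (n - z.1.1 - z.2.1 - 1, η - (z.1.2 + z.2.2)) := by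
  ext <;> simp
  ring

/-- The integrand of the inverse Fourier transform of a trilinear convolution, as a function of all
frequencies, to which Fubini's theorem is applied. -/
def waveTriple (m : ℤ → ℤ → ℤ → ℝ) (u v w : ℤ × ℝ → ℝ) (n : ℤ) (ζ η : ℝ)
    (z : (ℤ × ℝ) × (ℤ × ℝ)) : ℂ :=
  wave ζ η * ((m n z.1.1 z.2.1 * (u z.1 * v z.2 * w ((n, η) - z.1 - z.2 - (1, 0))) : ℝ) : ℂ)

theorem measurable_waveTriple (m : ℤ → ℤ → ℤ → ℝ) (hu : Measurable u) (hv : Measurable v)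
    (hw : Measurable w) (n : ℤ) (ζ : ℝ) :
    Measurable fun p : ℝ × ((ℤ × ℝ) × (ℤ × ℝ)) => waveTriple m u v w n ζ p.1 p.2 := by
  have hreal := (measurable_triple_integrand m hu hv hw).comp
    (by fun_prop : Measurable fun p : ℝ × ((ℤ × ℝ) × (ℤ × ℝ)) => (((n, p.1) : ℤ × ℝ), p.2))
  exact ((continuous_wave ζ).measurable.comp measurable_fst).mul
    (Complex.measurable_ofReal.comp hreal)

variable {m : ℤ → ℤ → ℤ → ℝ} {M : ℝ}

theorem enorm_waveTriple_le (hm : IsMask m M) (n : ℤ) (ζ η : ℝ) (z : (ℤ × ℝ) × (ℤ × ℝ)) :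
    ‖waveTriple m u v w n ζ η z‖ₑ ≤ ENNReal.ofReal M * (‖u z.1‖ₑ * ‖v z.2‖ₑ) *
      ‖w (n - z.1.1 - z.2.1 - 1, η - (z.1.2 + z.2.2))‖ₑ := by
  have hnorm : ‖waveTriple m u v w n ζ η z‖ₑ =
      ‖m n z.1.1 z.2.1 * (u z.1 * v z.2 * w ((n, η) - z.1 - z.2 - (1, 0)))‖ₑ := by
    rw [waveTriple, enorm_mul, ← ofReal_norm (wave ζ η), norm_wave, ENNReal.ofReal_one, one_mul,
      ← ofReal_norm, Complex.norm_real, ofReal_norm]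
  rw [hnorm, ← sub_sub_sub_shift_eq]
  refine (enorm_triple_integrand_le hm u v w (n, η) z).trans_eq ?_
  ring

theorem lintegral_enorm_waveTriple_le (hm : IsMask m M) (hw : Measurable w) (n : ℤ) (ζ : ℝ)
    (z : (ℤ × ℝ) × (ℤ × ℝ)) :
    ∫⁻ η : ℝ, ‖waveTriple m u v w n ζ η z‖ₑ ≤
      ENNReal.ofReal M * ((∫⁻ x, ‖w x‖ₑ ∂freqMeasure) * (‖u z.1‖ₑ * ‖v z.2‖ₑ)) := by
  refine (lintegral_mono fun η => enorm_waveTriple_le hm n ζ η z).trans ?_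
  rw [lintegral_const_mul _ (by fun_prop),
    lintegral_sub_right_eq_self (fun η => ‖w (n - z.1.1 - z.2.1 - 1, η)‖ₑ)]
  refine (mul_le_mul_right (lintegral_slice_le hw.enorm _) _).trans_eq ?_
  ring

theorem integrable_waveTriple (hs : 1 < s) (hm : IsMask m M) (hu : WL2 s u) (hv : WL2 s v)
    (hw : WL2 s w) (n : ℤ) (ζ : ℝ) :
    Integrable (fun p : ℝ × ((ℤ × ℝ) × (ℤ × ℝ)) => waveTriple m u v w n ζ p.1 p.2)
      (volume.prod (freqMeasure.prod freqMeasure)) := by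
  have hmu := hu.measurable
  have hmv := hv.measurable
  have hmeas := measurable_waveTriple m hmu hmv hw.measurable n ζ
  refine ⟨hmeas.aestronglyMeasurable, ?_⟩
  rw [hasFiniteIntegral_iff_enorm, lintegral_prod_symm _ hmeas.enorm.aemeasurable]
  refine (lintegral_mono fun z => lintegral_enorm_waveTriple_le hm hw.measurable n ζ z).trans_lt ?_
  rw [lintegral_const_mul _ (by fun_prop), lintegral_const_mul _ (by fun_prop),
    lintegral_prod_mul (f := fun y => ‖u y‖ₑ) (g := fun y => ‖v y‖ₑ) (by fun_prop) (by fun_prop)]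
  exact ENNReal.mul_lt_top ENNReal.ofReal_lt_top (ENNReal.mul_lt_top (hw.integrable hs).2
    (ENNReal.mul_lt_top (hu.integrable hs).2 (hv.integrable hs).2))

theorem integral_waveTriple (m : ℤ → ℤ → ℤ → ℝ) (u v w : ℤ × ℝ → ℝ) (n : ℤ) (ζ : ℝ)
    (z : (ℤ × ℝ) × (ℤ × ℝ)) :
    ∫ η : ℝ, waveTriple m u v w n ζ η z = (m n z.1.1 z.2.1 : ℂ) *
      envelope w (n - z.1.1 - z.2.1 - 1) ζ * (wave ζ z.1.2 * u z.1) * (wave ζ z.2.2 * v z.2) := by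
  have hsplit (η : ℝ) : wave ζ η = wave ζ z.1.2 * wave ζ z.2.2 *
      wave ζ (η - (z.1.2 + z.2.2)) := by
    rw [← wave_add, ← wave_add, add_sub_cancel]
  have hshift (η : ℝ) : waveTriple m u v w n ζ η z = (fun t : ℝ => (m n z.1.1 z.2.1 : ℂ) *
      (wave ζ z.1.2 * u z.1) * (wave ζ z.2.2 * v z.2) * (wave ζ t *
      (w (n - z.1.1 - z.2.1 - 1, t) : ℂ))) (η - (z.1.2 + z.2.2)) := by
    rw [waveTriple, sub_sub_sub_shift_eq, hsplit]
    push_cast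
    ring
  simp_rw [hshift]
  rw [integral_sub_right_eq_self (fun t : ℝ => (m n z.1.1 z.2.1 : ℂ) * (wave ζ z.1.2 * u z.1) *
    (wave ζ z.2.2 * v z.2) * (wave ζ t * (w (n - z.1.1 - z.2.1 - 1, t) : ℂ))),
    integral_const_mul, ← envelope_eq]
  ring

theorem exists_norm_mask_mul_envelope_le (hs : 1 < s) (hm : IsMask m M) (hw : WL2 s w) (n : ℤ)
    (ζ : ℝ) : ∃ K, ∀ q r : ℤ, ‖(m n q r : ℂ) * envelope w (n - q - r - 1) ζ‖ ≤ K := by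
  obtain ⟨Mw, hMw⟩ := hw.exists_norm_envelope_le hs
  refine ⟨M * Mw, fun q r => ?_⟩
  rw [norm_mul, Complex.norm_real]
  exact mul_le_mul (hm.bound _ _ _) (hMw _ _) (norm_nonneg _) hm.nonneg

theorem summable_envelope_triple (hs : 1 < s) (hm : IsMask m M) (hu : WL2 s u) (hv : WL2 s v)
    (hw : WL2 s w) (n : ℤ) (ζ : ℝ) :
    Summable fun k : ℤ × ℤ => ‖(m n k.1 k.2 : ℂ) * (envelope u k.1 ζ * envelope v k.2 ζ *
      envelope w (n - k.1 - k.2 - 1) ζ)‖ := by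
  obtain ⟨K, hK⟩ := exists_norm_mask_mul_envelope_le hs hm hw n ζ
  refine (summable_norm_mul_integral_slices hK
    (integrable_wave_mul_freq (hu.integrable_complex hs) ζ)
    (integrable_wave_mul_freq (hv.integrable_complex hs) ζ)).congr fun k => ?_
  rw [← envelope_eq, ← envelope_eq]
  congr 1
  ring

theorem envelope_triple (hs : 1 < s) (hm : IsMask m M) (hu : WL2 s u) (hv : WL2 s v)
    (hw : WL2 s w) (n : ℤ) (ζ : ℝ) :
    envelope (triple m u v w) n ζ = ∑' k : ℤ × ℤ, (m n k.1 k.2 : ℂ) *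
      (envelope u k.1 ζ * envelope v k.2 ζ * envelope w (n - k.1 - k.2 - 1) ζ) := by
  obtain ⟨K, hK⟩ := exists_norm_mask_mul_envelope_le hs hm hw n ζ
  calc envelope (triple m u v w) n ζ
      = ∫ η : ℝ, ∫ z, waveTriple m u v w n ζ η z ∂(freqMeasure.prod freqMeasure) := by
        simp only [envelope_eq, waveTriple, triple, integral_const_mul, integral_complex_ofReal]
    _ = ∫ z, (∫ η : ℝ, waveTriple m u v w n ζ η z) ∂(freqMeasure.prod freqMeasure) :=
        integral_integral_swap (integrable_waveTriple hs hm hu hv hw n ζ)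
    _ = ∑' k : ℤ × ℤ, (m n k.1 k.2 : ℂ) * envelope w (n - k.1 - k.2 - 1) ζ *
          envelope u k.1 ζ * envelope v k.2 ζ := by
        simp_rw [integral_waveTriple, envelope_eq u, envelope_eq v]
        exact integral_mul_mul_prod hK
          (integrable_wave_mul_freq (hu.integrable_complex hs) ζ)
          (integrable_wave_mul_freq (hv.integrable_complex hs) ζ)
    _ = _ := by
        congr with k
        ring

end Envelope

/-! ### The field with given Fourier transform -/

/-- The harmonic `e^{ipφ}` with `p = 2 n + 1`. -/
def carrier (n : ℤ) (φ : ℝ) : ℂ := Complex.exp (Complex.I * ((2 * n + 1 : ℤ) : ℂ) * φ)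

theorem norm_carrier (n : ℤ) (φ : ℝ) : ‖carrier n φ‖ = 1 := by
  have hreal : (Complex.I * ((2 * n + 1 : ℤ) : ℂ) * φ) =
      (((2 * n + 1 : ℤ) * φ : ℝ) : ℂ) * Complex.I := by push_cast; ring
  rw [carrier, hreal, Complex.norm_exp_ofReal_mul_I]

theorem continuous_carrier (n : ℤ) : Continuous (carrier n) := by
  unfold carrier; fun_prop

theorem conj_carrier (n : ℤ) (φ : ℝ) : conj (carrier n φ) = carrier (-1 - n) φ := by
  rw [carrier, carrier, ← Complex.exp_conj]
  congr 1
  simp only [map_mul, Complex.conj_I, Complex.conj_ofReal, map_intCast]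
  push_cast
  ring

theorem carrier_add_two_pi (n : ℤ) (φ : ℝ) : carrier n (φ + 2 * Real.pi) = carrier n φ := by
  rw [carrier, carrier, Complex.exp_eq_exp_iff_exists_int]
  exact ⟨2 * n + 1, by push_cast; ring⟩

theorem norm_exp_neg_I_int_mul (p : ℤ) (φ : ℝ) : ‖Complex.exp (-(Complex.I * p * φ))‖ = 1 := by
  have hreal : -(Complex.I * p * φ) = ((-(p * φ) : ℝ) : ℂ) * Complex.I := by push_cast; ring
  rw [hreal, Complex.norm_exp_ofReal_mul_I]

theorem carrier_mul_exp (n p : ℤ) (φ : ℝ) :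
    carrier n φ * Complex.exp (-(Complex.I * p * φ)) =
      Complex.exp (Complex.I * ((2 * n + 1 - p : ℤ) : ℂ) * φ) := by
  rw [carrier, ← Complex.exp_add]
  congr 1
  push_cast
  ring

theorem integral_exp_int_mul (k : ℤ) :
    ∫ φ in (-Real.pi)..Real.pi, Complex.exp (Complex.I * k * φ) =
      if k = 0 then (2 * Real.pi : ℂ) else 0 := by
  split_ifs with hk
  · subst hk
    simp only [Int.cast_zero, mul_zero, zero_mul, Complex.exp_zero,
      intervalIntegral.integral_const, sub_neg_eq_add, Complex.real_smul, Complex.ofReal_add,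
      mul_one]
    ring
  · have hc : Complex.I * (k : ℂ) ≠ 0 := mul_ne_zero Complex.I_ne_zero (by exact_mod_cast hk)
    rw [integral_exp_mul_complex hc, div_eq_zero_iff, sub_eq_zero]
    left
    rw [Complex.exp_eq_exp_iff_exists_int]
    exact ⟨k, by push_cast; ring⟩

/-- The field with Fourier transform `u`, as a complex number. -/
def cfield (u : ℤ × ℝ → ℝ) (ζ φ : ℝ) : ℂ := ∑' n : ℤ, envelope u n ζ * carrier n φ

/-- The field with Fourier transform `u`. -/
def field (u : ℤ × ℝ → ℝ) (ζ φ : ℝ) : ℝ := (cfield u ζ φ).re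

section Field

variable {s : ℝ} {u : ℤ × ℝ → ℝ}

theorem EvenL2.conj_cfield (hu : EvenL2 s u) (ζ φ : ℝ) :
    conj (cfield u ζ φ) = cfield u ζ φ := by
  have hinv : Function.Involutive (fun n : ℤ => -1 - n) := fun n => by simp
  rw [cfield, Complex.conj_tsum, ← (hinv.toPerm).tsum_eq (fun n => envelope u n ζ * carrier n φ)]
  congr with n
  rw [map_mul, hu.conj_envelope, conj_carrier]
  change _ = envelope u (-1 - n) ζ * carrier (-1 - n) φ
  rw [hu.envelope_reflect]

theorem EvenL2.ofReal_field (hu : EvenL2 s u) (ζ φ : ℝ) : (field u ζ φ : ℂ) = cfield u ζ φ :=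
  Complex.conj_eq_iff_re.1 (hu.conj_cfield ζ φ)

theorem norm_envelope_mul_carrier (n : ℤ) (ζ φ : ℝ) :
    ‖envelope u n ζ * carrier n φ‖ = ‖envelope u n ζ‖ := by
  rw [norm_mul, norm_carrier, mul_one]

theorem WL2.continuous_cfield (hs : 1 < s) (hu : WL2 s u) :
    Continuous (Function.uncurry (cfield u)) := by
  refine continuous_tsum (fun n => ?_) (hu.summable_norm hs) fun n x => ?_
  · exact ((hu.continuous_envelope hs n).comp continuous_fst).mul
      ((continuous_carrier n).comp continuous_snd)
  · rw [norm_envelope_mul_carrier]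
    exact norm_envelope_le u n x.1

theorem WL2.continuous_field (hs : 1 < s) (hu : WL2 s u) :
    Continuous (Function.uncurry (field u)) :=
  Complex.continuous_re.comp (hu.continuous_cfield hs)

theorem field_periodic (u : ℤ × ℝ → ℝ) (ζ : ℝ) :
    Function.Periodic (field u ζ) (2 * Real.pi) := fun φ => by
  simp only [field, cfield, carrier_add_two_pi]

theorem tendsto_envelope (u : ℤ × ℝ → ℝ) (n : ℤ) :
    Tendsto (envelope u n) (cocompact ℝ) (𝓝 0) := by
  rw [envelope, Real.fourierInv_eq_fourier_comp_neg]
  exact Real.zero_at_infty_fourier _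

theorem WL2.tendsto_field (hs : 1 < s) (hu : WL2 s u) (φ : ℝ) :
    Tendsto (fun ζ => field u ζ φ) (cocompact ℝ) (𝓝 0) := by
  have h : Tendsto (fun ζ => cfield u ζ φ) (cocompact ℝ) (𝓝 (∑' _ : ℤ, 0)) := by
    refine tendsto_tsum_of_dominated_convergence (hu.summable_norm hs) (fun n => ?_)
      (Eventually.of_forall fun ζ n => ?_)
    · simpa using (tendsto_envelope u n).mul_const (carrier n φ)
    · rw [norm_envelope_mul_carrier]
      exact norm_envelope_le u n ζ
  rw [tsum_zero] at h
  exact (Complex.continuous_re.tendsto 0).comp h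

theorem WL2.hasSum_integral_cfield (hs : 1 < s) (hu : WL2 s u) (p : ℤ) (ζ : ℝ) :
    HasSum (fun n : ℤ => ∫ φ in (-Real.pi)..Real.pi,
      envelope u n ζ * carrier n φ * Complex.exp (-(Complex.I * p * φ)))
      (∫ φ in (-Real.pi)..Real.pi, cfield u ζ φ * Complex.exp (-(Complex.I * p * φ))) := by
  refine intervalIntegral.hasSum_integral_of_dominated_convergence
    (fun n _ => ‖envelope u n ζ‖) (fun n => ?_) (fun n => ae_of_all _ fun φ _ => ?_)
    (ae_of_all _ fun φ _ => hu.summable_envelope hs ζ) intervalIntegrable_const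
    (ae_of_all _ fun φ _ => HasSum.mul_right _ (Summable.hasSum (Summable.of_norm ?_)))
  · have hcarrier := continuous_carrier n
    exact Continuous.aestronglyMeasurable (by fun_prop)
  · rw [norm_mul, norm_envelope_mul_carrier, norm_exp_neg_I_int_mul, mul_one]
  · simpa only [norm_envelope_mul_carrier] using hu.summable_envelope hs ζ

theorem EvenL2.mode_field (hs : 1 < s) (hu : EvenL2 s u) (p : ℤ) (ζ : ℝ) :
    mode (field u) p ζ = ∑' n : ℤ, if 2 * n + 1 - p = 0 then envelope u n ζ else 0 := by
  simp_rw [mode, hu.ofReal_field]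
  rw [← (hu.toWL2.hasSum_integral_cfield hs p ζ).tsum_eq, ← tsum_mul_left]
  refine tsum_congr fun n => ?_
  have hcombine (φ : ℝ) : envelope u n ζ * carrier n φ * Complex.exp (-(Complex.I * p * φ)) =
      envelope u n ζ * Complex.exp (Complex.I * ((2 * n + 1 - p : ℤ) : ℂ) * φ) := by
    rw [mul_assoc, carrier_mul_exp]
  simp_rw [hcombine]
  rw [intervalIntegral.integral_const_mul, integral_exp_int_mul]
  have hpi : (Real.pi : ℂ) ≠ 0 := by exact_mod_cast Real.pi_ne_zero
  split_ifs
  · field_simp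
  · simp

theorem EvenL2.mode_field_odd (hs : 1 < s) (hu : EvenL2 s u) (n : ℤ) :
    mode (field u) (2 * n + 1) = envelope u n := by
  funext ζ
  rw [hu.mode_field hs, tsum_eq_single n]
  · simp
  · intro k hk
    rw [if_neg]
    omega

theorem EvenL2.mode_field_even (hs : 1 < s) (hu : EvenL2 s u) {p : ℤ} (hp : Even p) (ζ : ℝ) :
    mode (field u) p ζ = 0 := by
  rw [hu.mode_field hs]
  convert tsum_zero with n
  rw [if_neg]
  obtain ⟨k, rfl⟩ := hp
  omega

/-! ### Energies -/

/-- The enumeration `n ↦ 2 n + 1` of the odd integers. -/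
def oddEquiv : ℤ ≃ {p : ℤ // Odd p} where
  toFun n := ⟨2 * n + 1, ⟨n, rfl⟩⟩
  invFun p := p.1 / 2
  left_inv n := by simp; omega
  right_inv p := by
    obtain ⟨_, k, rfl⟩ := p
    apply Subtype.ext
    simp only [add_left_inj, mul_eq_mul_left_iff, OfNat.ofNat_ne_zero, or_false]
    omega

theorem modeEnergy_envelope (hs : 1 < s) (hu : WL2 s u) (n : ℤ) :
    modeEnergy s (2 * n + 1) (envelope u n) = ∫⁻ η : ℝ, eweight s (n, η) * ‖u (n, η)‖ₑ ^ 2 := by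
  have h := memLp_fourierInv (hu.integrable_slice hs n) (hu.memLp_slice hs n)
  have h' : MemLp (envelope u n) 2 (volume : Measure ℝ) := h
  rw [modeEnergy, dif_pos h']
  refine lintegral_congr_ae ?_
  have e : 𝓕 (h'.toLp (envelope u n)) = (hu.memLp_slice hs n).toLp _ :=
    fourier_toLp_fourierInv (hu.integrable_slice hs n) (hu.memLp_slice hs n) h
  rw [e]
  filter_upwards [(hu.memLp_slice hs n).coeFn_toLp] with η hη
  rw [hη, eweight, weight, freqSymbol, ← ofReal_norm, ← ofReal_norm, Complex.norm_real]

theorem wsq_eq_tsum (hu : Measurable u) :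
    wsq s u = ∑' n : ℤ, ∫⁻ η : ℝ, eweight s (n, η) * ‖u (n, η)‖ₑ ^ 2 := by
  have hW := measurable_eweight s
  exact lintegral_freqMeasure (by fun_prop)

theorem xNorm_eq_tsum (s : ℝ) (U : ℝ → ℝ → ℝ) :
    xNorm s U = (∑' n : ℤ, modeEnergy s (2 * n + 1) (mode U (2 * n + 1))) ^ (1 / 2 : ℝ) := by
  rw [xNorm, ← oddEquiv.tsum_eq]
  rfl

theorem xNorm_eq_of_mode_eq (hs : 1 < s) (hu : WL2 s u) {U : ℝ → ℝ → ℝ}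
    (h : ∀ n, mode U (2 * n + 1) = envelope u n) : xNorm s U = wsq s u ^ (1 / 2 : ℝ) := by
  rw [xNorm_eq_tsum, wsq_eq_tsum hu.measurable]
  simp_rw [h, modeEnergy_envelope hs hu]

theorem wsq_comp_equiv {σ : ℤ × ℝ ≃ᵐ ℤ × ℝ} (hσ : MeasurePreserving σ freqMeasure freqMeasure)
    (hw : ∀ x, weight s (σ x) = weight s x) (u : ℤ × ℝ → ℝ) : wsq s (u ∘ σ) = wsq s u := by
  rw [wsq, wsq, ← hσ.lintegral_comp_emb σ.measurableEmbedding fun x => eweight s x * ‖u x‖ₑ ^ 2]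
  simp_rw [eweight, hw, Function.comp_apply]

theorem WL2.comp_equiv {σ : ℤ × ℝ ≃ᵐ ℤ × ℝ} (hσ : MeasurePreserving σ freqMeasure freqMeasure)
    (hw : ∀ x, weight s (σ x) = weight s x) (hu : WL2 s u) : WL2 s (u ∘ σ) :=
  ⟨hu.measurable.comp σ.measurable, (wsq_comp_equiv hσ hw u).trans_lt hu.finite⟩

theorem envelope_comp_reflectSpace (u : ℤ × ℝ → ℝ) (n : ℤ) (ζ : ℝ) :
    envelope (u ∘ reflectSpace) n ζ = envelope u n (-ζ) := by
  rw [envelope_eq, envelope_eq, ← integral_neg_eq_self]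
  congr with η
  rw [wave_neg_left, Function.comp_apply, reflectSpace_apply, neg_neg]

theorem WL2.evenL2_of_envelope (hs : 1 < s) (hu : WL2 s u)
    (hrefl : ∀ n, envelope u (-1 - n) = envelope u n)
    (heven : ∀ n ζ, envelope u n (-ζ) = envelope u n ζ) : EvenL2 s u where
  toWL2 := hu
  harmonic := ae_eq_of_envelope_eq hs
    (hu.comp_equiv measurePreserving_reflectHarmonic (weight_reflectHarmonic s)) hu hrefl
  space := ae_eq_of_envelope_eq hs
    (hu.comp_equiv measurePreserving_reflectSpace (weight_reflectSpace s)) hu fun n =>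
      funext fun ζ => (envelope_comp_reflectSpace u n ζ).trans (heven n ζ)

theorem memLp_of_modeEnergy_lt_top {p : ℤ} {f : ℝ → ℂ} (h : modeEnergy s p f < ⊤) :
    MemLp f 2 := by
  by_contra hf
  rw [modeEnergy, dif_neg hf] at h
  exact lt_irrefl _ h

theorem integrable_of_lintegral_eweight_lt_top (hs : 1 < s) {n : ℤ} {g : ℝ → ℂ}
    (hg : AEStronglyMeasurable g) (h : ∫⁻ η : ℝ, eweight s (n, η) * ‖g η‖ₑ ^ 2 < ⊤) :
    Integrable g := by
  have hW := measurable_eweight s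
  have hinv : ∫⁻ η : ℝ, (eweight s (n, η))⁻¹ < ⊤ :=
    (lintegral_slice_le hW.inv n).trans_lt (lintegral_inv_eweight_lt_top hs)
  have hsq := (sq_lintegral_le_weighted hg.enorm (W := fun η : ℝ => eweight s (n, η))
    (by fun_prop) (fun _ => eweight_ne_zero s _) (fun _ => eweight_ne_top s _)).trans_lt
    (ENNReal.mul_lt_top hinv h)
  exact ⟨hg, hasFiniteIntegral_iff_enorm.2
    ((ENNReal.pow_lt_top_iff.1 hsq).resolve_right two_ne_zero)⟩

theorem ae_conj_eq_of_conj_fourierInv {g : ℝ → ℂ} (hg : Integrable g) (hg2 : MemLp g 2)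
    (h : ∀ ζ, conj (𝓕⁻ g ζ) = 𝓕⁻ g (-ζ)) : ∀ᵐ η, conj (g η) = g η := by
  refine ae_eq_of_fourierInv_eq (Complex.conjLIE.toContinuousLinearEquiv.integrable_comp_iff.2 hg)
    hg2.star hg hg2 (funext fun ζ => ?_)
  rw [← neg_neg ζ, ← h, fourierInv_eq_integral_wave, fourierInv_eq_integral_wave, ← integral_conj]
  congr with η
  rw [map_mul, conj_wave, wave_neg_left]

theorem exists_real_fourierInv_eq (hs : 1 < s) {n : ℤ} {f : ℝ → ℂ} (hf : Continuous f)
    (hconj : ∀ ζ, conj (f ζ) = f (-ζ)) (hfin : modeEnergy s (2 * n + 1) f < ⊤) :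
    ∃ d : ℝ → ℝ, Measurable d ∧ (f = 𝓕⁻ fun η => (d η : ℂ)) ∧
      ∫⁻ η : ℝ, eweight s (n, η) * ‖d η‖ₑ ^ 2 = modeEnergy s (2 * n + 1) f := by
  have hmem := memLp_of_modeEnergy_lt_top hfin
  set g : Lp ℂ 2 (volume : Measure ℝ) := 𝓕 (hmem.toLp f) with hg
  have henergy : ∫⁻ η : ℝ, eweight s (n, η) * ‖g η‖ₑ ^ 2 = modeEnergy s (2 * n + 1) f := by
    rw [modeEnergy, dif_pos hmem]
    simp only [eweight, weight, freqSymbol, Int.cast_add, Int.cast_mul, Int.cast_ofNat,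
      Int.cast_one, hg]
  have hint : Integrable g := integrable_of_lintegral_eweight_lt_top hs
    (Lp.aestronglyMeasurable g) (henergy.trans_lt hfin)
  have hfg : f = 𝓕⁻ (g : ℝ → ℂ) := eq_fourierInv_of_integrable hf hmem hint
  have hreal : ∀ᵐ η, ((g η).re : ℂ) = g η := by
    filter_upwards [ae_conj_eq_of_conj_fourierInv hint (Lp.memLp g) (hfg ▸ hconj)] with η hη
    exact Complex.conj_eq_iff_re.1 hη
  refine ⟨fun η => (g η).re, Complex.measurable_re.comp (Lp.stronglyMeasurable g).measurable,
    hfg.trans (funext (Real.fourierInv_congr_ae (EventuallyEq.symm hreal))), ?_⟩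
  rw [← henergy]
  refine lintegral_congr_ae ?_
  filter_upwards [hreal] with η hη
  rw [← hη, ← ofReal_norm, ← ofReal_norm, Complex.norm_real, Complex.ofReal_re]

theorem exists_evenL2_of_modeEnergy (hs : 1 < s) {f : ℤ → ℝ → ℂ} (hcont : ∀ n, Continuous (f n))
    (hreal : ∀ n ζ, conj (f n ζ) = f n ζ) (heven : ∀ n ζ, f n (-ζ) = f n ζ)
    (hrefl : ∀ n, f (-1 - n) = f n)
    (hfin : ∑' n : ℤ, modeEnergy s (2 * n + 1) (f n) < ⊤) :
    ∃ u, EvenL2 s u ∧ ∀ n, f n = envelope u n := by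
  choose d hmeas hinv henergy using fun n => exists_real_fourierInv_eq hs (hcont n)
    (fun ζ => (hreal n ζ).trans (heven n ζ).symm) ((ENNReal.le_tsum n).trans_lt hfin)
  have henv (n : ℤ) : f n = envelope (fun x => d x.1 x.2) n := hinv n
  have hmeasd : Measurable fun x : ℤ × ℝ => d x.1 x.2 :=
    measurable_from_prod_countable_right hmeas
  have hwL2 : WL2 s (fun x => d x.1 x.2) := by
    refine ⟨hmeasd, ?_⟩
    rw [wsq_eq_tsum hmeasd]
    simpa only [henergy] using hfin
  refine ⟨_, hwL2.evenL2_of_envelope hs (fun n => ?_) (fun n ζ => ?_), henv⟩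
  · rw [← henv, ← henv, hrefl]
  · rw [← henv, heven]

end Field

/-! ### Modes determine a continuous periodic function -/

theorem fourier_neg_coe_two_pi (p : ℤ) (x : ℝ) :
    fourier (-p) (x : AddCircle (2 * Real.pi)) = Complex.exp (-(Complex.I * p * x)) := by
  have hpi : (Real.pi : ℂ) ≠ 0 := by exact_mod_cast Real.pi_ne_zero
  rw [fourier_coe_apply]
  congr 1
  push_cast
  field_simp

theorem eq_zero_of_integral_mul_exp_eq_zero {D : ℝ → ℂ} (hD : Continuous D)
    (hper : Function.Periodic D (2 * Real.pi))
    (h : ∀ p : ℤ, ∫ φ in (-Real.pi)..Real.pi, D φ * Complex.exp (-(Complex.I * p * φ)) = 0)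
    (φ : ℝ) : D φ = 0 := by
  have : Fact (0 < 2 * Real.pi) := ⟨Real.two_pi_pos⟩
  let F : C(AddCircle (2 * Real.pi), ℂ) := ⟨hper.lift, continuous_coinduced_dom.mpr hD⟩
  have hF (x : ℝ) : F (x : AddCircle (2 * Real.pi)) = D x := hper.lift_coe x
  have hcoeff : fourierCoeff F = 0 := by
    funext p
    have hend : -Real.pi + 2 * Real.pi = Real.pi := by ring
    rw [fourierCoeff_eq_intervalIntegral _ p (-Real.pi), hend]
    simp_rw [fourier_neg_coe_two_pi, hF, smul_eq_mul, mul_comm (Complex.exp _), h p, smul_zero]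
    rfl
  have hsum := has_pointwise_sum_fourier_series_of_summable (f := F)
    (hcoeff ▸ summable_zero) (φ : AddCircle (2 * Real.pi))
  simp only [hcoeff, Pi.zero_apply, zero_smul] at hsum
  exact (hF φ).symm.trans (hsum.unique hasSum_zero)

theorem mode_sub {U V : ℝ → ℝ → ℝ} (hU : Continuous (Function.uncurry U))
    (hV : Continuous (Function.uncurry V)) (p : ℤ) (ζ : ℝ) :
    mode (U - V) p ζ = mode U p ζ - mode V p ζ := by
  have hUc : Continuous (U ζ) := hU.comp (Continuous.prodMk_right ζ)
  have hVc : Continuous (V ζ) := hV.comp (Continuous.prodMk_right ζ)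
  rw [mode, mode, mode, ← mul_sub, ← intervalIntegral.integral_sub
    (Continuous.intervalIntegrable (by fun_prop) _ _)
    (Continuous.intervalIntegrable (by fun_prop) _ _)]
  congr 1
  refine intervalIntegral.integral_congr fun φ _ => ?_
  simp only [Pi.sub_apply, Complex.ofReal_sub]
  ring

theorem eq_of_mode_eq {U V : ℝ → ℝ → ℝ} (hU : Continuous (Function.uncurry U))
    (hV : Continuous (Function.uncurry V)) (hUp : ∀ ζ, Function.Periodic (U ζ) (2 * Real.pi))
    (hVp : ∀ ζ, Function.Periodic (V ζ) (2 * Real.pi)) (h : ∀ p ζ, mode U p ζ = mode V p ζ) :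
    U = V := by
  funext ζ φ
  have hzero : ((U - V) ζ φ : ℂ) = 0 := by
    refine eq_zero_of_integral_mul_exp_eq_zero (D := fun φ => ((U - V) ζ φ : ℂ))
      (Complex.continuous_ofReal.comp ((hU.sub hV).comp (Continuous.prodMk_right ζ)))
      (fun φ => ?_) (fun p => ?_) φ
    · simp only [Pi.sub_apply, hUp ζ φ, hVp ζ φ]
    · have hmode := mode_sub hU hV p ζ
      rw [h, sub_self, mode] at hmode
      exact (mul_eq_zero.1 hmode).resolve_left (by simp)
  exact sub_eq_zero.1 (by exact_mod_cast hzero)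

/-! ### The differential equation on the Fourier side -/

section

variable {s : ℝ} {u v w g : ℤ × ℝ → ℝ}

theorem envelope_add (hs : 1 < s) (hu : WL2 s u) (hv : WL2 s v) (n : ℤ) (ζ : ℝ) :
    envelope (fun x => u x + v x) n ζ = envelope u n ζ + envelope v n ζ := by
  rw [envelope_eq, envelope_eq, envelope_eq, ← integral_add
    (integrable_wave_mul (hu.integrable_slice hs n) ζ)
    (integrable_wave_mul (hv.integrable_slice hs n) ζ)]
  congr with η
  push_cast
  ring

theorem envelope_const_mul (c : ℝ) (u : ℤ × ℝ → ℝ) (n : ℤ) (ζ : ℝ) :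
    envelope (fun x => c * u x) n ζ = c * envelope u n ζ := by
  rw [envelope_eq, envelope_eq, ← integral_const_mul]
  congr with η
  push_cast
  ring

theorem odd_cast_ne_zero (n : ℤ) : (2 * n + 1 : ℝ) ≠ 0 := by
  exact_mod_cast (by omega : 2 * n + 1 ≠ 0)

theorem envelope_resolventMul (g : ℤ × ℝ → ℝ) (n : ℤ) : envelope (resolventMul g) n =
    𝓕⁻ fun η : ℝ => (resolvent (2 * n + 1) η : ℂ) • (g (n, η) : ℂ) := by
  simp only [envelope, resolventMul, Complex.ofReal_mul, smul_eq_mul]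

theorem contDiff_envelope_resolventMul (hs : 1 < s) (hg : WL2 s g) (n : ℤ) :
    ContDiff ℝ 2 (envelope (resolventMul g) n) := by
  rw [envelope_resolventMul]
  exact contDiff_fourierInv_resolvent_smul _ (hg.integrable_slice hs n)

theorem exists_norm_deriv_envelope_resolventMul_le (hs : 1 < s) (hg : WL2 s g) (n : ℤ) :
    ∃ M, ∀ ζ, ‖deriv (envelope (resolventMul g) n) ζ‖ ≤ M := by
  rw [envelope_resolventMul]
  exact exists_norm_deriv_fourierInv_resolvent_smul_le _ (hg.integrable_slice hs n)

theorem deriv_deriv_envelope_resolventMul (hs : 1 < s) (hg : WL2 s g) (n : ℤ) (ζ : ℝ) :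
    deriv (deriv (envelope (resolventMul g) n)) ζ =
      (2 * n + 1 : ℝ) ^ 2 • (envelope (resolventMul g) n ζ - envelope g n ζ) := by
  rw [envelope_resolventMul, Complex.real_smul, Complex.ofReal_pow]
  exact deriv_deriv_fourierInv_resolvent_smul _ (hg.integrable_slice hs n) ζ

theorem ae_eq_resolventMul_of_deriv_deriv_eq (hs : 1 < s) (hu : WL2 s u) (hg : WL2 s g)
    (hc : ∀ n, ContDiff ℝ 2 (envelope u n))
    (hode : ∀ n ζ, deriv (deriv (envelope u n)) ζ =
      (2 * n + 1 : ℝ) ^ 2 • (envelope u n ζ - envelope g n ζ)) :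
    u =ᵐ[freqMeasure] resolventMul g := by
  obtain ⟨M, hM⟩ := hu.exists_norm_envelope_le hs
  obtain ⟨N, hN⟩ := hg.resolventMul.exists_norm_envelope_le hs
  exact ae_eq_of_envelope_eq hs hu hg.resolventMul fun n =>
    eq_of_bounded_of_deriv_deriv_eq (odd_cast_ne_zero n) (hc n)
      (contDiff_envelope_resolventMul hs hg n) (hode n)
      (deriv_deriv_envelope_resolventMul hs hg n) (hM n) (hN n)

/-! ### The masks of the system -/

/-- The mask of the self-interaction `U_p³ = U_p U_p U_{-p}`. -/
def selfMask (n q r : ℤ) : ℝ := if q = n ∧ r = n then 1 else 0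

/-- The mask of `U_p ∑ |U_q|²`, with `|U_q|² = U_q U_{-q}`. -/
def pairMask (n q r : ℤ) : ℝ := if q = n ∧ |2 * r + 1| ≠ |2 * n + 1| then 1 else 0

/-- The mask of `∑ U_q U_r U_{p-q-r}` without self-interaction. -/
def mixMask (n q r : ℤ) : ℝ :=
  if |2 * q + 1| = |2 * n + 1| ∧ |2 * r + 1| = |2 * n + 1| ∧
    |2 * (n - q - r - 1) + 1| = |2 * n + 1| then 0 else 1

theorem abs_odd_reflect (n : ℤ) : |2 * (-1 - n) + 1| = |2 * n + 1| := by
  rw [← abs_neg]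
  congr 1
  ring

theorem isMask_selfMask : IsMask selfMask 1 where
  bound n q r := by unfold selfMask; split_ifs <;> simp
  symm n q r := by simp only [selfMask, sub_right_inj]

theorem isMask_pairMask : IsMask pairMask 1 where
  bound n q r := by unfold pairMask; split_ifs <;> simp
  symm n q r := by simp only [pairMask, sub_right_inj, abs_odd_reflect]

theorem isMask_mixMask : IsMask mixMask 1 where
  bound n q r := by unfold mixMask; split_ifs <;> simp
  symm n q r := by
    have hthird : -1 - n - (-1 - q) - (-1 - r) - 1 = -1 - (n - q - r - 1) := by ring
    simp only [mixMask, hthird, abs_odd_reflect]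

theorem envelope_triple_selfMask (hs : 1 < s) (hu : WL2 s u) (hv : WL2 s v) (hw : EvenL2 s w)
    (n : ℤ) (ζ : ℝ) : envelope (triple selfMask u v w) n ζ =
      envelope u n ζ * envelope v n ζ * envelope w n ζ := by
  rw [envelope_triple hs isMask_selfMask hu hv hw.toWL2 n ζ, tsum_eq_single (n, n)]
  · have : n - n - n - 1 = -1 - n := by ring
    simp only [selfMask, and_self, if_true, this, hw.envelope_reflect]
    simp
  · rintro ⟨q, r⟩ hqr
    have : ¬ (q = n ∧ r = n) := fun h => hqr (Prod.ext h.1 h.2)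
    simp only [selfMask, if_neg this]
    simp

theorem EvenL2.envelope_mul_reflect (hu : EvenL2 s u) (n : ℤ) (ζ : ℝ) :
    envelope u n ζ * envelope u (-1 - n) ζ = ((‖envelope u n ζ‖ ^ 2 : ℝ) : ℂ) := by
  rw [hu.envelope_reflect]
  nth_rw 2 [← hu.conj_envelope]
  rw [Complex.mul_conj, Complex.normSq_eq_norm_sq]

theorem injective_odd : Function.Injective fun n : ℤ => 2 * n + 1 := fun a b h => by
  simpa using h

theorem tsum_crossIndex {U : ℝ → ℝ → ℝ} (h : ∀ n, mode U (2 * n + 1) = envelope u n)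
    (n : ℤ) (ζ : ℝ) :
    ∑' q : crossIndex (2 * n + 1), ((‖mode U q ζ‖ ^ 2 : ℝ) : ℂ) =
      ∑' r : ℤ, if |2 * r + 1| ≠ |2 * n + 1| then ((‖envelope u r ζ‖ ^ 2 : ℝ) : ℂ) else 0 := by
  rw [tsum_subtype (crossIndex (2 * n + 1)) fun q => ((‖mode U q ζ‖ ^ 2 : ℝ) : ℂ),
    ← injective_odd.tsum_eq]
  · congr with r
    rw [← h]
    by_cases hr : |2 * r + 1| ≠ |2 * n + 1|
    · rw [if_pos hr, Set.indicator_of_mem]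
      exact ⟨⟨r, rfl⟩, hr⟩
    · rw [if_neg hr, Set.indicator_of_notMem]
      exact fun h => hr h.2
  · intro q hq
    obtain ⟨k, rfl⟩ : Odd q := (Set.mem_of_indicator_ne_zero hq).1
    exact ⟨k, rfl⟩

theorem envelope_triple_pairMask (hs : 1 < s) (hu : EvenL2 s u) {U : ℝ → ℝ → ℝ}
    (h : ∀ n, mode U (2 * n + 1) = envelope u n) (n : ℤ) (ζ : ℝ) :
    envelope (triple pairMask u u u) n ζ = envelope u n ζ *
      ∑' q : crossIndex (2 * n + 1), ((‖mode U q ζ‖ ^ 2 : ℝ) : ℂ) := by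
  have hinj : Function.Injective fun r : ℤ => (n, r) := fun a b h => (Prod.ext_iff.1 h).2
  rw [envelope_triple hs isMask_pairMask hu.toWL2 hu.toWL2 hu.toWL2 n ζ, tsum_crossIndex h,
    ← tsum_mul_left, ← hinj.tsum_eq]
  · congr with r
    have e : n - n - r - 1 = -1 - r := by ring
    simp only [pairMask, true_and, e, mul_assoc, hu.envelope_mul_reflect]
    split_ifs <;> simp
  · rintro ⟨q, r⟩ hqr
    have : q = n := by
      by_contra hq
      apply hqr
      have : ¬ (q = n ∧ |2 * r + 1| ≠ |2 * n + 1|) := fun h => hq h.1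
      simp only [pairMask, if_neg this, Complex.ofReal_zero, zero_mul]
    exact ⟨r, by rw [this]⟩

theorem envelope_triple_mixMask (hs : 1 < s) (hu : EvenL2 s u) {U : ℝ → ℝ → ℝ}
    (h : ∀ n, mode U (2 * n + 1) = envelope u n) (n : ℤ) (ζ : ℝ) :
    envelope (triple mixMask u u u) n ζ = ∑' m : mixIndex (2 * n + 1),
      mode U m.1.1 ζ * mode U m.1.2 ζ * mode U (2 * n + 1 - m.1.1 - m.1.2) ζ := by
  have hinj : Function.Injective fun k : ℤ × ℤ => (2 * k.1 + 1, 2 * k.2 + 1) := fun a b h => by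
    simpa [Prod.ext_iff] using h
  rw [envelope_triple hs isMask_mixMask hu.toWL2 hu.toWL2 hu.toWL2 n ζ,
    tsum_subtype (mixIndex (2 * n + 1)) fun m : ℤ × ℤ =>
      mode U m.1 ζ * mode U m.2 ζ * mode U (2 * n + 1 - m.1 - m.2) ζ,
    ← hinj.tsum_eq (f := (mixIndex (2 * n + 1)).indicator fun m : ℤ × ℤ =>
      mode U m.1 ζ * mode U m.2 ζ * mode U (2 * n + 1 - m.1 - m.2) ζ)]
  · congr with k
    have e : 2 * n + 1 - (2 * k.1 + 1) - (2 * k.2 + 1) = 2 * (n - k.1 - k.2 - 1) + 1 := by ring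
    by_cases hk : |2 * k.1 + 1| = |2 * n + 1| ∧ |2 * k.2 + 1| = |2 * n + 1| ∧
        |2 * (n - k.1 - k.2 - 1) + 1| = |2 * n + 1|
    · rw [Set.indicator_of_notMem]
      · simp only [mixMask, if_pos hk, Complex.ofReal_zero, zero_mul]
      · rintro ⟨-, -, hk'⟩
        simp only [e] at hk'
        exact hk' hk
    · rw [Set.indicator_of_mem]
      · simp only [mixMask, if_neg hk, e, h, Complex.ofReal_one, one_mul]
      · refine ⟨⟨_, rfl⟩, ⟨_, rfl⟩, ?_⟩
        simp only [e]
        exact hk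
  · rintro ⟨q, r⟩ hqr
    obtain ⟨⟨k, rfl⟩, ⟨l, rfl⟩, -⟩ := Set.mem_of_indicator_ne_zero hqr
    exact ⟨(k, l), rfl⟩

theorem summable_crossIndex (hs : 1 < s) (hu : WL2 s u) {U : ℝ → ℝ → ℝ}
    (h : ∀ n, mode U (2 * n + 1) = envelope u n) (p : ℤ) (ζ : ℝ) :
    Summable fun q : crossIndex p => ‖mode U q ζ‖ ^ 2 := by
  obtain ⟨M, hM⟩ := hu.exists_norm_envelope_le hs
  have hsum : Summable fun n : ℤ => ‖envelope u n ζ‖ ^ 2 := by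
    refine Summable.of_nonneg_of_le (fun n => by positivity) (fun n => ?_)
      ((hu.summable_envelope hs ζ).mul_left M)
    rw [pow_two]
    exact mul_le_mul_of_nonneg_right (hM n ζ) (norm_nonneg _)
  have hodd : ∀ q : crossIndex p, (q : ℤ) = 2 * ((q : ℤ) / 2) + 1 := fun q => by
    obtain ⟨k, hk⟩ := q.2.1
    omega
  have hinj : Function.Injective fun q : crossIndex p => (q : ℤ) / 2 := fun a b hab => by
    apply Subtype.ext
    rw [hodd a, hodd b]
    simp only at hab
    rw [hab]
  refine (hsum.comp_injective hinj).congr fun q => ?_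
  simp only [Function.comp_apply]
  rw [← h, ← hodd]

theorem summable_mixIndex (hs : 1 < s) (hu : EvenL2 s u) {U : ℝ → ℝ → ℝ}
    (h : ∀ n, mode U (2 * n + 1) = envelope u n) (n : ℤ) (ζ : ℝ) :
    Summable fun m : mixIndex (2 * n + 1) =>
      ‖mode U m.1.1 ζ * mode U m.1.2 ζ * mode U (2 * n + 1 - m.1.1 - m.1.2) ζ‖ := by
  have hsum := summable_envelope_triple hs isMask_mixMask hu.toWL2 hu.toWL2 hu.toWL2 n ζ
  have hodd : ∀ m : mixIndex (2 * n + 1), m.1.1 = 2 * (m.1.1 / 2) + 1 ∧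
      m.1.2 = 2 * (m.1.2 / 2) + 1 := fun m => by
    obtain ⟨k, hk⟩ := m.2.1
    obtain ⟨l, hl⟩ := m.2.2.1
    omega
  have hinj : Function.Injective fun m : mixIndex (2 * n + 1) => (m.1.1 / 2, m.1.2 / 2) := by
    intro a b hab
    simp only [Prod.mk.injEq] at hab
    apply Subtype.ext
    refine Prod.ext ?_ ?_
    · rw [(hodd a).1, (hodd b).1, hab.1]
    · rw [(hodd a).2, (hodd b).2, hab.2]
  refine (hsum.comp_injective hinj).congr fun m => ?_
  obtain ⟨⟨⟨k, hk⟩, ⟨l, hl⟩, hm⟩, hodd₁, hodd₂⟩ := And.intro m.2 (hodd m)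
  have hodd₃ : 2 * n + 1 - m.1.1 - m.1.2 = 2 * (n - m.1.1 / 2 - m.1.2 / 2 - 1) + 1 := by omega
  simp only [Function.comp_apply]
  have hmask : mixMask n (m.1.1 / 2) (m.1.2 / 2) = 1 := by
    rw [mixMask, if_neg]
    rw [← hodd₁, ← hodd₂, ← hodd₃]
    exact hm
  rw [hmask, hodd₃, ← h, ← h, ← h, ← hodd₁, ← hodd₂]
  simp

/-- The nonlinearity of the system on the Fourier side. -/
def nonlinearity (Γ ε : ℝ) (u : ℤ × ℝ → ℝ) (x : ℤ × ℝ) : ℝ :=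
  6 * Γ * triple selfMask u u u x +
    2 / 3 * ε * Γ * (3 * triple pairMask u u u x + triple mixMask u u u x)

theorem WL2.nonlinearity (hs : 1 < s) (hu : WL2 s u) (Γ ε : ℝ) :
    WL2 s (nonlinearity Γ ε u) :=
  ((WL2.triple hs isMask_selfMask hu hu hu).const_mul (6 * Γ)).add
    ((((WL2.triple hs isMask_pairMask hu hu hu).const_mul 3).add
      (WL2.triple hs isMask_mixMask hu hu hu)).const_mul (2 / 3 * ε * Γ))

theorem envelope_nonlinearity (hs : 1 < s) (hu : EvenL2 s u) {U : ℝ → ℝ → ℝ}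
    (h : ∀ n, mode U (2 * n + 1) = envelope u n) (Γ ε : ℝ) (n : ℤ) (ζ : ℝ) :
    envelope (nonlinearity Γ ε u) n ζ = 6 * Γ * mode U (2 * n + 1) ζ ^ 3 +
      2 / 3 * ε * Γ * coupling U (2 * n + 1) ζ := by
  have hself := WL2.triple hs isMask_selfMask hu.toWL2 hu.toWL2 hu.toWL2
  have hpair := WL2.triple hs isMask_pairMask hu.toWL2 hu.toWL2 hu.toWL2
  have hmix := WL2.triple hs isMask_mixMask hu.toWL2 hu.toWL2 hu.toWL2
  unfold nonlinearity
  rw [envelope_add hs (hself.const_mul (6 * Γ)) (((hpair.const_mul 3).add hmix).const_mul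
    (2 / 3 * ε * Γ)), envelope_const_mul, envelope_const_mul,
    envelope_add hs (hpair.const_mul 3) hmix, envelope_const_mul,
    envelope_triple_selfMask hs hu.toWL2 hu.toWL2 hu,
    envelope_triple_pairMask hs hu h, envelope_triple_mixMask hs hu h, coupling, h]
  push_cast
  ring

theorem solves_iff (hs : 1 < s) (hu : EvenL2 s u) {U : ℝ → ℝ → ℝ}
    (h : ∀ n, mode U (2 * n + 1) = envelope u n) (Γ ε : ℝ) :
    Solves Γ ε U ↔ u =ᵐ[freqMeasure] resolventMul (nonlinearity Γ ε u) := by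
  have hN := hu.toWL2.nonlinearity hs Γ ε
  constructor
  · intro hS
    refine ae_eq_resolventMul_of_deriv_deriv_eq hs hu.toWL2 hN (fun n => ?_) fun n ζ => ?_
    · rw [← h]
      exact hS.contDiff _ ⟨n, rfl⟩
    · have heq := hS.equation (2 * n + 1) ⟨n, rfl⟩ ζ
      rw [envelope_nonlinearity hs hu h, ← h, Complex.real_smul]
      push_cast at heq ⊢
      linear_combination heq
  · intro hfix
    have henv (n : ℤ) : mode U (2 * n + 1) = envelope (resolventMul (nonlinearity Γ ε u)) n :=
      (h n).trans (envelope_congr hfix n)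
    refine ⟨?_, fun p _ ζ => summable_crossIndex hs hu.toWL2 h p ζ, ?_, ?_⟩
    · rintro _ ⟨n, rfl⟩
      rw [henv]
      exact contDiff_envelope_resolventMul hs hN n
    · rintro _ ⟨n, rfl⟩ ζ
      exact summable_mixIndex hs hu h n ζ
    · rintro _ ⟨n, rfl⟩ ζ
      have hode := deriv_deriv_envelope_resolventMul hs hN n ζ
      rw [← henv, envelope_nonlinearity hs hu h, Complex.real_smul] at hode
      push_cast at hode ⊢
      linear_combination hode

end

/-! ### The soliton -/

theorem hasDerivAt_sech (ζ : ℝ) :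
    HasDerivAt (fun x => 1 / Real.cosh x) (-(Real.tanh ζ * (1 / Real.cosh ζ))) ζ := by
  have hc := (Real.cosh_pos ζ).ne'
  simp only [one_div]
  refine ((Real.hasDerivAt_cosh ζ).inv hc).congr_deriv ?_
  rw [Real.tanh_eq_sinh_div_cosh]
  field_simp

theorem hasDerivAt_tanh (ζ : ℝ) : HasDerivAt Real.tanh (1 - Real.tanh ζ ^ 2) ζ := by
  have hc := (Real.cosh_pos ζ).ne'
  rw [Real.tanh_eq_sinh_div_cosh, funext Real.tanh_eq_sinh_div_cosh]
  refine ((Real.hasDerivAt_sinh ζ).div (Real.hasDerivAt_cosh ζ) hc).congr_deriv ?_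
  field_simp

theorem hasDerivAt_tanh_mul_sech (ζ : ℝ) :
    HasDerivAt (fun x => Real.tanh x * (1 / Real.cosh x))
      (2 / Real.cosh ζ ^ 3 - 1 / Real.cosh ζ) ζ := by
  have hc := (Real.cosh_pos ζ).ne'
  refine ((hasDerivAt_tanh ζ).mul (hasDerivAt_sech ζ)).congr_deriv ?_
  rw [Real.tanh_eq_sinh_div_cosh]
  field_simp
  linear_combination 2 * Real.cosh_sq_sub_sinh_sq ζ

theorem exists_iteratedDeriv_sech_eq (c : ℝ) (n : ℕ) : ∃ P : Polynomial ℝ,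
    iteratedDeriv n (fun ζ : ℝ => ((c * (1 / Real.cosh ζ) : ℝ) : ℂ)) =
      fun ζ => ((P.eval (Real.tanh ζ) * (1 / Real.cosh ζ) : ℝ) : ℂ) := by
  induction n with
  | zero => exact ⟨Polynomial.C c, by simp⟩
  | succ n ih =>
    obtain ⟨P, hP⟩ := ih
    refine ⟨P.derivative * (1 - Polynomial.X ^ 2) - P * Polynomial.X, ?_⟩
    rw [iteratedDeriv_succ, hP]
    funext ζ
    have hderiv := ((P.hasDerivAt (Real.tanh ζ)).comp ζ (hasDerivAt_tanh ζ)).mul (hasDerivAt_sech ζ)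
    refine HasDerivAt.deriv (hderiv.ofReal_comp.congr_deriv ?_)
    congr 1
    simp only [Polynomial.eval_sub, Polynomial.eval_mul, Polynomial.eval_one,
      Polynomial.eval_pow, Polynomial.eval_X, Function.comp_apply]
    ring

theorem contDiff_sech (c : ℝ) {n : WithTop ℕ∞} :
    ContDiff ℝ n (fun ζ : ℝ => ((c * (1 / Real.cosh ζ) : ℝ) : ℂ)) :=
  Complex.ofRealCLM.contDiff.comp
    (contDiff_const.mul (contDiff_const.div Real.contDiff_cosh fun ζ => (Real.cosh_pos ζ).ne'))

theorem sech_pos (ζ : ℝ) : 0 < 1 / Real.cosh ζ := one_div_pos.2 (Real.cosh_pos ζ)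

theorem abs_pow_mul_sech_le (k : ℕ) (ζ : ℝ) :
    |ζ| ^ k * (1 / Real.cosh ζ) ≤ 2 * k.factorial := by
  have hexp := Real.pow_div_factorial_le_exp |ζ| (abs_nonneg ζ) k
  have hcosh : Real.exp |ζ| ≤ 2 * Real.cosh ζ := by
    rw [← Real.cosh_abs, Real.cosh_eq]
    linarith [Real.exp_pos (-|ζ|)]
  have hk : (0 : ℝ) < k.factorial := by exact_mod_cast k.factorial_pos
  rw [mul_one_div, div_le_iff₀ (Real.cosh_pos ζ), mul_right_comm, ← div_le_iff₀ hk]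
  exact hexp.trans hcosh

theorem exists_pow_mul_norm_iteratedDeriv_sech_le (c : ℝ) (k n : ℕ) : ∃ C, ∀ ζ : ℝ,
    |ζ| ^ k * ‖iteratedDeriv n (fun ζ : ℝ => ((c * (1 / Real.cosh ζ) : ℝ) : ℂ)) ζ‖ ≤ C := by
  obtain ⟨P, hP⟩ := exists_iteratedDeriv_sech_eq c n
  obtain ⟨M, hM⟩ := isCompact_Icc.exists_bound_of_continuousOn
    (s := Set.Icc (-1 : ℝ) 1) P.continuous.continuousOn
  refine ⟨M * (2 * k.factorial), fun ζ => ?_⟩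
  have hPM := hM _ (abs_le.1 (Real.abs_tanh_lt_one ζ).le)
  rw [hP, Complex.norm_real, norm_mul, Real.norm_of_nonneg (sech_pos ζ).le, mul_left_comm]
  exact mul_le_mul hPM (abs_pow_mul_sech_le k ζ)
    (mul_nonneg (pow_nonneg (abs_nonneg ζ) k) (sech_pos ζ).le) ((norm_nonneg _).trans hPM)

/-- The NLS soliton as a Schwartz function, which makes its Fourier transform rapidly decaying. -/
def solitonSchwartz (Γ : ℝ) : SchwartzMap ℝ ℂ where
  toFun ζ := soliton Γ ζ
  smooth' := contDiff_sech _
  decay' k n := by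
    simp only [norm_iteratedFDeriv_eq_norm_iteratedDeriv]
    exact exists_pow_mul_norm_iteratedDeriv_sech_le (1 / √(3 * Γ)) k n

theorem solitonSchwartz_apply (Γ ζ : ℝ) : solitonSchwartz Γ ζ = soliton Γ ζ := rfl

theorem coe_solitonSchwartz (Γ : ℝ) :
    (solitonSchwartz Γ : ℝ → ℂ) = fun ζ => (soliton Γ ζ : ℂ) := rfl

theorem soliton_neg (Γ ζ : ℝ) : soliton Γ (-ζ) = soliton Γ ζ := by
  simp [soliton]

theorem hasDerivAt_soliton (Γ ζ : ℝ) :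
    HasDerivAt (soliton Γ) (-(1 / √(3 * Γ)) * (Real.tanh ζ * (1 / Real.cosh ζ))) ζ :=
  ((hasDerivAt_sech ζ).const_mul (1 / √(3 * Γ))).congr_deriv (by ring)

theorem six_mul_soliton_sq {Γ : ℝ} (hΓ : 0 < Γ) (ζ : ℝ) :
    6 * Γ * soliton Γ ζ ^ 2 = 2 / Real.cosh ζ ^ 2 := by
  have hc := (Real.cosh_pos ζ).ne'
  have hsqrt : √(3 * Γ) ^ 2 = 3 * Γ := Real.sq_sqrt (by positivity)
  rw [soliton, mul_pow, div_pow, div_pow, hsqrt]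
  field_simp
  norm_num

theorem deriv_deriv_soliton {Γ : ℝ} (hΓ : 0 < Γ) (ζ : ℝ) :
    deriv (deriv fun x => (soliton Γ x : ℂ)) ζ =
      (soliton Γ ζ : ℂ) - 6 * Γ * (soliton Γ ζ : ℂ) ^ 3 := by
  have hderiv : (deriv fun x => (soliton Γ x : ℂ)) =
      fun x => ((-(1 / √(3 * Γ)) * (Real.tanh x * (1 / Real.cosh x)) : ℝ) : ℂ) :=
    funext fun x => (hasDerivAt_soliton Γ x).ofReal_comp.deriv
  have heq : -(1 / √(3 * Γ)) * (2 / Real.cosh ζ ^ 3 - 1 / Real.cosh ζ) =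
      soliton Γ ζ - 6 * Γ * soliton Γ ζ ^ 2 * soliton Γ ζ := by
    rw [six_mul_soliton_sq hΓ, soliton]
    field_simp
    ring
  rw [hderiv, ((hasDerivAt_tanh_mul_sech ζ).const_mul (-(1 / √(3 * Γ)))).ofReal_comp.deriv, heq]
  push_cast
  ring

/-! ### Functions that are carried by the first harmonics -/

/-- The function that is `f` on the harmonics `p = 2 n + 1 = ±1`, that is `n ∈ {0, -1}`, and zero on
the others. -/
def firstHarmonic (f : ℝ → ℝ) (x : ℤ × ℝ) : ℝ := if x.1 = 0 ∨ x.1 = -1 then f x.2 else 0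

theorem weight_fundamental_le {s : ℝ} (hs : 0 ≤ s) {n : ℤ} (hn : n = 0 ∨ n = -1) (η : ℝ) :
    weight s (n, η) ≤ (2 * Real.pi) ^ (2 * s) * (1 + |η|) ^ ⌈2 * s⌉₊ := by
  have hpi := Real.one_le_pi_div_two
  have hη := abs_nonneg η
  have hodd : ((2 * n + 1 : ℤ) : ℝ) ^ 2 = 1 := by rcases hn with rfl | rfl <;> norm_num
  have hsymbol : freqSymbol (n, η) ≤ (2 * Real.pi * (1 + |η|)) ^ (2 : ℝ) := by
    rw [freqSymbol, hodd, Real.rpow_two, mul_pow, mul_pow _ (1 + |η|), ← sq_abs η]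
    nlinarith [mul_nonneg (sq_nonneg Real.pi) hη]
  calc weight s (n, η) ≤ ((2 * Real.pi * (1 + |η|)) ^ (2 : ℝ)) ^ s :=
        Real.rpow_le_rpow (zero_le_one.trans (one_le_freqSymbol _)) hsymbol hs
    _ = (2 * Real.pi) ^ (2 * s) * (1 + |η|) ^ (2 * s) := by
        rw [← Real.rpow_mul (by positivity), Real.mul_rpow (by positivity) (by positivity)]
    _ ≤ (2 * Real.pi) ^ (2 * s) * (1 + |η|) ^ ⌈2 * s⌉₊ := by
        rw [← Real.rpow_natCast (1 + |η|)]
        gcongr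
        · linarith
        · exact Nat.le_ceil _

theorem lintegral_firstHarmonic_lt_top {F : ℤ × ℝ → ℝ≥0∞} (hF : Measurable F) {C : ℝ}
    (h0 : ∀ n η, ¬ (n = 0 ∨ n = -1) → F (n, η) = 0)
    (h1 : ∀ n η, (n = 0 ∨ n = -1) → F (n, η) ≤ ENNReal.ofReal (C * (1 + η ^ 2)⁻¹)) :
    ∫⁻ x, F x ∂freqMeasure < ⊤ := by
  rw [lintegral_freqMeasure hF, tsum_eq_sum (s := {0, -1})]
  · refine ENNReal.sum_lt_top.2 fun n hn => ?_
    have hn' : n = 0 ∨ n = -1 := by simpa using hn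
    refine (lintegral_mono fun η => h1 n η hn').trans_lt ?_
    exact (integrable_inv_one_add_sq.const_mul C).lintegral_lt_top
  · intro n hn
    have hn' : ¬ (n = 0 ∨ n = -1) := by simpa using hn
    simp [h0 n _ hn']

theorem measurable_firstHarmonic {f : ℝ → ℝ} (hf : Measurable f) :
    Measurable (firstHarmonic f) :=
  Measurable.ite (measurable_fst (Set.to_countable {n : ℤ | n = 0 ∨ n = -1}).measurableSet)
    (hf.comp measurable_snd) measurable_const

/-- Functions decaying faster than any power, such as Schwartz functions. -/
def RapidDecay (f : ℝ → ℝ) : Prop := ∀ k : ℕ, ∃ C, ∀ η, (1 + |η|) ^ k * |f η| ≤ C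

theorem RapidDecay.weight_mul_le {f : ℝ → ℝ} (hf : RapidDecay f) {s : ℝ} (hs : 0 ≤ s) :
    ∃ C, 0 ≤ C ∧ ∀ n η, (n = 0 ∨ n = -1) → weight s (n, η) * |f η| ≤ C * (1 + η ^ 2)⁻¹ := by
  obtain ⟨C, hC⟩ := hf (⌈2 * s⌉₊ + 2)
  have hC0 : 0 ≤ C := le_trans (by positivity) (hC 0)
  refine ⟨(2 * Real.pi) ^ (2 * s) * C, by positivity, fun n η hn => ?_⟩
  have hsq : 1 + η ^ 2 ≤ (1 + |η|) ^ 2 := by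
    rw [← sq_abs η]
    nlinarith [abs_nonneg η]
  rw [← div_eq_mul_inv, le_div_iff₀ (by positivity)]
  calc weight s (n, η) * |f η| * (1 + η ^ 2)
      ≤ (2 * Real.pi) ^ (2 * s) * (1 + |η|) ^ ⌈2 * s⌉₊ * |f η| * (1 + |η|) ^ 2 := by
        gcongr
        exact weight_fundamental_le hs hn η
    _ = (2 * Real.pi) ^ (2 * s) * ((1 + |η|) ^ (⌈2 * s⌉₊ + 2) * |f η|) := by ring
    _ ≤ (2 * Real.pi) ^ (2 * s) * C := by
        gcongr
        exact hC η

theorem RapidDecay.lintegral_rpow_eweight_lt_top {f : ℝ → ℝ} (hf : RapidDecay f)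
    (hm : Measurable f) {s : ℝ} (hs : 0 ≤ s) :
    ∫⁻ x, eweight s x ^ (1 / 2 : ℝ) * ‖firstHarmonic f x‖ₑ ∂freqMeasure < ⊤ := by
  obtain ⟨C, -, hC⟩ := hf.weight_mul_le hs
  refine lintegral_firstHarmonic_lt_top (C := C) (((measurable_eweight s).pow_const _).mul
    (measurable_firstHarmonic hm).enorm) (fun n η hn => by simp [firstHarmonic, hn])
    fun n η hn => ?_
  have hle : eweight s (n, η) ^ (1 / 2 : ℝ) ≤ eweight s (n, η) := by
    conv_rhs => rw [← ENNReal.rpow_one (eweight s (n, η))]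
    exact ENNReal.rpow_le_rpow_of_exponent_le (one_le_eweight hs _) (by norm_num)
  refine (mul_le_mul_left hle _).trans ?_
  rw [firstHarmonic, if_pos hn, Real.enorm_eq_ofReal_abs, eweight,
    ← ENNReal.ofReal_mul (weight_pos _ _).le]
  exact ENNReal.ofReal_le_ofReal (hC n η hn)

theorem RapidDecay.evenL2 {f : ℝ → ℝ} (hf : RapidDecay f) (hm : Measurable f)
    (he : ∀ η, f (-η) = f η) {s : ℝ} (hs : 0 ≤ s) : EvenL2 s (firstHarmonic f) where
  measurable := measurable_firstHarmonic hm
  finite := by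
    obtain ⟨C, hC0, hC⟩ := hf.weight_mul_le hs
    refine lintegral_firstHarmonic_lt_top (C := C * C) ((measurable_eweight s).mul
      ((measurable_firstHarmonic hm).enorm.pow_const _)) (fun n η hn => by simp [firstHarmonic, hn])
      fun n η hn => ?_
    rw [firstHarmonic, if_pos hn, Real.enorm_eq_ofReal_abs, eweight,
      ← ENNReal.ofReal_pow (abs_nonneg _), ← ENNReal.ofReal_mul (weight_pos _ _).le]
    refine ENNReal.ofReal_le_ofReal ?_
    have hweight := hC n η hn
    have habs : |f η| ≤ C := by
      have := one_le_weight hs (n, η)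
      have hC_le : C * (1 + η ^ 2)⁻¹ ≤ C :=
        mul_le_of_le_one_right hC0 (inv_le_one_of_one_le₀ (by nlinarith [sq_nonneg η]))
      exact (le_mul_of_one_le_left (abs_nonneg _) this).trans (hweight.trans hC_le)
    calc weight s (n, η) * |f η| ^ 2 = (weight s (n, η) * |f η|) * |f η| := by ring
      _ ≤ (C * (1 + η ^ 2)⁻¹) * C := mul_le_mul hweight habs (abs_nonneg _) (by positivity)
      _ = _ := by ring
  harmonic := Eventually.of_forall fun x => by
    have : (-1 - x.1 = 0 ∨ -1 - x.1 = -1) ↔ (x.1 = 0 ∨ x.1 = -1) := by omega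
    simp only [Function.comp_apply, firstHarmonic, reflectHarmonic_apply, this]
  space := Eventually.of_forall fun x => by
    simp [firstHarmonic, he]

theorem envelope_firstHarmonic (f : ℝ → ℝ) {n : ℤ} (hn : n = 0 ∨ n = -1) :
    envelope (firstHarmonic f) n = 𝓕⁻ fun η => (f η : ℂ) := by
  simp only [envelope, firstHarmonic, if_pos hn]

theorem envelope_firstHarmonic_of_ne (f : ℝ → ℝ) {n : ℤ} (hn : ¬ (n = 0 ∨ n = -1)) (ζ : ℝ) :
    envelope (firstHarmonic f) n ζ = 0 := by
  simp [envelope_eq, firstHarmonic, if_neg hn]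

theorem rapidDecay_re (f : SchwartzMap ℝ ℂ) : RapidDecay fun η => (f η).re := fun k => by
  refine ⟨2 ^ k * (Finset.Iic (k, 0)).sup (fun m => SchwartzMap.seminorm ℝ m.1 m.2) f,
    fun η => ?_⟩
  have h := SchwartzMap.one_add_le_sup_seminorm_apply (𝕜 := ℝ) (m := (k, 0)) (k := k) (n := 0)
    le_rfl le_rfl f η
  rw [norm_iteratedFDeriv_zero] at h
  refine le_trans ?_ h
  exact mul_le_mul_of_nonneg_left (Complex.abs_re_le_norm _) (by positivity)

theorem measurable_re_schwartz (f : SchwartzMap ℝ ℂ) : Measurable fun η => (f η).re :=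
  (Complex.continuous_re.comp f.continuous).measurable

/-- The Fourier transform of the soliton. -/
def solitonHat (Γ : ℝ) (η : ℝ) : ℝ := ((𝓕⁻ (solitonSchwartz Γ)) η).re

theorem evenL2_solitonSpace (Γ : ℝ) {s : ℝ} (hs : 0 ≤ s) :
    EvenL2 s (firstHarmonic (soliton Γ)) := by
  have h := (rapidDecay_re (solitonSchwartz Γ)).evenL2 (measurable_re_schwartz _)
    (fun η => by simp only [solitonSchwartz_apply, soliton_neg]) hs
  simpa only [solitonSchwartz_apply, Complex.ofReal_re] using h

theorem fourierInv_solitonSchwartz (Γ : ℝ) :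
    (𝓕⁻ (solitonSchwartz Γ) : SchwartzMap ℝ ℂ) =
      (envelope (firstHarmonic (soliton Γ)) 0 : ℝ → ℂ) := by
  rw [envelope_firstHarmonic _ (Or.inl rfl), SchwartzMap.fourierInv_coe, coe_solitonSchwartz]

theorem ofReal_solitonHat (Γ η : ℝ) :
    (solitonHat Γ η : ℂ) = (𝓕⁻ (solitonSchwartz Γ) : SchwartzMap ℝ ℂ) η := by
  refine Complex.conj_eq_iff_re.1 ?_
  rw [fourierInv_solitonSchwartz]
  exact (evenL2_solitonSpace Γ zero_le_one).conj_envelope 0 η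

theorem solitonHat_neg (Γ η : ℝ) : solitonHat Γ (-η) = solitonHat Γ η := by
  rw [solitonHat, solitonHat, fourierInv_solitonSchwartz,
    (evenL2_solitonSpace Γ zero_le_one).envelope_neg]

theorem evenL2_soliton (Γ : ℝ) {s : ℝ} (hs : 0 ≤ s) :
    EvenL2 s (firstHarmonic (solitonHat Γ)) :=
  (rapidDecay_re _).evenL2 (measurable_re_schwartz _) (solitonHat_neg Γ) hs

theorem lintegral_rpow_eweight_soliton_lt_top (Γ : ℝ) {s : ℝ} (hs : 0 ≤ s) :
    ∫⁻ x, eweight s x ^ (1 / 2 : ℝ) * ‖firstHarmonic (solitonHat Γ) x‖ₑ ∂freqMeasure < ⊤ :=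
  (rapidDecay_re _).lintegral_rpow_eweight_lt_top (measurable_re_schwartz _) hs

theorem envelope_soliton (Γ : ℝ) {n : ℤ} (hn : n = 0 ∨ n = -1) (ζ : ℝ) :
    envelope (firstHarmonic (solitonHat Γ)) n ζ = soliton Γ ζ := by
  rw [← (evenL2_soliton Γ zero_le_one).envelope_neg, envelope_firstHarmonic _ hn,
    funext (ofReal_solitonHat Γ), Real.fourierInv_eq_fourier_neg, neg_neg,
    ← SchwartzMap.fourier_coe, FourierTransform.fourier_fourierInv_eq, solitonSchwartz_apply]

theorem field_soliton (Γ : ℝ) : field (firstHarmonic (solitonHat Γ)) = monoSoliton Γ := by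
  funext ζ φ
  have h : cfield (firstHarmonic (solitonHat Γ)) ζ φ = (monoSoliton Γ ζ φ : ℂ) := by
    rw [cfield, tsum_eq_sum (s := {0, -1})]
    · rw [Finset.sum_pair (by norm_num), envelope_soliton Γ (Or.inl rfl),
        envelope_soliton Γ (Or.inr rfl), carrier, carrier, monoSoliton]
      push_cast
      rw [Complex.cos]
      ring_nf
    · intro n hn
      rw [envelope_firstHarmonic_of_ne _ (by simpa using hn), zero_mul]
  rw [field, h, Complex.ofReal_re]

theorem soliton_ae_eq_resolventMul {Γ : ℝ} (hΓ : 0 < Γ) {s : ℝ} (hs : 1 < s) :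
    firstHarmonic (solitonHat Γ) =ᵐ[freqMeasure]
      resolventMul (nonlinearity Γ 0 (firstHarmonic (solitonHat Γ))) := by
  have hu := evenL2_soliton Γ (zero_le_one.trans hs.le)
  refine ae_eq_resolventMul_of_deriv_deriv_eq hs hu.toWL2 (hu.toWL2.nonlinearity hs Γ 0)
    (fun n => ?_) fun n ζ => ?_
  · by_cases hn : n = 0 ∨ n = -1
    · rw [funext (envelope_soliton Γ hn)]
      exact contDiff_sech _
    · rw [funext (envelope_firstHarmonic_of_ne (solitonHat Γ) hn)]
      exact contDiff_const
  · rw [envelope_nonlinearity hs hu (hu.mode_field_odd hs), hu.mode_field_odd hs]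
    by_cases hn : n = 0 ∨ n = -1
    · rw [funext (envelope_soliton Γ hn), deriv_deriv_soliton hΓ, Complex.real_smul]
      rcases hn with rfl | rfl <;> push_cast <;> ring
    · rw [funext (envelope_firstHarmonic_of_ne (solitonHat Γ) hn)]
      simp

/-! ### Hilbert-Schmidt operators -/

section

variable {H F : Type*} [NormedAddCommGroup H] [InnerProductSpace ℝ H] [NormedAddCommGroup F]
  [NormedSpace ℝ F] {ι : Type*}

/- Test the hypothesis with `v = ∑ i ∈ t, L (b i) • b i`, for which `L v = ‖v‖ ^ 2`. -/
theorem mul_sum_enorm_sq_le_of_orthonormal {b : ι → H} (hb : Orthonormal ℝ b) (t : Finset ι)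
    (L : H →ₗ[ℝ] ℝ) {a k : ℝ≥0∞} (h : ∀ v, a * ‖L v‖ₑ ^ 2 ≤ k * ‖v‖ₑ ^ 2) :
    a * ∑ i ∈ t, ‖L (b i)‖ₑ ^ 2 ≤ k := by
  set S : ℝ := ∑ i ∈ t, L (b i) ^ 2 with hS
  have hS_nonneg : 0 ≤ S := Finset.sum_nonneg fun i _ => sq_nonneg _
  have hsum : ∑ i ∈ t, ‖L (b i)‖ₑ ^ 2 = ENNReal.ofReal S := by
    rw [hS, ENNReal.ofReal_sum_of_nonneg fun i _ => sq_nonneg _]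
    refine Finset.sum_congr rfl fun i _ => ?_
    rw [Real.enorm_eq_ofReal_abs, ← ENNReal.ofReal_pow (abs_nonneg _), sq_abs]
  have hL : L (∑ i ∈ t, L (b i) • b i) = S := by
    simp only [map_sum, map_smul, smul_eq_mul, ← pow_two, hS]
  have hnorm : ‖∑ i ∈ t, L (b i) • b i‖ₑ ^ 2 = ENNReal.ofReal S := by
    rw [← ofReal_norm, ← ENNReal.ofReal_pow (norm_nonneg _), ← real_inner_self_eq_norm_sq,
      hb.inner_sum]
    simp only [conj_trivial, ← pow_two, hS]
  have htest := h (∑ i ∈ t, L (b i) • b i)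
  rw [hL, hnorm, Real.enorm_of_nonneg hS_nonneg, pow_two, ← mul_assoc] at htest
  rw [hsum]
  rcases eq_or_ne (ENNReal.ofReal S) 0 with h0 | h0
  · rw [h0, mul_zero]
    exact zero_le
  · exact (ENNReal.mul_le_mul_iff_left h0 ENNReal.ofReal_ne_top).1 htest

theorem isCompactOperator_smulRight (ℓ : H →L[ℝ] ℝ) (y : F) :
    IsCompactOperator (ℓ.smulRight y) := by
  have hid : IsCompactOperator (ContinuousLinearMap.id ℝ ℝ) :=
    ⟨Metric.closedBall 0 1, isCompact_closedBall 0 1, Metric.closedBall_mem_nhds 0 one_pos⟩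
  exact (hid.comp_clm ℓ).clm_comp (ContinuousLinearMap.toSpanSingleton ℝ y)

theorem isCompactOperator_sum (t : Finset ι) {A : ι → H →L[ℝ] F}
    (hA : ∀ i, IsCompactOperator (A i)) : IsCompactOperator (∑ i ∈ t, A i : H →L[ℝ] F) := by
  classical
  induction t using Finset.induction with
  | empty => exact isCompactOperator_zero
  | insert i t hi ih =>
    rw [Finset.sum_insert hi]
    exact (hA i).add ih

theorem norm_sum_inner_smul_le {b : ι → H} (hb : Orthonormal ℝ b) (t : Finset ι) (y : ι → F)
    (v : H) : ‖∑ i ∈ t, inner ℝ (b i) v • y i‖ ≤ ‖v‖ * √(∑ i ∈ t, ‖y i‖ ^ 2) :=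
  calc ‖∑ i ∈ t, inner ℝ (b i) v • y i‖
      ≤ ∑ i ∈ t, ‖inner ℝ (b i) v‖ * ‖y i‖ :=
        (norm_sum_le _ _).trans (Finset.sum_le_sum fun i _ => norm_smul_le _ _)
    _ ≤ √(∑ i ∈ t, ‖inner ℝ (b i) v‖ ^ 2) * √(∑ i ∈ t, ‖y i‖ ^ 2) :=
        Real.sum_mul_le_sqrt_mul_sqrt _ _ _
    _ ≤ ‖v‖ * √(∑ i ∈ t, ‖y i‖ ^ 2) := by
        gcongr
        exact Real.sqrt_le_iff.2 ⟨norm_nonneg _, hb.sum_inner_products_le v⟩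

theorem tendsto_sum_inner_smulRight (b : HilbertBasis ι ℝ H) (A : H →L[ℝ] F)
    (hA : Summable fun i => ‖A (b i)‖ ^ 2) :
    Tendsto (fun t : Finset ι => ∑ i ∈ t, (innerSL ℝ (b i)).smulRight (A (b i))) atTop (𝓝 A) := by
  classical
  set P : Finset ι → H →L[ℝ] F := fun t => ∑ i ∈ t, (innerSL ℝ (b i)).smulRight (A (b i)) with hP
  have hP_apply : ∀ t v, P t v = ∑ i ∈ t, inner ℝ (b i) v • A (b i) := fun t v => by simp [hP]
  have hlim : ∀ v, Tendsto (fun t => P t v) atTop (𝓝 (A v)) := fun v => by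
    have hsum := (b.hasSum_repr v).mapL A
    simp only [map_smul, b.repr_apply_apply] at hsum
    exact hsum.congr fun t => (hP_apply t v).symm
  rw [tendsto_iff_norm_sub_tendsto_zero, Metric.tendsto_atTop]
  intro ε hε
  obtain ⟨t₀, ht₀⟩ := summable_iff_vanishing_norm.1 hA ((ε / 2) ^ 2) (by positivity)
  refine ⟨t₀, fun t ht => ?_⟩
  rw [Real.dist_eq, sub_zero, abs_norm]
  refine (ContinuousLinearMap.opNorm_le_bound _ (half_pos hε).le fun v => ?_).trans_lt
    (half_lt_self hε)
  have hlim_sub : Tendsto (fun t' => P t v - P t' v) atTop (𝓝 (P t v - A v)) :=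
    tendsto_const_nhds.sub (hlim v)
  refine le_of_tendsto hlim_sub.norm ?_
  filter_upwards [eventually_ge_atTop t] with t' ht'
  have hdiff : P t v - P t' v = -∑ i ∈ t' \ t, inner ℝ (b i) v • A (b i) := by
    rw [hP_apply, hP_apply, ← Finset.sum_sdiff ht']
    abel
  have htail : ∑ i ∈ t' \ t, ‖A (b i)‖ ^ 2 ≤ (ε / 2) ^ 2 :=
    (Real.le_norm_self _).trans
      (ht₀ _ (Finset.disjoint_of_subset_right ht Finset.sdiff_disjoint)).le
  rw [hdiff, norm_neg, mul_comm]
  refine (norm_sum_inner_smul_le b.orthonormal _ _ v).trans ?_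
  gcongr
  exact Real.sqrt_le_iff.2 ⟨(half_pos hε).le, htail⟩

variable [CompleteSpace F]

theorem isCompactOperator_of_summable (b : HilbertBasis ι ℝ H) (A : H →L[ℝ] F)
    (hA : Summable fun i => ‖A (b i)‖ ^ 2) : IsCompactOperator A :=
  isCompactOperator_of_tendsto (tendsto_sum_inner_smulRight b A hA)
    (Eventually.of_forall fun t => isCompactOperator_sum t fun _ => isCompactOperator_smulRight _ _)

theorem isCompactOperator_of_lintegral [CompleteSpace H] {X : Type*} [MeasurableSpace X]
    {μ : Measure X} (A : H →L[ℝ] F) (L : X → H →ₗ[ℝ] ℝ) {w k : X → ℝ≥0∞}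
    (hm : ∀ v, Measurable fun x => w x * ‖L x v‖ₑ ^ 2)
    (hA : ∀ v, ‖A v‖ₑ ^ 2 ≤ ∫⁻ x, w x * ‖L x v‖ₑ ^ 2 ∂μ)
    (hL : ∀ x v, w x * ‖L x v‖ₑ ^ 2 ≤ k x * ‖v‖ₑ ^ 2) (hk : ∫⁻ x, k x ∂μ < ⊤) :
    IsCompactOperator A := by
  obtain ⟨ι, b, -⟩ := exists_hilbertBasis ℝ H
  refine isCompactOperator_of_summable b A ?_
  refine summable_of_sum_le (c := (∫⁻ x, k x ∂μ).toReal) (fun i => by positivity) fun t => ?_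
  rw [← ENNReal.ofReal_le_iff_le_toReal hk.ne,
    ENNReal.ofReal_sum_of_nonneg fun i _ => by positivity]
  calc ∑ i ∈ t, ENNReal.ofReal (‖A (b i)‖ ^ 2) = ∑ i ∈ t, ‖A (b i)‖ₑ ^ 2 :=
        Finset.sum_congr rfl fun i _ => by rw [ENNReal.ofReal_pow (norm_nonneg _), ofReal_norm]
    _ ≤ ∑ i ∈ t, ∫⁻ x, w x * ‖L x (b i)‖ₑ ^ 2 ∂μ := Finset.sum_le_sum fun i _ => hA _
    _ = ∫⁻ x, w x * ∑ i ∈ t, ‖L x (b i)‖ₑ ^ 2 ∂μ := by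
        rw [← lintegral_finsetSum _ fun i _ => hm (b i)]
        simp only [Finset.mul_sum]
    _ ≤ ∫⁻ x, k x ∂μ := lintegral_mono fun x =>
        mul_sum_enorm_sq_le_of_orthonormal b.orthonormal t (L x) (hL x)

end

/-! ### The linearized equation -/

section

variable {E : Type*} [NormedAddCommGroup E] [NormedSpace ℝ E] {V : ℝ → E}

theorem hasDerivAt_deriv_of_contDiff_two (hV : ContDiff ℝ 2 V) (x : ℝ) :
    HasDerivAt (deriv V) (deriv (deriv V) x) x :=
  ((contDiff_succ_iff_deriv (n := 1)).1 hV).2.2.differentiable one_ne_zero x |>.hasDerivAt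

theorem wronskian_eq_wronskian_zero {q φ ψ : ℝ → ℝ} (hV : ContDiff ℝ 2 V)
    (hode : ∀ x, deriv (deriv V) x = q x • V x) (hφ : ∀ x, HasDerivAt φ (ψ x) x)
    (hψ : ∀ x, HasDerivAt ψ (q x * φ x) x) (x : ℝ) :
    φ x • deriv V x - ψ x • V x = φ 0 • deriv V 0 - ψ 0 • V 0 := by
  have hderiv : ∀ y, HasDerivAt (fun y => φ y • deriv V y - ψ y • V y) 0 y := fun y => by
    refine (((hφ y).smul (hasDerivAt_deriv_of_contDiff_two hV y)).sub
      ((hψ y).smul (hV.differentiable two_ne_zero y).hasDerivAt)).congr_deriv ?_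
    rw [hode]
    module
  exact is_const_of_deriv_eq_zero (fun y => (hderiv y).differentiableAt)
    (fun y => (hderiv y).deriv) x 0

theorem eq_zero_of_deriv_deriv_eq_smul {q : ℝ → ℝ} {K : ℝ} (hq : ∀ x, |q x| ≤ K)
    (hV : ContDiff ℝ 2 V) (hode : ∀ x, deriv (deriv V) x = q x • V x) (h0 : V 0 = 0)
    (h1 : deriv V 0 = 0) : V = 0 := by
  have hK : 0 ≤ K := (abs_nonneg _).trans (hq 0)
  have hlip : ∀ t, LipschitzWith (K.toNNReal + 1) fun y : E × E => (y.2, q t • y.1) := fun t => by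
    refine LipschitzWith.of_dist_le_mul fun y z => ?_
    rw [NNReal.coe_add, NNReal.coe_one, Real.coe_toNNReal _ hK, Prod.dist_eq, Prod.dist_eq,
      dist_smul₀]
    set d := max (dist y.1 z.1) (dist y.2 z.2)
    have hd : 0 ≤ d := dist_nonneg.trans (le_max_left _ _)
    refine max_le ?_ ?_
    · exact (le_max_right _ _).trans (le_mul_of_one_le_left hd (by linarith))
    · exact mul_le_mul ((hq t).trans (by linarith)) (le_max_left _ _) dist_nonneg (by linarith)
  have hunique := ODE_solution_unique_univ (s := fun _ => Set.univ)
    (f := fun t => (V t, deriv V t)) (g := fun _ => 0) (t₀ := 0)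
    (fun t => (hlip t).lipschitzOnWith)
    (fun t => ⟨(hV.differentiable two_ne_zero t).hasDerivAt.prodMk
      ((hasDerivAt_deriv_of_contDiff_two hV t).congr_deriv (hode t)), trivial⟩)
    (fun t => ⟨(hasDerivAt_const t (0 : E × E)).congr_deriv
      (Prod.ext rfl (smul_zero _).symm), trivial⟩)
    (Prod.ext h0 h1)
  exact funext fun t => congrArg Prod.fst (congrFun hunique t)

theorem nonpos_of_forall_le_mul_sech {r R : ℝ} (h : ∀ x, r ≤ R * (1 / Real.cosh x)) : r ≤ 0 := by
  have hcosh : Tendsto Real.cosh atTop atTop :=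
    tendsto_atTop_mono (fun x => by rw [Real.cosh_eq]; linarith [Real.exp_pos (-x)])
      (Real.tendsto_exp_atTop.atTop_div_const two_pos)
  have hlim : Tendsto (fun x => R * (1 / Real.cosh x)) atTop (𝓝 0) := by
    simpa only [one_div, mul_zero, Pi.inv_apply] using hcosh.inv_tendsto_atTop.const_mul R
  exact ge_of_tendsto' hlim h

theorem deriv_zero_eq_zero_of_even (heven : ∀ x, V (-x) = V x) : deriv V 0 = 0 := by
  have h := deriv_comp_neg V 0
  rw [funext heven, neg_zero] at h
  have := IsAddTorsionFree.of_isTorsionFree ℝ E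
  exact self_eq_neg.1 h

theorem one_div_cosh_sq_le_one (x : ℝ) : 1 / Real.cosh x ^ 2 ≤ 1 :=
  div_le_self zero_le_one (one_le_pow₀ (Real.one_le_cosh x))

/- The derivative of the soliton solves the linearized equation. Its Wronskian with `V` is constant,
and decays like the soliton. -/
theorem eq_zero_of_bounded_of_even_of_linearized (hV : ContDiff ℝ 2 V)
    (heven : ∀ x, V (-x) = V x) {M₀ M₁ : ℝ} (hM₀ : ∀ x, ‖V x‖ ≤ M₀) (hM₁ : ∀ x, ‖deriv V x‖ ≤ M₁)
    (hode : ∀ x, deriv (deriv V) x = (1 - 6 / Real.cosh x ^ 2) • V x) : V = 0 := by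
  set φ : ℝ → ℝ := fun x => Real.tanh x * (1 / Real.cosh x) with hφ
  set ψ : ℝ → ℝ := fun x => 2 / Real.cosh x ^ 3 - 1 / Real.cosh x with hψ
  have hψ_deriv : ∀ x, HasDerivAt ψ ((1 - 6 / Real.cosh x ^ 2) * φ x) x := fun x => by
    have hc := (Real.cosh_pos x).ne'
    refine (((hasDerivAt_const x (2 : ℝ)).div ((Real.hasDerivAt_cosh x).pow 3)
      (pow_ne_zero 3 hc)).sub (hasDerivAt_sech x)).congr_deriv ?_
    simp only [hφ, Pi.pow_apply, Real.tanh_eq_sinh_div_cosh]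
    field_simp
    ring
  have hφ_le : ∀ x, |φ x| ≤ 1 / Real.cosh x := fun x => by
    rw [hφ, abs_mul, abs_of_pos (sech_pos x)]
    exact mul_le_of_le_one_left (sech_pos x).le (Real.abs_tanh_lt_one x).le
  have hψ_le : ∀ x, |ψ x| ≤ 1 / Real.cosh x := fun x => by
    have hfactor : ψ x = (2 * (1 / Real.cosh x ^ 2) - 1) * (1 / Real.cosh x) := by
      simp only [hψ]
      field_simp
    rw [hfactor, abs_mul, abs_of_pos (sech_pos x)]
    refine mul_le_of_le_one_left (sech_pos x).le (abs_le.2 ⟨?_, ?_⟩)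
    · linarith [one_div_nonneg.2 (sq_nonneg (Real.cosh x))]
    · linarith [one_div_cosh_sq_le_one x]
  have hwronskian := wronskian_eq_wronskian_zero hV hode hasDerivAt_tanh_mul_sech hψ_deriv
  have hV_zero : V 0 = 0 := by
    refine norm_le_zero_iff.1 (nonpos_of_forall_le_mul_sech (R := M₁ + M₀) fun x => ?_)
    have hat_zero : V 0 = -(φ x • deriv V x - ψ x • V x) := by
      rw [hwronskian]
      norm_num [hψ]
    rw [hat_zero, norm_neg, add_mul, mul_comm M₁, mul_comm M₀]
    refine (norm_sub_le _ _).trans (add_le_add ?_ ?_) <;> rw [norm_smul, Real.norm_eq_abs]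
    · exact mul_le_mul (hφ_le x) (hM₁ x) (norm_nonneg _) (sech_pos x).le
    · exact mul_le_mul (hψ_le x) (hM₀ x) (norm_nonneg _) (sech_pos x).le
  refine eq_zero_of_deriv_deriv_eq_smul (K := 5) (fun x => abs_le.2 ⟨?_, ?_⟩) hV hode hV_zero
    (deriv_zero_eq_zero_of_even heven)
  · linarith [one_div_cosh_sq_le_one x, mul_one_div (6 : ℝ) (Real.cosh x ^ 2)]
  · linarith [div_nonneg (by norm_num : (0 : ℝ) ≤ 6) (sq_nonneg (Real.cosh x))]

end

/-! ### The linearization at the soliton -/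

section

variable {s : ℝ}

theorem eweight_mul_enorm_triple_sq_le (hs : 0 ≤ s) {m : ℤ → ℤ → ℤ → ℝ} {M : ℝ} (hm : IsMask m M)
    {u v w : ℤ × ℝ → ℝ} (hu : Measurable u) (hv : Measurable v) (hw : Measurable w) (x : ℤ × ℝ) :
    eweight s x * ‖triple m u v w x‖ₑ ^ 2 ≤ ENNReal.ofReal M ^ 2 * (ENNReal.ofReal (9 ^ s) * 3 *
      ((∫⁻ y, eweight s y ^ (1 / 2 : ℝ) * ‖u y‖ₑ ∂freqMeasure) ^ 2 * (wsq s v * wsq s w))) :=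
  calc eweight s x * ‖triple m u v w x‖ₑ ^ 2
      ≤ eweight s x * (ENNReal.ofReal M * tripleLConv freqMeasure (1, 0) (fun y => ‖u y‖ₑ)
          (fun y => ‖v y‖ₑ) (fun y => ‖w y‖ₑ) x) ^ 2 := by
        gcongr
        exact enorm_triple_le hm hu hv hw x
    _ = ENNReal.ofReal M ^ 2 * (eweight s x * tripleLConv freqMeasure (1, 0) (fun y => ‖u y‖ₑ)
          (fun y => ‖v y‖ₑ) (fun y => ‖w y‖ₑ) x ^ 2) := by ring
    _ ≤ _ := mul_le_mul_right (mul_tripleLConv_sq_le_of_one_le (μ := freqMeasure)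
        (measurable_eweight s) (one_le_eweight hs) (eweight_le hs) hu.enorm hv.enorm hw.enorm x) _

/-- The trilinear map `(f, g, h) ↦ (p² / (p² + ξ²)) (f g h)_p` of the self-interaction. -/
def selfCLM (hs : 1 < s) :
    EvenSpace s →L[ℝ] EvenSpace s →L[ℝ] EvenSpace s →L[ℝ] EvenSpace s :=
  interactionCLM hs isMask_selfMask

theorem selfCLM_ae (hs : 1 < s) (f g h : EvenSpace s) :
    (selfCLM hs f g h).fn =ᵐ[freqMeasure] resolventMul (triple selfMask f.fn g.fn h.fn) :=
  interactionCLM_ae hs isMask_selfMask f g h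

theorem wL2_triple_fn (hs : 1 < s) (f g h : EvenSpace s) :
    WL2 s (triple selfMask f.fn g.fn h.fn) :=
  WL2.triple hs isMask_selfMask f.evenL2_fn.toWL2 g.evenL2_fn.toWL2
    h.evenL2_fn.toWL2

theorem envelope_triple_selfMask_fn (hs : 1 < s) (f g h : EvenSpace s) (n : ℤ) (ζ : ℝ) :
    envelope (triple selfMask f.fn g.fn h.fn) n ζ =
      envelope f.fn n ζ * envelope g.fn n ζ * envelope h.fn n ζ :=
  envelope_triple_selfMask hs f.evenL2_fn.toWL2 g.evenL2_fn.toWL2 h.evenL2_fn n ζ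

theorem selfCLM_eq_of_envelope_mul_eq (hs : 1 < s) {f g h f' g' h' : EvenSpace s}
    (heq : ∀ n ζ, envelope f.fn n ζ * envelope g.fn n ζ * envelope h.fn n ζ =
      envelope f'.fn n ζ * envelope g'.fn n ζ * envelope h'.fn n ζ) :
    selfCLM hs f g h = selfCLM hs f' g' h' := by
  refine EvenSpace.ext ((selfCLM_ae hs f g h).trans (.trans ?_ (selfCLM_ae hs f' g' h').symm))
  refine resolventMul_congr (ae_eq_of_envelope_eq hs (wL2_triple_fn hs f g h)
    (wL2_triple_fn hs f' g' h') fun n => funext fun ζ => ?_)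
  rw [envelope_triple_selfMask_fn hs, envelope_triple_selfMask_fn hs, heq]

theorem selfCLM_swap_right (hs : 1 < s) (f g h : EvenSpace s) :
    selfCLM hs f g h = selfCLM hs f h g :=
  selfCLM_eq_of_envelope_mul_eq hs fun _ _ => mul_right_comm _ _ _

theorem selfCLM_swap_left (hs : 1 < s) (f g h : EvenSpace s) :
    selfCLM hs f g h = selfCLM hs g f h :=
  selfCLM_eq_of_envelope_mul_eq hs fun _ _ => by rw [mul_comm (envelope f.fn _ _)]

/-- The soliton as a point of the Hilbert space `EvenSpace s`. -/
def solitonPoint (Γ : ℝ) (hs : 1 < s) : EvenSpace s :=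
  (evenL2_soliton Γ (zero_le_one.trans hs.le)).toEvenSpace

theorem solitonPoint_ae (Γ : ℝ) (hs : 1 < s) :
    (solitonPoint Γ hs).fn =ᵐ[freqMeasure] firstHarmonic (solitonHat Γ) :=
  (evenL2_soliton Γ (zero_le_one.trans hs.le)).fn_toEvenSpace

theorem triple_selfMask_firstHarmonic (f : ℝ → ℝ) (v w : ℤ × ℝ → ℝ) {x : ℤ × ℝ}
    (hx : ¬ (x.1 = 0 ∨ x.1 = -1)) : triple selfMask (firstHarmonic f) v w x = 0 := by
  have hzero : ∀ z : (ℤ × ℝ) × (ℤ × ℝ), selfMask x.1 z.1.1 z.2.1 *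
      (firstHarmonic f z.1 * v z.2 * w (x - z.1 - z.2 - (1, 0))) = 0 := fun z => by
    by_cases hz : z.1.1 = x.1
    · rw [show firstHarmonic f z.1 = 0 from if_neg (by rwa [hz]), zero_mul, zero_mul, mul_zero]
    · rw [show selfMask x.1 z.1.1 z.2.1 = 0 from if_neg fun h => hz h.1, zero_mul]
  simp only [triple, hzero, integral_zero]

theorem interaction_selfMask_firstHarmonic (f : ℝ → ℝ) (v w : ℤ × ℝ → ℝ) (x : ℤ × ℝ) :
    interaction selfMask (firstHarmonic f) v w x =
      firstHarmonic (resolvent 1) x * triple selfMask (firstHarmonic f) v w x := by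
  rw [interaction, resolventMul]
  by_cases hx : x.1 = 0 ∨ x.1 = -1
  · congr 1
    rw [firstHarmonic, if_pos hx, ← resolvent_neg_left]
    rcases hx with h | h <;> norm_num [h, resolvent]
  · rw [triple_selfMask_firstHarmonic f v w hx, mul_zero, mul_zero]

theorem resolvent_one_sq_le (η : ℝ) : resolvent 1 η ^ 2 ≤ (1 + η ^ 2)⁻¹ := by
  refine (pow_le_of_le_one (resolvent_nonneg 1 η) (resolvent_le_one 1 η) two_ne_zero).trans ?_
  rw [resolvent, one_pow, one_div, mul_pow]
  refine inv_anti₀ (by positivity) ?_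
  have hpi : 1 ≤ (2 * Real.pi) ^ 2 := one_le_pow₀ (by linarith [Real.pi_gt_three])
  nlinarith [sq_nonneg η]

theorem lintegral_enorm_resolvent_one_sq_lt_top :
    ∫⁻ x, ‖firstHarmonic (resolvent 1) x‖ₑ ^ 2 ∂freqMeasure < ⊤ := by
  refine lintegral_firstHarmonic_lt_top (C := 1)
    ((measurable_firstHarmonic (measurable_resolvent 1)).enorm.pow_const _)
    (fun n η hn => by simp [firstHarmonic, hn]) fun n η hn => ?_
  rw [firstHarmonic, if_pos hn, Real.enorm_of_nonneg (resolvent_nonneg _ _),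
    ← ENNReal.ofReal_pow (resolvent_nonneg _ _), one_mul]
  exact ENNReal.ofReal_le_ofReal (resolvent_one_sq_le η)

/-- The value at the frequency `x` of the linearized self-interaction at the soliton, which is
defined pointwise although its argument is only a class of functions. -/
def linearizedFunctional (Γ : ℝ) (hs : 1 < s) (x : ℤ × ℝ) : EvenSpace s →ₗ[ℝ] ℝ where
  toFun v := interaction selfMask (firstHarmonic (solitonHat Γ))
    (firstHarmonic (solitonHat Γ)) v.fn x
  map_add' f g := by
    have hu := (evenL2_soliton Γ (zero_le_one.trans hs.le)).toWL2
    simp only [interaction, resolventMul]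
    rw [triple_congr (.refl _ _) (.refl _ _) (EvenSpace.fn_add f g),
      triple_add_right hs isMask_selfMask hu hu f.evenL2_fn.toWL2 g.evenL2_fn.toWL2,
      mul_add]
  map_smul' c f := by
    simp only [interaction, resolventMul, RingHom.id_apply, smul_eq_mul]
    rw [triple_congr (.refl _ _) (.refl _ _) (EvenSpace.fn_smul c f), triple_mul_right,
      mul_left_comm]

/-- The constant in the bound of the linearized self-interaction at the soliton. -/
def linearizedConst (Γ s : ℝ) : ℝ≥0∞ :=
  ENNReal.ofReal (9 ^ s) * 3 *
    ((∫⁻ y, eweight s y ^ (1 / 2 : ℝ) * ‖firstHarmonic (solitonHat Γ) y‖ₑ ∂freqMeasure) ^ 2 *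
      wsq s (firstHarmonic (solitonHat Γ)))

theorem linearizedConst_lt_top (Γ : ℝ) (hs : 0 ≤ s) : linearizedConst Γ s < ⊤ :=
  ENNReal.mul_lt_top (by finiteness) (ENNReal.mul_lt_top
    (ENNReal.pow_lt_top (lintegral_rpow_eweight_soliton_lt_top Γ hs)) (evenL2_soliton Γ hs).finite)

theorem eweight_mul_linearizedFunctional_sq_le (Γ : ℝ) (hs : 1 < s) (x : ℤ × ℝ)
    (v : EvenSpace s) : eweight s x * ‖linearizedFunctional Γ hs x v‖ₑ ^ 2 ≤
      ‖firstHarmonic (resolvent 1) x‖ₑ ^ 2 * linearizedConst Γ s * ‖v‖ₑ ^ 2 := by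
  have hs0 : 0 ≤ s := zero_le_one.trans hs.le
  set f := firstHarmonic (solitonHat Γ) with hf
  have hfm : Measurable f := (evenL2_soliton Γ hs0).measurable
  have hle := eweight_mul_enorm_triple_sq_le hs0 isMask_selfMask hfm hfm
    v.evenL2_fn.measurable x
  rw [ENNReal.ofReal_one, one_pow, one_mul] at hle
  calc eweight s x * ‖linearizedFunctional Γ hs x v‖ₑ ^ 2
      = ‖firstHarmonic (resolvent 1) x‖ₑ ^ 2 *
          (eweight s x * ‖triple selfMask f f v.fn x‖ₑ ^ 2) := by
        rw [show linearizedFunctional Γ hs x v = interaction selfMask f f v.fn x from rfl, hf,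
          interaction_selfMask_firstHarmonic, enorm_mul, mul_pow, mul_left_comm]
    _ ≤ _ := mul_le_mul_right hle _
    _ = _ := by
        rw [EvenSpace.enorm_sq, linearizedConst]
        ring

theorem isCompactOperator_selfCLM (Γ : ℝ) (hs : 1 < s) :
    IsCompactOperator (selfCLM hs (solitonPoint Γ hs) (solitonPoint Γ hs)) := by
  have hu := evenL2_soliton Γ (zero_le_one.trans hs.le)
  have hC := linearizedConst_lt_top Γ (zero_le_one.trans hs.le)
  refine isCompactOperator_of_lintegral (μ := freqMeasure) _ (linearizedFunctional Γ hs)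
    (w := eweight s) (fun v => ?_) (fun v => ?_) (eweight_mul_linearizedFunctional_sq_le Γ hs) ?_
  · exact (measurable_eweight s).mul ((EvenL2.interaction hs isMask_selfMask hu hu
      v.evenL2_fn).measurable.enorm.pow_const _)
  · rw [EvenSpace.enorm_sq, wsq_congr (selfCLM_ae hs _ _ _)]
    refine le_of_eq (lintegral_congr fun x => ?_)
    rw [resolventMul,
      triple_congr (solitonPoint_ae Γ hs) (solitonPoint_ae Γ hs) (.refl _ _)]
    rfl
  · rw [lintegral_mul_const' _ _ hC.ne]
    exact ENNReal.mul_lt_top lintegral_enorm_resolvent_one_sq_lt_top hC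

theorem ae_eq_resolventMul_of_linearized_fixed {Γ : ℝ} (hs : 1 < s) {v : EvenSpace s}
    (h : (18 * Γ) • selfCLM hs (solitonPoint Γ hs) (solitonPoint Γ hs) v = v) :
    v.fn =ᵐ[freqMeasure] resolventMul fun x => 18 * Γ *
      triple selfMask (solitonPoint Γ hs).fn (solitonPoint Γ hs).fn v.fn x := by
  have hsmul := EvenSpace.fn_smul (18 * Γ) (selfCLM hs (solitonPoint Γ hs) (solitonPoint Γ hs) v)
  rw [h] at hsmul
  filter_upwards [hsmul, selfCLM_ae hs (solitonPoint Γ hs) (solitonPoint Γ hs) v] with x hx hx'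
  rw [hx, hx', resolventMul, resolventMul, mul_left_comm]

theorem envelope_eq_zero_of_linearized_fixed {Γ : ℝ} (hΓ : 0 < Γ) (hs : 1 < s) {v : EvenSpace s}
    (h : (18 * Γ) • selfCLM hs (solitonPoint Γ hs) (solitonPoint Γ hs) v = v) (n : ℤ) :
    envelope v.fn n = 0 := by
  set p := solitonPoint Γ hs
  have hv := v.evenL2_fn
  have hg := (wL2_triple_fn hs p p v).const_mul (18 * Γ)
  have henv := envelope_congr (ae_eq_resolventMul_of_linearized_fixed hs h) n
  have hcont := contDiff_envelope_resolventMul hs hg n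
  obtain ⟨M₀, hM₀⟩ := hv.toWL2.exists_norm_envelope_le hs
  obtain ⟨M₁, hM₁⟩ := exists_norm_deriv_envelope_resolventMul_le hs hg n
  have hode : ∀ ζ, deriv (deriv (envelope v.fn n)) ζ = (2 * n + 1 : ℝ) ^ 2 • (envelope v.fn n ζ -
      18 * Γ * (envelope (firstHarmonic (solitonHat Γ)) n ζ ^ 2 * envelope v.fn n ζ)) := fun ζ => by
    rw [henv, deriv_deriv_envelope_resolventMul hs hg n ζ, ← henv, envelope_const_mul,
      envelope_triple_selfMask_fn hs, envelope_congr (solitonPoint_ae Γ hs)]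
    push_cast
    ring_nf
  rw [← henv] at hcont hM₁
  by_cases hn : n = 0 ∨ n = -1
  · refine eq_zero_of_bounded_of_even_of_linearized hcont (hv.envelope_neg n) (hM₀ n) hM₁
      fun ζ => ?_
    have hsq : (2 * n + 1 : ℝ) ^ 2 = 1 := by rcases hn with rfl | rfl <;> norm_num
    have hsol := congrArg (fun t : ℝ => (t : ℂ)) (six_mul_soliton_sq hΓ ζ)
    rw [hode, envelope_soliton Γ hn, hsq, one_smul, Complex.real_smul]
    push_cast at hsol ⊢
    linear_combination -3 * envelope v.fn n ζ * hsol
  · refine eq_zero_of_bounded_of_deriv_deriv_eq (odd_cast_ne_zero n) hcont (fun ζ => ?_) (hM₀ n)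
    rw [hode, envelope_firstHarmonic_of_ne _ hn]
    ring_nf

theorem eq_zero_of_linearized_fixed {Γ : ℝ} (hΓ : 0 < Γ) (hs : 1 < s) {v : EvenSpace s}
    (h : (18 * Γ) • selfCLM hs (solitonPoint Γ hs) (solitonPoint Γ hs) v = v) : v = 0 := by
  have henv_zero := envelope_eq_zero_of_linearized_fixed (v := 0) hΓ hs (by simp only [map_zero,
    smul_zero])
  exact EvenSpace.ext (ae_eq_of_envelope_eq hs v.evenL2_fn.toWL2 (EvenSpace.evenL2_fn 0).toWL2
    fun n => (envelope_eq_zero_of_linearized_fixed hΓ hs h n).trans (henv_zero n).symm)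

/-- The derivative of the system at the soliton with respect to the unknown. -/
def linearization (Γ : ℝ) (hs : 1 < s) : EvenSpace s →L[ℝ] EvenSpace s :=
  ContinuousLinearMap.id ℝ _ -
    (18 * Γ) • selfCLM hs (solitonPoint Γ hs) (solitonPoint Γ hs)

theorem isInvertible_linearization {Γ : ℝ} (hΓ : 0 < Γ) (hs : 1 < s) :
    (linearization Γ hs).IsInvertible := by
  have hcompact : IsCompactOperator
      ((18 * Γ) • selfCLM hs (solitonPoint Γ hs) (solitonPoint Γ hs)) :=
    (isCompactOperator_selfCLM Γ hs).smul (18 * Γ)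
  rcases hcompact.hasEigenvalue_or_mem_resolventSet one_ne_zero with h | h
  · obtain ⟨v, hv⟩ := h.exists_hasEigenvector
    refine absurd (eq_zero_of_linearized_fixed hΓ hs ?_) hv.2
    exact hv.apply_eq_smul.trans (one_smul _ _)
  · rw [spectrum.mem_resolventSet_iff, map_one] at h
    obtain ⟨e, he⟩ := h
    exact ⟨ContinuousLinearEquiv.ofUnit e, he⟩

end

/-! ### Continuation in the parameter -/

section

variable {E F P : Type*} [NormedAddCommGroup E] [NormedSpace ℝ E]
  [NormedAddCommGroup F] [NormedSpace ℝ F] [NormedAddCommGroup P] [NormedSpace ℝ P]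

theorem exists_hasStrictFDerivAt_diagonal (T : E →L[ℝ] E →L[ℝ] E →L[ℝ] F) (u : E) :
    ∃ D : E →L[ℝ] F, HasStrictFDerivAt (fun u => T u u u) D u ∧
      ∀ v, D v = T v u u + T u v u + T u u v := by
  have h := ((T.hasStrictFDerivAt (x := u)).clm_apply (hasStrictFDerivAt_id u)).clm_apply
    (hasStrictFDerivAt_id u)
  refine ⟨_, h, fun v => ?_⟩
  simp only [id_eq, ContinuousLinearMap.comp_id, ContinuousLinearMap.flip_add, add_apply,
    ContinuousLinearMap.flip_apply]
  abel

theorem exists_locally_unique_zero [CompleteSpace E] [CompleteSpace F] [CompleteSpace P]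
    {Φ : P × E → F} {D : P × E →L[ℝ] F} {a : P} {p : E} (hΦ : HasStrictFDerivAt Φ D (a, p))
    (hinv : (D ∘L .inr ℝ P E).IsInvertible) (h0 : Φ (a, p) = 0) :
    ∃ ε₀ > 0, ∃ C > 0, ∃ δ > 0, ∀ t : P, ‖t - a‖ < ε₀ → ∃ f : E,
      Φ (t, f) = 0 ∧ ‖f - p‖ < δ ∧ ‖f - p‖ ≤ C * ‖t - a‖ ∧
        ∀ g : E, Φ (t, g) = 0 → ‖g - p‖ < δ → g = f := by
  have hiff := hΦ.eventually_apply_eq_iff_implicitFunctionOfProdDomain hinv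
  have hderiv := (hΦ.hasStrictFDerivAt_implicitFunctionOfProdDomain hinv).hasFDerivAt
  set ψ := hΦ.implicitFunctionOfProdDomain hinv
  have hψ : ψ a = p := hiff.self_of_nhds.1 rfl
  rw [h0] at hiff
  obtain ⟨δ, hδ, hzero⟩ := Metric.eventually_nhds_iff.1 hiff
  obtain ⟨C, hC⟩ := hderiv.isBigO_sub.bound
  have hlim : Tendsto ψ (𝓝 a) (𝓝 p) := hψ ▸ hderiv.continuousAt.tendsto
  obtain ⟨ε₀, hε₀, hnear⟩ := Metric.eventually_nhds_iff.1
    (hC.and ((hlim.eventually (Metric.ball_mem_nhds p hδ)).and (Metric.ball_mem_nhds a hδ)))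
  refine ⟨ε₀, hε₀, max C 1, by positivity, δ, hδ, fun t ht => ?_⟩
  rw [← dist_eq_norm] at ht
  obtain ⟨hbound, hψt, hta⟩ := hnear ht
  have hzero_iff : ∀ g, ‖g - p‖ < δ → (Φ (t, g) = 0 ↔ ψ t = g) := fun g hg =>
    hzero (y := (t, g)) (max_lt hta ((dist_eq_norm g p).trans_lt hg))
  rw [hψ] at hbound
  have hψt_norm : ‖ψ t - p‖ < δ := by rwa [← dist_eq_norm]
  exact ⟨ψ t, (hzero_iff _ hψt_norm).2 rfl, hψt_norm,
    hbound.trans (mul_le_mul_of_nonneg_right (le_max_left _ _) (norm_nonneg _)), fun g hg hgδ =>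
      ((hzero_iff g hgδ).1 hg).symm⟩

end

section

variable {s : ℝ}

/-- The trilinear map of the coupling between the harmonics. -/
def couplingCLM (hs : 1 < s) :
    EvenSpace s →L[ℝ] EvenSpace s →L[ℝ] EvenSpace s →L[ℝ] EvenSpace s :=
  (3 : ℝ) • interactionCLM hs isMask_pairMask + interactionCLM hs isMask_mixMask

theorem couplingCLM_ae (hs : 1 < s) (f : EvenSpace s) :
    (couplingCLM hs f f f).fn =ᵐ[freqMeasure] resolventMul fun x =>
      3 * triple pairMask f.fn f.fn f.fn x + triple mixMask f.fn f.fn f.fn x := by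
  set g := interactionCLM hs isMask_pairMask f f f with hg
  set h := interactionCLM hs isMask_mixMask f f f with hh
  have hcoupling : couplingCLM hs f f f = (3 : ℝ) • g + h := rfl
  filter_upwards [EvenSpace.fn_add ((3 : ℝ) • g) h, EvenSpace.fn_smul 3 g,
    interactionCLM_ae hs isMask_pairMask f f f,
    interactionCLM_ae hs isMask_mixMask f f f] with x hadd hsmul hpair hmix
  rw [hcoupling, hadd, hsmul, hg, hh, hpair, hmix]
  simp only [interaction, resolventMul]
  ring

/-- The difference of the two sides of the system, in its form as a fixed point equation in the
Hilbert space `EvenSpace s`. -/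
def residual (Γ : ℝ) (hs : 1 < s) (q : ℝ × EvenSpace s) : EvenSpace s :=
  q.2 - ((6 * Γ) • selfCLM hs q.2 q.2 q.2 +
    (2 / 3 * q.1 * Γ) • couplingCLM hs q.2 q.2 q.2)

theorem selfCLM_add_couplingCLM_ae (Γ : ℝ) (hs : 1 < s) (ε : ℝ) (f : EvenSpace s) :
    ((6 * Γ) • selfCLM hs f f f + (2 / 3 * ε * Γ) • couplingCLM hs f f f).fn
      =ᵐ[freqMeasure] resolventMul (nonlinearity Γ ε f.fn) := by
  filter_upwards [EvenSpace.fn_add ((6 * Γ) • selfCLM hs f f f)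
      ((2 / 3 * ε * Γ) • couplingCLM hs f f f), EvenSpace.fn_smul (6 * Γ) (selfCLM hs f f f),
    EvenSpace.fn_smul (2 / 3 * ε * Γ) (couplingCLM hs f f f), selfCLM_ae hs f f f,
    couplingCLM_ae hs f] with x hadd hself hcoupling hself_ae hcoupling_ae
  rw [hadd, hself, hcoupling, hself_ae, hcoupling_ae]
  simp only [resolventMul, nonlinearity]
  ring

theorem residual_eq_zero_iff (Γ : ℝ) (hs : 1 < s) (ε : ℝ) (f : EvenSpace s) :
    residual Γ hs (ε, f) = 0 ↔ f.fn =ᵐ[freqMeasure] resolventMul (nonlinearity Γ ε f.fn) := by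
  have hae := selfCLM_add_couplingCLM_ae Γ hs ε f
  rw [residual, sub_eq_zero]
  refine ⟨fun h => ?_, fun h => EvenSpace.ext (h.trans hae.symm)⟩
  rwa [← h] at hae

theorem residual_soliton {Γ : ℝ} (hΓ : 0 < Γ) (hs : 1 < s) :
    residual Γ hs (0, solitonPoint Γ hs) = 0 := by
  rw [residual_eq_zero_iff]
  have hae := solitonPoint_ae Γ hs
  filter_upwards [hae, soliton_ae_eq_resolventMul hΓ hs] with x hx hx'
  rw [hx, hx']
  simp only [resolventMul, nonlinearity, triple_congr hae hae hae]

theorem exists_hasStrictFDerivAt_residual (Γ : ℝ) (hs : 1 < s) :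
    ∃ D : ℝ × EvenSpace s →L[ℝ] EvenSpace s,
      HasStrictFDerivAt (residual Γ hs) D (0, solitonPoint Γ hs) ∧
        D ∘L .inr ℝ ℝ (EvenSpace s) = linearization Γ hs := by
  set p := solitonPoint Γ hs
  obtain ⟨D₁, hD₁, hD₁_apply⟩ := exists_hasStrictFDerivAt_diagonal (selfCLM hs) p
  obtain ⟨D₂, hD₂, -⟩ := exists_hasStrictFDerivAt_diagonal (couplingCLM hs) p
  have hfst : HasStrictFDerivAt (fun q : ℝ × EvenSpace s => q.1)
    (ContinuousLinearMap.fst ℝ ℝ (EvenSpace s)) (0, p) := hasStrictFDerivAt_fst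
  have hsnd : HasStrictFDerivAt (fun q : ℝ × EvenSpace s => q.2)
    (ContinuousLinearMap.snd ℝ ℝ (EvenSpace s)) (0, p) := hasStrictFDerivAt_snd
  have hself := HasStrictFDerivAt.comp (0, p) (f := fun q : ℝ × EvenSpace s => q.2) hD₁ hsnd
  have hcoupling := HasStrictFDerivAt.comp (0, p) (f := fun q : ℝ × EvenSpace s => q.2) hD₂ hsnd
  refine ⟨_, hsnd.sub ((hself.const_smul (6 * Γ)).add
    (((hfst.const_mul (2 / 3)).mul_const Γ).smul hcoupling)), ?_⟩
  ext1 v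
  simp only [linearization, ContinuousLinearMap.comp_apply, ContinuousLinearMap.inr_apply,
    mul_zero, zero_mul, zero_smul, zero_add, sub_apply, ContinuousLinearMap.coe_snd', add_apply,
    smul_apply, ContinuousLinearMap.smulRight_apply, ContinuousLinearMap.coe_fst', smul_eq_mul,
    add_zero, ContinuousLinearMap.id_apply, sub_right_inj, hD₁_apply]
  rw [selfCLM_swap_left hs v p p, selfCLM_swap_right hs p v p]
  module

theorem exists_branch {Γ : ℝ} (hΓ : 0 < Γ) (hs : 1 < s) :
    ∃ ε₀ > 0, ∃ C > 0, ∃ δ > 0, ∀ ε : ℝ, |ε| < ε₀ → ∃ f : EvenSpace s,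
      residual Γ hs (ε, f) = 0 ∧ ‖f - solitonPoint Γ hs‖ < δ ∧
        ‖f - solitonPoint Γ hs‖ ≤ C * |ε| ∧
        ∀ g : EvenSpace s, residual Γ hs (ε, g) = 0 → ‖g - solitonPoint Γ hs‖ < δ → g = f := by
  obtain ⟨D, hD, hinr⟩ := exists_hasStrictFDerivAt_residual Γ hs
  simpa only [sub_zero, Real.norm_eq_abs] using exists_locally_unique_zero hD
    (hinr ▸ isInvertible_linearization hΓ hs) (residual_soliton hΓ hs)

end

/-! ### From the Fourier side to the fields -/

section

variable {s : ℝ} {u : ℤ × ℝ → ℝ}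

theorem envelope_fn_sub (hs : 1 < s) (f g : EvenSpace s) (n : ℤ) (ζ : ℝ) :
    envelope (f - g).fn n ζ = envelope f.fn n ζ - envelope g.fn n ζ := by
  have hsub : (f - g).fn =ᵐ[freqMeasure] fun x => f.fn x + (-1) * g.fn x := by
    filter_upwards [EvenSpace.fn_sub f g] with x hx
    rw [hx, neg_one_mul, sub_eq_add_neg]
  rw [envelope_congr hsub, envelope_add hs f.evenL2_fn.toWL2
    (g.evenL2_fn.toWL2.const_mul (-1)), envelope_const_mul]
  push_cast
  ring

theorem xNorm_sub_eq (hs : 1 < s) {U V : ℝ → ℝ → ℝ} (hU : Continuous (Function.uncurry U))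
    (hV : Continuous (Function.uncurry V)) {f g : EvenSpace s}
    (hf : ∀ n, mode U (2 * n + 1) = envelope f.fn n)
    (hg : ∀ n, mode V (2 * n + 1) = envelope g.fn n) :
    xNorm s (U - V) = ‖f - g‖ₑ := by
  have hmode : ∀ n, mode (U - V) (2 * n + 1) = envelope (f - g).fn n := fun n => by
    funext ζ
    rw [mode_sub hU hV, hf, hg, envelope_fn_sub hs]
  rw [xNorm_eq_of_mode_eq hs (EvenSpace.evenL2_fn (f - g)).toWL2 hmode, ← EvenSpace.enorm_sq,
    ← ENNReal.rpow_natCast, ← ENNReal.rpow_mul]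
  norm_num

theorem isEvenSolution_field (hs : 1 < s) (hu : EvenL2 s u) {Γ ε : ℝ}
    (h : u =ᵐ[freqMeasure] resolventMul (nonlinearity Γ ε u)) :
    IsEvenSolution s Γ ε (field u) where
  memX :=
    { continuous := hu.toWL2.continuous_field hs
      periodic := field_periodic u
      even_harmonics := fun p hp ζ => hu.mode_field_even hs hp ζ
      norm_lt_top := by
        rw [xNorm_eq_of_mode_eq hs hu.toWL2 (hu.mode_field_odd hs)]
        exact ENNReal.rpow_lt_top_of_nonneg (by norm_num) hu.finite.ne }
  realEnvelopes p ζ := by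
    rcases Int.even_or_odd p with hp | ⟨n, rfl⟩
    · rw [hu.mode_field_even hs hp, hu.mode_field_even hs hp.neg]
      exact ⟨map_zero _, rfl⟩
    · rw [show -(2 * n + 1) = 2 * (-1 - n) + 1 by ring, hu.mode_field_odd hs,
        hu.mode_field_odd hs, hu.envelope_reflect]
      exact ⟨hu.conj_envelope n ζ, rfl⟩
  evenModes p ζ := by
    rcases Int.even_or_odd p with hp | ⟨n, rfl⟩
    · rw [hu.mode_field_even hs hp, hu.mode_field_even hs hp]
    · rw [hu.mode_field_odd hs, hu.envelope_neg]
  solves := (solves_iff hs hu (hu.mode_field_odd hs) Γ ε).2 h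

theorem continuous_monoSoliton (Γ : ℝ) : Continuous (Function.uncurry (monoSoliton Γ)) := by
  rw [← field_soliton]
  exact (evenL2_soliton Γ zero_le_two).toWL2.continuous_field one_lt_two

theorem mode_monoSoliton (Γ : ℝ) (hs : 1 < s) (n : ℤ) :
    mode (monoSoliton Γ) (2 * n + 1) = envelope (solitonPoint Γ hs).fn n := by
  rw [← field_soliton, (evenL2_soliton Γ (zero_le_one.trans hs.le)).mode_field_odd hs,
    envelope_congr (solitonPoint_ae Γ hs)]

theorem xNorm_sub_monoSoliton (Γ : ℝ) (hs : 1 < s) {U : ℝ → ℝ → ℝ}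
    (hU : Continuous (Function.uncurry U)) {f : EvenSpace s}
    (hf : ∀ n, mode U (2 * n + 1) = envelope f.fn n) :
    xNorm s (U - monoSoliton Γ) = ENNReal.ofReal ‖f - solitonPoint Γ hs‖ := by
  rw [xNorm_sub_eq hs hU (continuous_monoSoliton Γ) hf (mode_monoSoliton Γ hs), ofReal_norm]

theorem MemX.eq_of_mode_odd_eq {U V : ℝ → ℝ → ℝ} (hU : MemX s U) (hV : MemX s V)
    (h : ∀ n, mode U (2 * n + 1) = mode V (2 * n + 1)) : U = V := by
  refine eq_of_mode_eq hU.continuous hV.continuous hU.periodic hV.periodic fun p ζ => ?_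
  rcases Int.even_or_odd p with hp | ⟨n, rfl⟩
  · rw [hU.even_harmonics p hp, hV.even_harmonics p hp]
  · rw [h]

theorem continuous_mode {U : ℝ → ℝ → ℝ} (hU : Continuous (Function.uncurry U)) (p : ℤ) :
    Continuous (mode U p) := by
  refine continuous_const.mul
    (intervalIntegral.continuous_parametric_intervalIntegral_of_continuous' ?_ _ _)
  exact (Complex.continuous_ofReal.comp hU).mul (by fun_prop)

theorem exists_residual_eq_zero_of_isEvenSolution (hs : 1 < s) {Γ ε : ℝ} {V : ℝ → ℝ → ℝ}
    (hV : IsEvenSolution s Γ ε V) :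
    ∃ f : EvenSpace s, residual Γ hs (ε, f) = 0 ∧
      ∀ n, mode V (2 * n + 1) = envelope f.fn n := by
  obtain ⟨u, hu, huV⟩ := exists_evenL2_of_modeEnergy hs
    (f := fun n => mode V (2 * n + 1)) (fun n => continuous_mode hV.memX.continuous _)
    (fun n ζ => (hV.realEnvelopes _ ζ).1) (fun n ζ => (hV.evenModes _ ζ).symm)
    (fun n => by
      funext ζ
      rw [show 2 * (-1 - n) + 1 = -(2 * n + 1) by ring]
      exact (hV.realEnvelopes _ ζ).2)
    (by
      have h := hV.memX.norm_lt_top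
      rwa [xNorm_eq_tsum, ENNReal.rpow_lt_top_iff_of_pos (by norm_num)] at h)
  have hfV : ∀ n, mode V (2 * n + 1) = envelope hu.toEvenSpace.fn n := fun n => by
    rw [envelope_congr hu.fn_toEvenSpace, ← huV]
  exact ⟨hu.toEvenSpace, (residual_eq_zero_iff Γ hs ε _).2
    ((solves_iff hs (EvenSpace.evenL2_fn _) hfV Γ ε).1 hV.solves), hfV⟩

end

end XNLS

end

theorem theorem2 (Γ : ℝ) (hΓ : 0 < Γ) (s : ℝ) (hs : 1 < s) :
    ∃ ε₀ > 0, ∃ C > 0, ∃ δ > 0, ∀ ε : ℝ, |ε| < ε₀ →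
      ∃ U : ℝ → ℝ → ℝ,
        XNLS.IsEvenSolution s Γ ε U ∧
        (∀ φ : ℝ, Tendsto (fun ζ => U ζ φ) (cocompact ℝ) (𝓝 0)) ∧
        XNLS.xNorm s (U - XNLS.monoSoliton Γ) < ENNReal.ofReal δ ∧
        XNLS.xNorm s (U - XNLS.monoSoliton Γ) ≤ ENNReal.ofReal (C * |ε|) ∧
        ∀ V : ℝ → ℝ → ℝ, XNLS.IsEvenSolution s Γ ε V →
          XNLS.xNorm s (V - XNLS.monoSoliton Γ) < ENNReal.ofReal δ → V = U := by
  obtain ⟨ε₀, hε₀, C, hC, δ, hδ, hbranch⟩ := XNLS.exists_branch hΓ hs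
  refine ⟨ε₀, hε₀, C, hC, δ, hδ, fun ε hε => ?_⟩
  obtain ⟨f, hf, hfδ, hfC, huniq⟩ := hbranch ε hε
  have hu := f.evenL2_fn
  have hsol := XNLS.isEvenSolution_field hs hu ((XNLS.residual_eq_zero_iff Γ hs ε f).1 hf)
  have hnorm := XNLS.xNorm_sub_monoSoliton Γ hs hsol.memX.continuous (hu.mode_field_odd hs)
  refine ⟨XNLS.field f.fn, hsol, hu.toWL2.tendsto_field hs, ?_, ?_, fun V hV hVδ => ?_⟩
  · rwa [hnorm, ENNReal.ofReal_lt_ofReal_iff hδ]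
  · rw [hnorm]
    exact ENNReal.ofReal_le_ofReal hfC
  · obtain ⟨g, hg, hgV⟩ := XNLS.exists_residual_eq_zero_of_isEvenSolution hs hV
    rw [XNLS.xNorm_sub_monoSoliton Γ hs hV.memX.continuous hgV,
      ENNReal.ofReal_lt_ofReal_iff hδ] at hVδ
    obtain rfl := huniq g hg hVδ
    exact hV.memX.eq_of_mode_odd_eq hsol.memX fun n => by rw [hgV, hu.mode_field_odd hs]
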